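/- Let $\Sigma$ be an alphabet with a fixed (arbitrary) linear order $<$. Let $\widehat{\Sigma^*}$ be the free profinite monoid over $\Sigma$, i.e. the completion of $\Sigma^*$ with respect to the profinite metric ($d(u,u)=0$ and, for $u\neq v$, $d(u,v)=2^{-|M|}$ for a smallest finite monoid $M$ such that some homomorphism $\varphi:\Sigma^*\to M$ has $\varphi(u)\neq\varphi(v)$), with the multiplication $\lim u_k\cdot\lim v_k=\lim u_kv_k$; its elements are called pseudowords. Let $\widehat{\mathbb N}$ be the profinite natural numbers, i.e. the completion of $\mathbb N$ with respect to the analogous metric in which, for $m\neq n$, the distance is $2^{-|M|}$ for a smallest finite monogenic monoid $M$ generated by an element $a$ with $a^m\neq a^n$. Elements of $\widehat{\mathbb N}\setminus\mathbb N$ are called infinite, and $\omega=\lim_k k!\in\widehat{\mathbb N}$. For $\alpha=\lim u_k\in\widehat{\Sigma^*}$ and $\hat n=\lim n_k\in\widehat{\mathbb N}$ let $\alpha^{\hat n}=\lim u_k^{n_k}$, let $|\alpha|_a=\lim|u_k|_a\in\widehat{\mathbb N}$ for $a\in\Sigma$ (where $|u|_a$ is the number of occurrences of $a$ in the word $u$),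 and let $\mathrm{alph}(\alpha)\subseteq\Sigma$ be the eventual value of the set of letters occurring in $u_k$. Let $\mathbf{DAb}$ be the class of all finite monoids in which every regular $\mathcal D$-class (i.e. every $\mathcal D$-class containing an idempotent) forms an Abelian group. For pseudowords $\alpha,\beta$ write $\mathbf{DAb}\models\alpha=\beta$ if $\varphi(\alpha)=\varphi(\beta)$ for every $M\in\mathbf{DAb}$ and every continuous homomorphism $\varphi:\widehat{\Sigma^*}\to M$ ($M$ discrete). An infinite block is a pseudoword of the form $(a_1\cdots a_\ell)^\omega a_1^{\hat n_1}\cdots a_\ell^{\hat n_\ell}$ with $\ell>0$, letters $a_1<\dots<a_\ell$ in $\Sigma$ and infinite $\hat n_1,\dots,\hat n_\ell\in\widehat{\mathbb N}\setminus\mathbb N$. A pseudoword $\alpha$ is in normal form if it can be written as $\alpha=\alpha_1\cdots\alpha_L$ with $L\ge 0$ such that each $\alpha_i$ is either a letter or an infinite block for which * (c-1) $\mathrm{alph}(\alpha_{i-1})\setminus\mathrm{alph}(\alpha_i)\neq\emptyset$ (if $1<i$) and $\mathrm{alph}(\alpha_{i+1})\setminus\mathrm{alph}(\alpha_i)\neq\emptyset$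 (if $i<L$), and * (c-2) if $1<i$, then $|\alpha_i|_a=\omega$ for every $a\in\mathrm{alph}(\alpha_{i-1})\cap\mathrm{alph}(\alpha_i)$. **Theorem.** For every pseudoword $\alpha\in\widehat{\Sigma^*}$ there is a unique pseudoword $\alpha'\in\widehat{\Sigma^*}$ in normal form with $\mathbf{DAb}\models\alpha=\alpha'$. -/

import Mathlib

open Filter Topology UniformSpace

/-! ### Profinite metric and completion -/

/-- Some homomorphism from `N` to a finite monoid with exactly `n` elements separates `u` and `v`.
(Every finite monoid has an isomorphic copy in `Type`.) -/
def SeparatedBy {N : Type*} [Monoid N] (n : ℕ) (u v : N) : Prop :=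
  ∃ (M : Type) (_ : Monoid M) (_ : Finite M), Nat.card M = n ∧ ∃ φ : N →* M, φ u ≠ φ v

/-- Distinct elements can be separated by a homomorphism to a finite monoid. -/
class ResiduallyFiniteMonoid (N : Type*) [Monoid N] : Prop where
  exists_separatedBy : ∀ u v : N, u ≠ v → ∃ n, SeparatedBy n u v

/-- The profinite distance: `0` if `u = v`, and otherwise `2 ^ (-|M|)` for a smallest finite
monoid `M` such that some homomorphism `N → M` separates `u` and `v`. -/
noncomputable def profiniteDist {N : Type*} [Monoid N] (u v : N) : ℝ :=
  open Classical in
  if u = v then 0 else (2⁻¹ : ℝ) ^ sInf {n : ℕ | SeparatedBy n u v}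

section ProfiniteDist

variable {N : Type*} [Monoid N]

theorem SeparatedBy.ne {n : ℕ} {u v : N} (h : SeparatedBy n u v) : u ≠ v := by
  rintro rfl
  obtain ⟨M, _, _, _, φ, hφ⟩ := h
  exact hφ rfl

theorem SeparatedBy.symm {n : ℕ} {u v : N} (h : SeparatedBy n u v) : SeparatedBy n v u := by
  obtain ⟨M, i, j, hc, φ, hφ⟩ := h
  exact ⟨M, i, j, hc, φ, hφ.symm⟩

theorem SeparatedBy.le_profiniteDist {n : ℕ} {u v : N} (h : SeparatedBy n u v) :
    (2⁻¹ : ℝ) ^ n ≤ profiniteDist u v := by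
  rw [profiniteDist, if_neg h.ne]
  exact pow_le_pow_of_le_one (by norm_num) (by norm_num) (Nat.sInf_le h)

theorem profiniteDist_nonneg (u v : N) : 0 ≤ profiniteDist u v := by
  rw [profiniteDist]
  split_ifs <;> positivity

theorem exists_separatedBy_profiniteDist_eq [ResiduallyFiniteMonoid N] {u v : N} (h : u ≠ v) :
    ∃ n, SeparatedBy n u v ∧ profiniteDist u v = (2⁻¹ : ℝ) ^ n :=
  ⟨_, Nat.sInf_mem (ResiduallyFiniteMonoid.exists_separatedBy u v h), by
    rw [profiniteDist, if_neg h]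
    rfl⟩

theorem profiniteDist_le_max {N₁ N₂ : Type*} [Monoid N₁] [Monoid N₂] [ResiduallyFiniteMonoid N]
    {x y : N} {u v : N₁} {u' v' : N₂}
    (h : ∀ n, SeparatedBy n x y → SeparatedBy n u v ∨ SeparatedBy n u' v') :
    profiniteDist x y ≤ max (profiniteDist u v) (profiniteDist u' v') := by
  by_cases hxy : x = y
  · rw [profiniteDist, if_pos hxy]
    exact le_max_of_le_left (profiniteDist_nonneg _ _)
  · obtain ⟨n, hn, hd⟩ := exists_separatedBy_profiniteDist_eq hxy
    rw [hd]
    rcases h n hn with h | h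
    · exact le_max_of_le_left h.le_profiniteDist
    · exact le_max_of_le_right h.le_profiniteDist

end ProfiniteDist

/-- The monoid `N`, as a metric space with the profinite distance. -/
def WithProfinite (N : Type*) : Type _ := N

instance {N : Type*} [Monoid N] : Monoid (WithProfinite N) := inferInstanceAs (Monoid N)

/-- The identity map from `WithProfinite N` to `N`. -/
def ofProfinite {N : Type*} [Monoid N] : WithProfinite N ≃* N := MulEquiv.refl N

/-- The identity map from `N` to `WithProfinite N`. -/
def toProfinite {N : Type*} [Monoid N] : N ≃* WithProfinite N := MulEquiv.refl N

noncomputable instance {N : Type*} [Monoid N] [ResiduallyFiniteMonoid N] :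
    MetricSpace (WithProfinite N) where
  dist u v := profiniteDist (ofProfinite u) (ofProfinite v)
  dist_self u := if_pos rfl
  dist_comm u v := by
    have (a b : N) : profiniteDist a b ≤ profiniteDist b a := by
      simpa using profiniteDist_le_max (x := a) (y := b) (u := b) (v := a) (u' := b) (v' := a)
        fun n hn => Or.inl hn.symm
    exact le_antisymm (this _ _) (this _ _)
  dist_triangle u v w := by
    refine (profiniteDist_le_max (u := ofProfinite u) (v := ofProfinite v)
      (u' := ofProfinite v) (v' := ofProfinite w) ?_).trans (max_le_add_of_nonneg (profiniteDist_nonneg _ _) (profiniteDist_nonneg _ _))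
    rintro n ⟨M, i, j, hc, φ, hφ⟩
    by_cases h : φ (ofProfinite u) = φ (ofProfinite v)
    · exact Or.inr ⟨M, i, j, hc, φ, fun h' => hφ (h.trans h')⟩
    · exact Or.inl ⟨M, i, j, hc, φ, h⟩
  eq_of_dist_eq_zero {u v} h := by
    by_contra hne
    obtain ⟨n, -, hd⟩ := exists_separatedBy_profiniteDist_eq (ofProfinite.injective.ne hne)
    have h0 : profiniteDist (ofProfinite u) (ofProfinite v) = 0 := h
    rw [hd] at h0
    exact absurd h0 (by positivity)

theorem dist_eq_profiniteDist {N : Type*} [Monoid N] [ResiduallyFiniteMonoid N]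
    (u v : WithProfinite N) : dist u v = profiniteDist (ofProfinite u) (ofProfinite v) := rfl

/-- The profinite completion of `N`: the completion with respect to the profinite distance. -/
abbrev ProfiniteCompl (N : Type*) [Monoid N] [ResiduallyFiniteMonoid N] : Type _ :=
  Completion (WithProfinite N)

namespace ProfiniteCompl

variable {N N' : Type*} [Monoid N] [ResiduallyFiniteMonoid N]
  [Monoid N'] [ResiduallyFiniteMonoid N']

/-- The inclusion of `N` in its profinite completion. -/
noncomputable def of (u : N) : ProfiniteCompl N := ((toProfinite u : WithProfinite N) : Completion (WithProfinite N))

theorem uniformContinuous_mul :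
    UniformContinuous₂ fun u v : WithProfinite N => u * v := by
  rw [UniformContinuous₂, Metric.uniformContinuous_iff]
  rintro ε hε
  refine ⟨ε, hε, ?_⟩
  rintro ⟨u, u'⟩ ⟨v, v'⟩ h
  refine lt_of_le_of_lt (profiniteDist_le_max (u := ofProfinite u) (v := ofProfinite v)
    (u' := ofProfinite u') (v' := ofProfinite v') ?_) h
  rintro n ⟨M, i, j, hc, φ, hφ⟩
  by_cases h : φ (ofProfinite u) = φ (ofProfinite v)
  · refine Or.inr ⟨M, i, j, hc, φ, fun h' => hφ ?_⟩
    change φ (ofProfinite (u * u')) = φ (ofProfinite (v * v'))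
    rw [map_mul, map_mul, map_mul, map_mul, h, h']
  · exact Or.inl ⟨M, i, j, hc, φ, h⟩

/-- Multiplication of limits: `lim uₖ * lim vₖ = lim (uₖ * vₖ)`. -/
noncomputable instance : Mul (ProfiniteCompl N) where
  mul := Completion.map₂ fun u v : WithProfinite N => u * v

noncomputable instance : One (ProfiniteCompl N) where
  one := (1 : WithProfinite N)

theorem continuous_mul : Continuous fun p : ProfiniteCompl N × ProfiniteCompl N => p.1 * p.2 :=
  Completion.continuous_map₂ continuous_fst continuous_snd

theorem coe_mul (u v : WithProfinite N) :
    ((u * v : WithProfinite N) : ProfiniteCompl N) = (u : ProfiniteCompl N) * v :=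
  (Completion.map₂_coe_coe u v _ uniformContinuous_mul).symm

theorem of_mul (u v : N) : of (u * v) = of u * of v := by
  rw [of, map_mul, coe_mul]
  rfl

noncomputable instance : Monoid (ProfiniteCompl N) where
  mul_assoc a b c := by
    refine Completion.induction_on₃ a b c (isClosed_eq ?_ ?_) fun u v w => ?_
    · exact continuous_mul.comp ((continuous_mul.comp
        (continuous_fst.prodMk (continuous_fst.comp continuous_snd))).prodMk
          (continuous_snd.comp continuous_snd))
    · exact continuous_mul.comp (continuous_fst.prodMk (continuous_mul.comp continuous_snd))
    · simp only [← coe_mul, mul_assoc]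
  one_mul a := by
    refine Completion.induction_on a (isClosed_eq ?_ continuous_id) fun u => ?_
    · exact continuous_mul.comp (continuous_const.prodMk continuous_id)
    · exact (coe_mul 1 u).symm.trans (congrArg _ (one_mul u))
  mul_one a := by
    refine Completion.induction_on a (isClosed_eq ?_ continuous_id) fun u => ?_
    · exact continuous_mul.comp (continuous_id.prodMk continuous_const)
    · exact (coe_mul u 1).symm.trans (congrArg _ (mul_one u))

/-- The continuous extension of a homomorphism: `lim uₖ ↦ lim (f uₖ)`. -/
noncomputable def map (f : N →* N') : ProfiniteCompl N → ProfiniteCompl N' :=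
  Completion.map fun u : WithProfinite N => toProfinite (f (ofProfinite u))

theorem uniformContinuous_hom (f : N →* N') :
    UniformContinuous fun u : WithProfinite N => toProfinite (f (ofProfinite u)) := by
  rw [Metric.uniformContinuous_iff]
  refine fun ε hε => ⟨ε, hε, fun {u v} h => lt_of_le_of_lt ?_ h⟩
  have := profiniteDist_le_max (x := f (ofProfinite u)) (y := f (ofProfinite v))
    (u := ofProfinite u) (v := ofProfinite v) (u' := ofProfinite u) (v' := ofProfinite v) ?_
  · rwa [max_self] at this
  · rintro n ⟨M, i, j, hc, φ, hφ⟩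
    exact Or.inl ⟨M, i, j, hc, φ.comp f, hφ⟩

theorem map_of (f : N →* N') (u : N) : map f (of u) = of (f u) :=
  Completion.map_coe (uniformContinuous_hom f) _

end ProfiniteCompl

/-! ### Profinite natural numbers -/

/-- For `m ≠ n` there is a finite cyclic group with an element `a` such that `a ^ m ≠ a ^ n`. -/
instance : ResiduallyFiniteMonoid (Multiplicative ℕ) where
  exists_separatedBy u v h := by
    refine ⟨_, Multiplicative (ZMod (u.toAdd + v.toAdd + 1)), inferInstance, inferInstance, rfl,
      AddMonoidHom.toMultiplicative (Nat.castAddMonoidHom _), fun h' => h ?_⟩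
    have h1 : ((u.toAdd : ℕ) : ZMod (u.toAdd + v.toAdd + 1)) = (v.toAdd : ℕ) := h'
    rw [ZMod.natCast_eq_natCast_iff'] at h1
    rw [Nat.mod_eq_of_lt (by omega), Nat.mod_eq_of_lt (by omega)] at h1
    exact h1

/-- The profinite natural numbers: the completion of `(ℕ, +)` with respect to the distance which
is `2 ^ (-|M|)` for `m ≠ n`, where `M` is a smallest finite monoid with an element `a` such that
`a ^ m ≠ a ^ n` (a smallest such `M` is monogenic, generated by `a`). The additive monoid `ℕ` is
written multiplicatively here, so a homomorphism to `M` is the map `n ↦ a ^ n` for some `a`. -/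
abbrev ProfiniteNat : Type := ProfiniteCompl (Multiplicative ℕ)

namespace ProfiniteNat

/-- The inclusion of the natural numbers in the profinite natural numbers. -/
noncomputable def ofNat (n : ℕ) : ProfiniteNat := ProfiniteCompl.of (Multiplicative.ofAdd n)

/-- A profinite natural number is infinite if it is not a natural number. -/
def IsInfinite (n : ProfiniteNat) : Prop := n ∉ Set.range ofNat

/-- `ω = lim k!`. -/
noncomputable def omega : ProfiniteNat := limUnder atTop fun k : ℕ => ofNat k.factorial

theorem pow_factorial_eq {M : Type*} [Monoid M] [Finite M] (a : M) {k l : ℕ}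
    (hk : Nat.card M ≤ k) (hl : Nat.card M ≤ l) : a ^ k.factorial = a ^ l.factorial := by
  have := Fintype.ofFinite M
  obtain ⟨x, y, hxy, he⟩ := Fintype.exists_ne_map_eq_of_card_lt
    (fun i : Fin (Nat.card M + 1) => a ^ (i : ℕ)) (by simp [Nat.card_eq_fintype_card])
  wlog hlt : (x : ℕ) < y generalizing x y
  · exact this y x hxy.symm he.symm
      (lt_of_le_of_ne (not_lt.1 hlt) fun h => hxy (Fin.ext h.symm))
  obtain ⟨p, hp⟩ : ∃ p, (y : ℕ) = x + p := ⟨y - x, by omega⟩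
  have he' : a ^ (x : ℕ) = a ^ ((x : ℕ) + p) := by rw [← hp]; exact he
  have hstep : ∀ t, a ^ ((x : ℕ) + p * t) = a ^ (x : ℕ) := by
    intro t
    induction t with
    | zero => simp
    | succ t ih =>
      rw [Nat.mul_succ, show (x : ℕ) + (p * t + p) = (x + p) + p * t by ring, pow_add, ← he',
        ← pow_add, ih]
  have hyM := y.2
  have key : ∀ k, Nat.card M ≤ k → ∃ t, k.factorial = p * t ∧ (x : ℕ) ≤ p * t := by
    intro k hk
    obtain ⟨t, ht⟩ := Nat.dvd_factorial (show 0 < p by omega) (show p ≤ k by omega)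
    exact ⟨t, ht, ht ▸ (show (x : ℕ) ≤ k by omega).trans (Nat.self_le_factorial k)⟩
  have mono : ∀ s t, s ≤ t → (x : ℕ) ≤ p * s → a ^ (p * t) = a ^ (p * s) := by
    intro s t hst hs
    obtain ⟨d, rfl⟩ := Nat.exists_eq_add_of_le hst
    obtain ⟨r, hr⟩ := Nat.exists_eq_add_of_le hs
    rw [show p * (s + d) = (x + p * d) + r by rw [Nat.mul_add, hr]; ring, pow_add, hstep,
      ← pow_add, ← hr]
  obtain ⟨s, hs, hs'⟩ := key k hk
  obtain ⟨t, ht, ht'⟩ := key l hl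
  rw [hs, ht]
  rcases le_total s t with h | h
  · exact (mono s t h hs').symm
  · exact mono t s h ht'

theorem tendsto_omega : Tendsto (fun k : ℕ => ofNat k.factorial) atTop (𝓝 omega) := by
  refine CauchySeq.tendsto_limUnder ?_
  refine UniformContinuous.comp_cauchySeq (Completion.uniformContinuous_coe _)
    (u := fun k : ℕ => toProfinite (Multiplicative.ofAdd k.factorial)) ?_
  rw [Metric.cauchySeq_iff]
  intro ε hε
  obtain ⟨n, hn⟩ := exists_pow_lt_of_lt_one hε (show (2⁻¹ : ℝ) < 1 by norm_num)
  refine ⟨n, fun k hk l hl => ?_⟩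
  change profiniteDist (Multiplicative.ofAdd k.factorial) (Multiplicative.ofAdd l.factorial) < ε
  by_cases hkl : Multiplicative.ofAdd k.factorial = Multiplicative.ofAdd l.factorial
  · rw [profiniteDist, if_pos hkl]
    exact hε
  · obtain ⟨m, ⟨M, _, _, hc, φ, hφ⟩, hd⟩ := exists_separatedBy_profiniteDist_eq hkl
    rw [hd]
    refine lt_of_le_of_lt (pow_le_pow_of_le_one (by norm_num) (by norm_num) ?_) hn
    by_contra! hlt
    refine hφ ?_
    have hpow : ∀ j : ℕ, φ (Multiplicative.ofAdd j) = φ (Multiplicative.ofAdd 1) ^ j := by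
      intro j
      rw [← map_pow, ← ofAdd_nsmul, smul_eq_mul, mul_one]
    rw [hpow k.factorial, hpow l.factorial]
    have hk' : n ≤ k := hk
    have hl' : n ≤ l := hl
    exact pow_factorial_eq (k := k) (l := l) (φ (Multiplicative.ofAdd 1)) (by omega) (by omega)

end ProfiniteNat

/-! ### The free profinite monoid -/

/-- For a word `u`, the words which are suffixes of `u` are the states of a finite automaton that
separates `u` from all other words. -/
instance {A : Type*} : ResiduallyFiniteMonoid (FreeMonoid A) where
  exists_separatedBy u v h := by
    classical
    let S : Type _ := Option {l : List A // l <:+ u.toList}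
    have hfin : Finite {l : List A // l <:+ u.toList} :=
      Set.Finite.subset (u.toList.tails.toFinset.finite_toSet) fun l hl => by
        simpa using (show l <:+ u.toList from hl)
    let act : A → Function.End S := fun c s => s.bind fun l =>
      if h : c :: l.1 <:+ u.toList then some ⟨c :: l.1, h⟩ else none
    let φ : FreeMonoid A →* Function.End S := FreeMonoid.lift act
    have hφ : ∀ w : List A, φ (FreeMonoid.ofList w) (some ⟨[], List.nil_suffix⟩) =
        if h : w <:+ u.toList then some ⟨w, h⟩ else none := by
      intro w
      induction w with
      | nil =>
        rw [dif_pos List.nil_suffix, FreeMonoid.ofList_nil, map_one]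
        rfl
      | cons c w ih =>
        have : φ (FreeMonoid.ofList (c :: w)) = act c * φ (FreeMonoid.ofList w) := by
          rw [FreeMonoid.ofList_cons, map_mul]
          simp [φ]
        rw [this]
        change act c (φ (FreeMonoid.ofList w) _) = _
        rw [ih]
        by_cases hw : w <:+ u.toList
        · simp [act, hw]
        · have hcw : ¬ c :: w <:+ u.toList := fun h => hw ((List.suffix_cons c w).trans h)
          simp [act, hw, hcw]
    have hfinS : Finite S := inferInstanceAs (Finite (Option _))
    have hfinE : Finite (Function.End S) := inferInstanceAs (Finite (S → S))
    let e : Function.End S ≃* Shrink.{0} (Function.End S) := Shrink.mulEquiv.symm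
    refine ⟨_, Shrink.{0} (Function.End S), inferInstance, inferInstance, rfl,
      e.toMonoidHom.comp φ, fun h' => h ?_⟩
    have h1 : φ u = φ v := e.injective h'
    have h2 := congrFun h1 (some ⟨[], List.nil_suffix⟩)
    have hu := hφ u.toList
    have hv := hφ v.toList
    rw [FreeMonoid.ofList_toList] at hu hv
    rw [hu, hv, dif_pos (List.suffix_refl _)] at h2
    split_ifs at h2 with hvu
    exact FreeMonoid.toList.injective (congrArg Subtype.val (Option.some.inj h2))

/-- The free profinite monoid over the alphabet `A`; its elements are the pseudowords. -/
abbrev Pseudoword (A : Type*) : Type _ := ProfiniteCompl (FreeMonoid A)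

namespace Pseudoword

variable {A : Type*}

/-- A letter, as a pseudoword. -/
noncomputable def letter (a : A) : Pseudoword A := ProfiniteCompl.of (FreeMonoid.of a)

/-- The power `α ^ n` with a profinite natural number as exponent:
`(lim uₖ) ^ (lim nₖ) = lim (uₖ ^ nₖ)`. -/
noncomputable def pow (α : Pseudoword A) (n : ProfiniteNat) : Pseudoword A :=
  Completion.map₂ (fun (u : WithProfinite (FreeMonoid A)) (n : WithProfinite (Multiplicative ℕ)) =>
    u ^ Multiplicative.toAdd (ofProfinite n)) α n

theorem uniformContinuous_pow :
    UniformContinuous₂ fun (u : WithProfinite (FreeMonoid A))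
      (n : WithProfinite (Multiplicative ℕ)) =>
        u ^ Multiplicative.toAdd (ofProfinite n) := by
  rw [UniformContinuous₂, Metric.uniformContinuous_iff]
  rintro ε hε
  refine ⟨ε, hε, ?_⟩
  rintro ⟨u, m⟩ ⟨v, n⟩ h
  refine lt_of_le_of_lt (profiniteDist_le_max (u := ofProfinite u) (v := ofProfinite v)
    (u' := ofProfinite m) (v' := ofProfinite n) ?_) h
  rintro k ⟨M, i, j, hc, φ, hφ⟩
  by_cases h : φ (ofProfinite u) = φ (ofProfinite v)
  · refine Or.inr ⟨M, i, j, hc, powersHom M (φ (ofProfinite v)), fun h' => hφ ?_⟩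
    rw [powersHom_apply, powersHom_apply] at h'
    change φ (ofProfinite (u ^ Multiplicative.toAdd (ofProfinite m))) =
      φ (ofProfinite (v ^ Multiplicative.toAdd (ofProfinite n)))
    rw [map_pow, map_pow, map_pow, map_pow, h, h']
  · exact Or.inl ⟨M, i, j, hc, φ, h⟩

theorem pow_of (u : FreeMonoid A) (n : ℕ) :
    pow (ProfiniteCompl.of u) (ProfiniteNat.ofNat n) = ProfiniteCompl.of (u ^ n) :=
  Completion.map₂_coe_coe _ _ _ uniformContinuous_pow

open Classical in
/-- The number of occurrences of the letter `a`, as a homomorphism on words. -/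
noncomputable def countHom (a : A) : FreeMonoid A →* Multiplicative ℕ :=
  FreeMonoid.lift fun b => Multiplicative.ofAdd (if b = a then 1 else 0)

/-- The number of occurrences of the letter `a` in a pseudoword: `|lim uₖ|ₐ = lim |uₖ|ₐ`. -/
noncomputable def count (a : A) : Pseudoword A → ProfiniteNat := ProfiniteCompl.map (countHom a)

/-- The set of letters which occur in a word. -/
def wordAlphabet (w : WithProfinite (FreeMonoid A)) : Set A :=
  {a | a ∈ (ofProfinite w).toList}

/-- The alphabet of a pseudoword: the continuous extension of the map which assigns to a word the
set of letters occurring in it (where the set of all subsets of `A` is discrete). -/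
noncomputable def alphabet : Pseudoword A → Set A :=
  letI : UniformSpace (Set A) := ⊥
  Completion.extension wordAlphabet

theorem wordAlphabet_eq_of_dist_lt (u v : WithProfinite (FreeMonoid A))
    (h : dist u v < (2⁻¹ : ℝ) ^ 2) : wordAlphabet u = wordAlphabet v := by
  classical
  by_contra hne
  obtain ⟨a, ha⟩ : ∃ a, ¬ (a ∈ wordAlphabet u ↔ a ∈ wordAlphabet v) := by
    by_contra! hall
    exact hne (Set.ext hall)
  let φ : FreeMonoid A →* ZMod 2 := FreeMonoid.lift fun b => if b = a then 0 else 1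
  have hφ : ∀ w : WithProfinite (FreeMonoid A), a ∈ wordAlphabet w ↔ φ (ofProfinite w) = 0 := by
    intro w
    change a ∈ FreeMonoid.toList _ ↔ _
    rw [FreeMonoid.lift_apply, List.prod_eq_zero_iff]
    simp
  refine absurd h (not_lt.2 (SeparatedBy.le_profiniteDist (n := 2)
    ⟨ZMod 2, inferInstance, inferInstance, by simp, φ, fun h' => ha ?_⟩))
  rw [hφ, hφ, h']

theorem alphabet_of (w : FreeMonoid A) :
    alphabet (ProfiniteCompl.of w) = {a | a ∈ w.toList} := by
  let _ : UniformSpace (Set A) := ⊥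
  have : DiscreteUniformity (Set A) := ⟨rfl⟩
  have : DiscreteTopology (Set A) := inferInstance
  refine Completion.extension_coe (β := Set A) (f := wordAlphabet) ?_ (toProfinite w)
  rw [UniformContinuous, DiscreteUniformity.eq_principal_setRelId (X := Set A), tendsto_principal]
  filter_upwards [Metric.dist_mem_uniformity (show (0 : ℝ) < 2⁻¹ ^ 2 by norm_num)] with p hp
  exact wordAlphabet_eq_of_dist_lt p.1 p.2 hp

end Pseudoword

/-! ### Finite monoids whose regular `𝓓`-classes form Abelian groups -/

section Green

variable {M : Type*} [Monoid M]

/-- Green's relation `𝓛`. -/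
def GreenL (s t : M) : Prop := (∃ x, x * s = t) ∧ ∃ x, s = x * t

/-- Green's relation `𝓡`. -/
def GreenR (s t : M) : Prop := (∃ y, s * y = t) ∧ ∃ y, s = t * y

/-- Green's relation `𝓓`: a finite chain of `𝓛`- and `𝓡`-steps. -/
def GreenD : M → M → Prop := Relation.ReflTransGen fun s t => GreenL s t ∨ GreenR s t

/-- The subset `D` of the monoid `M` forms an Abelian group under the multiplication of `M` (its
neutral element need not be `1`). -/
def FormsAbelianGroup (D : Set M) : Prop :=
  (∀ x ∈ D, ∀ y ∈ D, x * y ∈ D) ∧ (∀ x ∈ D, ∀ y ∈ D, x * y = y * x) ∧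
    ∃ e ∈ D, (∀ x ∈ D, e * x = x) ∧ ∀ x ∈ D, ∃ y ∈ D, x * y = e

end Green

/-- The variety `DAb`: finite monoids in which every regular `𝓓`-class, i.e. every `𝓓`-class that
contains an idempotent, forms an Abelian group. -/
structure IsDAb (M : Type*) [Monoid M] : Prop where
  finite : Finite M
  formsAbelianGroup : ∀ s : M, (∃ e : M, GreenD s e ∧ e * e = e) →
    FormsAbelianGroup {t : M | GreenD s t}

/-- The monoid `M` satisfies the equation `α = β`: all continuous homomorphisms from the free
profinite monoid to the discrete monoid `M` agree on `α` and `β`. -/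
def Satisfies {A : Type*} (M : Type*) [Monoid M] (α β : Pseudoword A) : Prop :=
  ∀ φ : Pseudoword A →* M, (letI : TopologicalSpace M := ⊥; Continuous φ) → φ α = φ β

/-- `DAb ⊨ α = β`. (Every finite monoid has an isomorphic copy in `Type`.) -/
def DAbSatisfies {A : Type*} (α β : Pseudoword A) : Prop :=
  ∀ (M : Type) [Monoid M], IsDAb M → Satisfies M α β

/-! ### The normal form -/

section NormalForm

open Pseudoword ProfiniteNat

variable {A : Type*}

/-- An infinite block `(a₁ ⋯ a_ℓ)^ω a₁^{n₁} ⋯ a_ℓ^{n_ℓ}` with `ℓ > 0`, letters `a₁ < ⋯ < a_ℓ` and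
infinite profinite natural numbers `n₁, …, n_ℓ`. -/
def IsInfiniteBlock [LinearOrder A] (α : Pseudoword A) : Prop :=
  ∃ (ℓ : ℕ) (a : Fin ℓ → A) (n : Fin ℓ → ProfiniteNat),
    0 < ℓ ∧ StrictMono a ∧ (∀ j, IsInfinite (n j)) ∧
      α = pow (List.ofFn fun j => letter (a j)).prod omega *
        (List.ofFn fun j => pow (letter (a j)) (n j)).prod

/-- A pseudoword is in normal form if it is a (possibly empty) product of blocks, each of which is
a letter or an infinite block that satisfies the following conditions with respect to its
neighbours: every neighbour contains a letter which is not in the infinite block, and every letter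
that the infinite block shares with its left neighbour occurs exactly `ω` times in it. -/
def IsNormalForm [LinearOrder A] (α : Pseudoword A) : Prop :=
  ∃ (L : ℕ) (b : Fin L → Pseudoword A), α = (List.ofFn b).prod ∧
    ∀ i, (∃ a, b i = letter a) ∨
      (IsInfiniteBlock (b i) ∧
        (∀ j : Fin L, (j : ℕ) + 1 = i ∨ (i : ℕ) + 1 = j →
          (alphabet (b j) \ alphabet (b i)).Nonempty) ∧
        ∀ j : Fin L, (j : ℕ) + 1 = i →
          ∀ a ∈ alphabet (b j) ∩ alphabet (b i), count a (b i) = omega)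

end NormalForm

/-! ### Finite quotients of a profinite completion -/

namespace ProfiniteCompl

/-! Existence rests on one reduction. Let `l` list finitely many letters, and suppose that for every
`k` the pseudoword α is a limit of words over `l` that begin with `k` factors each containing all of
`l` (`Full`). In a monoid of `DAb`, a word with enough such factors absorbs the idempotent power of
the product of `l`. This idempotent commutes with the letters of `l`, and next to it these letters
commute with each other. Hence α equals, in `DAb`, the infinite block over `l` whose exponents are
the letter counts of α (`Full.dAbSatisfies`). If α is not of this kind, it is a limit of words with
a bounded number of full factors. Cutting a word after its shortest prefix containing all letters
gives x·b·y with b absent from x. Since pseudowords over finitely many letters form a compact set,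
the cut passes to the limit, and an induction on the alphabet and on the number of factors writes α
as a product of blocks (`isBlockProduct`).

An infinite block absorbs any neighbour whose letters it contains, because the product is again
`Full`. Merging such neighbours gives the alphabet conditions. Shared letters are then moved from an
infinite block into the infinite block on its left, leaving exponent ω behind; doing so from right
to left gives the condition on counts.

Uniqueness needs enough monoids of `DAb`. A product of blocks in normal form and a modulus m define
a language: the words whose letters can be labelled by block indices, monotonically, so that each
piece uses the letters of its block, contains a key word of at most two letters telling it apart
from infinite neighbours, is short if the block is a letter, and has prescribed prefix counts modulo
m, except for letters common to the two blocks at the cut. This exception makes the language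
insensitive to permutations inside long powers, so its syntactic monoid lies in `DAb`
(`BlockPattern.eventually_mem_lang_iff`).

If two normal forms agree in `DAb`, then words approximating either one lie in the language of the
other. The labellings give monotone maps between the two index sets that only enlarge blocks.
Incomparability of neighbours forces these maps to be identities (`eq_self_of_subset`,
`IsNormalProduct.same_blocks`), so the blocks agree up to exponents. Prefix counts agree wherever
they are prescribed; a shared letter has the same residue in the right-hand block of both forms (ω
has residue 0), so all counts follow by moving back from the end (`IsNormalProduct.res_eq`). An
infinite profinite number is determined by its residues
(`ProfiniteNat.IsInfinite.eq_of_residue_eq`). -/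

theorem apply_eq_of_profiniteDist_lt {N : Type*} [Monoid N] {M : Type} [Monoid M] [Finite M]
    (ψ : N →* M) {u v : N} (h : profiniteDist u v < (2⁻¹ : ℝ) ^ Nat.card M) : ψ u = ψ v := by
  by_contra hne
  exact absurd h (not_lt.2 (SeparatedBy.le_profiniteDist
    ⟨M, inferInstance, inferInstance, rfl, ψ, hne⟩))

section General

variable {N : Type*} [Monoid N] [ResiduallyFiniteMonoid N]

theorem dist_of (u v : N) : dist (of u) (of v) = profiniteDist u v :=
  Completion.dist_eq _ _

theorem of_one : of (1 : N) = 1 := rfl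

theorem denseRange_of : DenseRange (of : N → ProfiniteCompl N) :=
  Completion.denseRange_coe (α := WithProfinite N)

theorem exists_tendsto_of (α : ProfiniteCompl N) :
    ∃ g : ℕ → N, Tendsto (fun k => of (g k)) atTop (𝓝 α) := by
  obtain ⟨x, hx, hlim⟩ := mem_closure_iff_seq_limit.1 (denseRange_of α)
  choose g hg using hx
  exact ⟨g, by simpa only [hg] using hlim⟩

instance : ContinuousMul (ProfiniteCompl N) := ⟨continuous_mul⟩

theorem exists_continuous_extension {M : Type} [Monoid M] [Finite M] (ψ : N →* M) :
    ∃ φ : ProfiniteCompl N →* M, (letI : TopologicalSpace M := ⊥; Continuous φ) ∧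
      ∀ u, φ (of u) = ψ u := by
  let _ : UniformSpace M := ⊥
  have : DiscreteUniformity M := ⟨rfl⟩
  have : DiscreteTopology M := inferInstance
  let f : WithProfinite N → M := fun u => ψ (ofProfinite u)
  have hf : UniformContinuous f := by
    rw [UniformContinuous, DiscreteUniformity.eq_principal_setRelId (X := M), tendsto_principal]
    filter_upwards [Metric.dist_mem_uniformity
      (show (0 : ℝ) < 2⁻¹ ^ Nat.card M by positivity)] with p hp
    exact apply_eq_of_profiniteDist_lt ψ hp
  have hc : Continuous (Completion.extension f) := Completion.continuous_extension
  have he : ∀ u : WithProfinite N, Completion.extension f (u : ProfiniteCompl N) = f u :=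
    Completion.extension_coe hf
  refine ⟨⟨⟨Completion.extension f, ?_⟩, ?_⟩, hc, he⟩
  · exact (he 1).trans (map_one ψ)
  · intro a b
    refine Completion.induction_on₂ a b (isClosed_eq ?_ ?_) fun u v => ?_
    · exact hc.comp continuous_mul
    · exact (hc.comp continuous_fst).mul (hc.comp continuous_snd)
    · change Completion.extension f ((u : ProfiniteCompl N) * v) =
        Completion.extension f (u : ProfiniteCompl N) * Completion.extension f (v : ProfiniteCompl N)
      rw [← coe_mul, he, he, he]
      exact map_mul ψ _ _

/-- The continuous extension of a homomorphism to a finite monoid. -/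
noncomputable def lift {M : Type} [Monoid M] [Finite M] (ψ : N →* M) : ProfiniteCompl N →* M :=
  (exists_continuous_extension ψ).choose

theorem continuous_lift {M : Type} [Monoid M] [Finite M] (ψ : N →* M) :
    letI : TopologicalSpace M := ⊥; Continuous (lift ψ) :=
  (exists_continuous_extension ψ).choose_spec.1

theorem lift_of {M : Type} [Monoid M] [Finite M] (ψ : N →* M) (u : N) : lift ψ (of u) = ψ u :=
  (exists_continuous_extension ψ).choose_spec.2 u

theorem eventually_eq_of_continuous {X M ι : Type*} [TopologicalSpace X] {f : X → M}
    (hf : letI : TopologicalSpace M := ⊥; Continuous f) {F : Filter ι} {g : ι → X} {x : X}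
    (h : Tendsto g F (𝓝 x)) : ∀ᶠ i in F, f (g i) = f x := by
  let _ : TopologicalSpace M := ⊥
  have : DiscreteTopology M := ⟨rfl⟩
  have := (hf.tendsto x).comp h
  rwa [nhds_discrete, tendsto_pure] at this

theorem isClosed_eq_discrete {X M : Type*} [TopologicalSpace X] {f g : X → M}
    (hf : letI : TopologicalSpace M := ⊥; Continuous f)
    (hg : letI : TopologicalSpace M := ⊥; Continuous g) : IsClosed {x | f x = g x} := by
  let _ : TopologicalSpace M := ⊥
  have : DiscreteTopology M := ⟨rfl⟩
  exact isClosed_eq hf hg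

theorem eventually_lift_eq {ι : Type*} {M : Type} [Monoid M] [Finite M] (ψ : N →* M)
    {F : Filter ι} {g : ι → N} {α : ProfiniteCompl N} (h : Tendsto (fun i => of (g i)) F (𝓝 α)) :
    ∀ᶠ i in F, ψ (g i) = lift ψ α := by
  filter_upwards [eventually_eq_of_continuous (continuous_lift ψ) h] with i hi
  rw [← hi, lift_of]

/-- Words close to α and β take the values of α and β in every small monoid. If these values agree,
only large monoids can separate the words, so the words are close to each other. -/
theorem ext_lift {α β : ProfiniteCompl N}
    (h : ∀ (M : Type) [Monoid M] [Finite M] (ψ : N →* M), lift ψ α = lift ψ β) : α = β := by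
  obtain ⟨u, hu⟩ := exists_tendsto_of α
  obtain ⟨v, hv⟩ := exists_tendsto_of β
  refine eq_of_forall_dist_le fun ε hε => ?_
  -- The triangle inequality will bound the distance by 2⁻ⁿ/2 + 2⁻ⁿ + 2⁻ⁿ/2, so 2⁻ⁿ < ε/4 is more
  -- than enough.
  obtain ⟨n, hn⟩ := exists_pow_lt_of_lt_one (half_pos (half_pos hε))
    (show (2⁻¹ : ℝ) < 1 by norm_num)
  have hpos : (0 : ℝ) < 2⁻¹ ^ n / 2 := by positivity
  obtain ⟨k, hku, hkv⟩ := ((Metric.tendsto_nhds.1 hu _ hpos).and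
    (Metric.tendsto_nhds.1 hv _ hpos)).exists
  have key : ∀ {γ : ProfiniteCompl N} {w : ℕ → N} (_ : Tendsto (fun k => of (w k)) atTop (𝓝 γ))
      {k : ℕ} (_ : dist (of (w k)) γ < 2⁻¹ ^ n / 2) (M : Type) [Monoid M] [Finite M] (ψ : N →* M),
      Nat.card M ≤ n → ψ (w k) = lift ψ γ := by
    intro γ w hw k hk M _ _ ψ hM
    obtain ⟨j, hj, hj'⟩ := ((Metric.tendsto_nhds.1 hw _ hpos).and (eventually_lift_eq ψ hw)).exists
    rw [← hj']
    refine apply_eq_of_profiniteDist_lt ψ ?_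
    rw [← dist_of]
    calc dist (of (w k)) (of (w j)) ≤ dist (of (w k)) γ + dist (of (w j)) γ :=
          dist_triangle_right _ _ _
      _ < 2⁻¹ ^ n := by linarith
      _ ≤ 2⁻¹ ^ Nat.card M := pow_le_pow_of_le_one (by norm_num) (by norm_num) hM
  have huv : dist (of (u k)) (of (v k)) ≤ 2⁻¹ ^ n := by
    rw [dist_of]
    by_cases he : u k = v k
    · rw [profiniteDist, if_pos he]
      positivity
    · obtain ⟨m, ⟨M, _, _, hM, ψ, hψ⟩, hd⟩ := exists_separatedBy_profiniteDist_eq he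
      rw [hd]
      refine pow_le_pow_of_le_one (by norm_num) (by norm_num) ?_
      by_contra! hlt
      exact hψ (by rw [key hu hku M ψ (by omega), key hv hkv M ψ (by omega), h M ψ])
  have h1 : dist α β ≤ dist (of (u k)) α + dist (of (u k)) (of (v k)) + dist (of (v k)) β := by
    have := dist_triangle4 α (of (u k)) (of (v k)) β
    rwa [dist_comm α (of (u k))] at this
  have : (0 : ℝ) ≤ 2⁻¹ ^ n := by positivity
  linarith

theorem continuous_map {N' : Type*} [Monoid N'] [ResiduallyFiniteMonoid N'] (f : N →* N') :
    Continuous (map f) :=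
  Completion.continuous_map

theorem map_mul_apply {N' : Type*} [Monoid N'] [ResiduallyFiniteMonoid N'] (f : N →* N')
    (α β : ProfiniteCompl N) : map f (α * β) = map f α * map f β := by
  refine Completion.induction_on₂ α β (isClosed_eq ?_ ?_) fun u v => ?_
  · exact (continuous_map f).comp continuous_mul
  · exact ((continuous_map f).comp continuous_fst).mul ((continuous_map f).comp continuous_snd)
  · change map f (of (ofProfinite u) * of (ofProfinite v)) =
      map f (of (ofProfinite u)) * map f (of (ofProfinite v))
    rw [← of_mul, map_of, map_of, map_of, map_mul, of_mul]

end General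

end ProfiniteCompl

/-! ### Infinite profinite natural numbers and their residues -/

namespace ProfiniteNat

open ProfiniteCompl

theorem hom_ofAdd {M : Type*} [Monoid M] (ψ : Multiplicative ℕ →* M) (n : ℕ) :
    ψ (Multiplicative.ofAdd n) = ψ (Multiplicative.ofAdd 1) ^ n := by
  rw [← map_pow, ← ofAdd_nsmul, smul_eq_mul, mul_one]

theorem ofNat_add (m n : ℕ) : ofNat (m + n) = ofNat m * ofNat n := by
  rw [ofNat, ofAdd_add, of_mul]
  rfl

theorem ofNat_zero : ofNat 0 = 1 := rfl

theorem exists_tendsto_ofNat (n : ProfiniteNat) :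
    ∃ ν : ℕ → ℕ, Tendsto (fun k => ofNat (ν k)) atTop (𝓝 n) :=
  exists_tendsto_of n

/-- A counter that stops at n + 1 tells n from every other number. So natural numbers are isolated
points, and sequences converging to an infinite number must tend to infinity. -/
theorem isOpen_singleton_ofNat (n : ℕ) : IsOpen {ofNat n} := by
  let M := Function.End (Fin (n + 2))
  have hM : Finite M := inferInstanceAs (Finite (Fin (n + 2) → Fin (n + 2)))
  let s : M := fun i => ⟨min (i + 1) (n + 1), by omega⟩
  let ψ : Multiplicative ℕ →* M := powersHom M s
  have hs : ∀ j : ℕ, (((s ^ j : M) 0 : Fin (n + 2)) : ℕ) = min j (n + 1) := by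
    intro j
    induction j with
    | zero => rfl
    | succ j ih =>
      rw [pow_succ']
      change min (((s ^ j : M) 0 : Fin (n + 2)) + 1 : ℕ) (n + 1) = _
      rw [ih]
      omega
  have hψ : ∀ j : ℕ, ψ (Multiplicative.ofAdd j) = s ^ j := fun j => rfl
  have key : ∀ j : ℕ, s ^ j = s ^ n → j = n := by
    intro j hj
    have := hs j
    rw [hj, hs n] at this
    omega
  have heq : {ofNat n} = {x : ProfiniteNat | lift ψ x = s ^ n} := by
    refine Set.Subset.antisymm ?_ fun x hx => ?_
    · rintro x rfl
      exact (lift_of ψ _).trans (hψ n)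
    · obtain ⟨ν, hν⟩ := exists_tendsto_ofNat x
      have h1 := eventually_lift_eq ψ hν
      have h2 : ∀ᶠ k in atTop, ofNat (ν k) = ofNat n := by
        filter_upwards [h1] with k hk
        rw [key (ν k) ((hψ _).symm.trans (hk.trans hx))]
      exact tendsto_nhds_unique hν (tendsto_const_nhds.congr' (h2.mono fun _ h => h.symm))
  rw [heq]
  let _ : TopologicalSpace M := ⊥
  have : DiscreteTopology M := ⟨rfl⟩
  exact (isOpen_discrete {s ^ n}).preimage (continuous_lift ψ)

theorem ofNat_injective : Function.Injective ofNat := by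
  intro m n h
  have h1 := congrArg (lift (AddMonoidHom.toMultiplicative (Nat.castAddMonoidHom (ZMod (m + n + 1))))) h
  rw [ofNat, ofNat, lift_of, lift_of] at h1
  have h2 : ((m : ℕ) : ZMod (m + n + 1)) = n := h1
  rw [ZMod.natCast_eq_natCast_iff'] at h2
  rwa [Nat.mod_eq_of_lt (by omega), Nat.mod_eq_of_lt (by omega)] at h2

theorem IsInfinite.eventually_ge {n : ProfiniteNat} (hn : IsInfinite n) {ι : Type*} {F : Filter ι}
    {ν : ι → ℕ} (h : Tendsto (fun k => ofNat (ν k)) F (𝓝 n)) (b : ℕ) : ∀ᶠ k in F, b ≤ ν k := by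
  have hcl : IsClosed (ofNat '' Set.Iio b) := ((Set.finite_Iio b).image _).isClosed
  have hmem : (ofNat '' Set.Iio b)ᶜ ∈ 𝓝 n := by
    refine hcl.isOpen_compl.mem_nhds ?_
    rintro ⟨m, -, rfl⟩
    exact hn ⟨m, rfl⟩
  filter_upwards [h.eventually hmem] with k hk
  by_contra! hlt
  exact hk ⟨ν k, hlt, rfl⟩

theorem isInfinite_of_tendsto {n : ProfiniteNat} {ν : ℕ → ℕ}
    (h : Tendsto (fun k => ofNat (ν k)) atTop (𝓝 n)) (hν : Tendsto ν atTop atTop) :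
    IsInfinite n := by
  rintro ⟨m, rfl⟩
  have h1 := h.eventually ((isOpen_singleton_ofNat m).mem_nhds rfl)
  obtain ⟨k, hk, hk'⟩ := (h1.and (hν.eventually_gt_atTop m)).exists
  exact hk'.ne' (ofNat_injective hk)

theorem tendsto_factorial : Tendsto Nat.factorial atTop atTop :=
  tendsto_atTop_mono Nat.self_le_factorial tendsto_id

theorem isInfinite_omega : IsInfinite omega :=
  isInfinite_of_tendsto tendsto_omega tendsto_factorial

theorem IsInfinite.mul_left {n : ProfiniteNat} (hn : IsInfinite n) (m : ProfiniteNat) :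
    IsInfinite (m * n) := by
  obtain ⟨μ, hμ⟩ := exists_tendsto_ofNat m
  obtain ⟨ν, hν⟩ := exists_tendsto_ofNat n
  refine isInfinite_of_tendsto (ν := fun k => μ k + ν k) ?_ ?_
  · simp only [ofNat_add]
    exact hμ.mul hν
  · exact tendsto_atTop_mono (fun k => Nat.le_add_left _ _)
      (tendsto_atTop.2 fun b => hn.eventually_ge hν b)

/-- The residue of a profinite natural number. -/
noncomputable def residue (m : ℕ) [NeZero m] (n : ProfiniteNat) : ZMod m :=
  (lift (AddMonoidHom.toMultiplicative (Nat.castAddMonoidHom (ZMod m))) n).toAdd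

theorem residue_mul (m : ℕ) [NeZero m] (n n' : ProfiniteNat) :
    residue m (n * n') = residue m n + residue m n' := by
  rw [residue, map_mul]
  rfl

theorem eventually_residue_eq (m : ℕ) [NeZero m] {ι : Type*} {F : Filter ι} {n : ProfiniteNat}
    {ν : ι → ℕ} (h : Tendsto (fun k => ofNat (ν k)) F (𝓝 n)) :
    ∀ᶠ k in F, (ν k : ZMod m) = residue m n := by
  filter_upwards [eventually_lift_eq
    (AddMonoidHom.toMultiplicative (Nat.castAddMonoidHom (ZMod m))) h] with k hk
  exact congrArg Multiplicative.toAdd hk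

theorem residue_omega (m : ℕ) [NeZero m] : residue m omega = 0 := by
  obtain ⟨k, hk, hk'⟩ := ((eventually_residue_eq m tendsto_omega).and (eventually_ge_atTop m)).exists
  rw [← hk, ZMod.natCast_eq_zero_iff]
  exact Nat.dvd_factorial (NeZero.pos m) hk'

end ProfiniteNat

/-! ### Powers in a finite monoid -/

theorem exists_pow_mul_pow_self (M : Type*) [Monoid M] [Finite M] :
    ∃ n, 0 < n ∧ ∀ x : M, x ^ n * x ^ n = x ^ n := by
  have key : ∀ x : M, ∃ n, 0 < n ∧ x ^ n * x ^ n = x ^ n := by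
    intro x
    obtain ⟨i, j, hij, h⟩ := Finite.exists_ne_map_eq_of_infinite fun i : ℕ => x ^ i
    wlog hlt : i < j generalizing i j
    · exact this j i hij.symm h.symm (by omega)
    obtain ⟨p, rfl⟩ := Nat.exists_eq_add_of_lt hlt
    have h1 : ∀ t, x ^ (i + (p + 1) * t) = x ^ i := by
      intro t
      induction t with
      | zero => simp
      | succ t ih =>
        rw [show i + (p + 1) * (t + 1) = (i + p + 1) + (p + 1) * t by ring, pow_add]
        have h' : x ^ i = x ^ (i + p + 1) := h
        rw [← h', ← pow_add, ih]
    -- This exponent is a multiple of the period p + 1 and is at least the index i.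
    refine ⟨(p + 1) * (i + 1), by positivity, ?_⟩
    rw [← pow_add]
    have : (p + 1) * (i + 1) = i + (p * (i + 1) + 1) := by ring
    calc x ^ ((p + 1) * (i + 1) + (p + 1) * (i + 1))
        = x ^ (i + (p + 1) * (i + 1)) * x ^ (p * (i + 1) + 1) := by rw [← pow_add]; congr 1; ring
      _ = x ^ ((p + 1) * (i + 1)) := by rw [h1, ← pow_add, this]
  choose n hn h using key
  have := Fintype.ofFinite M
  refine ⟨∏ x, n x, Finset.prod_pos fun x _ => hn x, fun x => ?_⟩
  obtain ⟨t, ht⟩ := Finset.dvd_prod_of_mem n (Finset.mem_univ x)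
  have := (IsIdempotentElem.pow t (h x : IsIdempotentElem (x ^ n x)))
  rw [ht, pow_mul]
  exact this

theorem pow_mul_eq_pow_of_idempotent {M : Type*} [Monoid M] {x : M} {n : ℕ}
    (h : x ^ n * x ^ n = x ^ n) {t : ℕ} (ht : 0 < t) : x ^ (n * t) = x ^ n := by
  rw [pow_mul]
  exact IsIdempotentElem.pow_eq (show IsIdempotentElem (x ^ n) from h) (by omega)

theorem pow_eq_pow_of_natCast_eq {M : Type*} [Monoid M] {x : M} {n a b : ℕ}
    (h : x ^ n * x ^ n = x ^ n) (ha : n ≤ a) (hb : n ≤ b) (hab : (a : ZMod n) = b) :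
    x ^ a = x ^ b := by
  wlog hle : a ≤ b generalizing a b
  · exact (this hb ha hab.symm (by omega)).symm
  rw [ZMod.natCast_eq_natCast_iff] at hab
  obtain ⟨t, ht⟩ := (Nat.modEq_iff_dvd' hle).1 hab
  obtain ⟨c, rfl⟩ := Nat.exists_eq_add_of_le ha
  have hb : b = n * (t + 1) + c := by
    have : b = n * t + (n + c) := by omega
    rw [this]; ring
  rw [hb, pow_add, pow_add, pow_mul_eq_pow_of_idempotent h (by omega)]

namespace ProfiniteNat

open ProfiniteCompl

/-- If all N-th powers in a finite monoid are idempotent, then an exponent that is at least N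
matters only modulo N. -/
theorem IsInfinite.eq_of_residue_eq {n n' : ProfiniteNat} (hn : IsInfinite n) (hn' : IsInfinite n')
    (h : ∀ (m : ℕ) [NeZero m], residue m n = residue m n') : n = n' := by
  refine ext_lift fun M _ _ ψ => ?_
  obtain ⟨N, hN, hidem⟩ := exists_pow_mul_pow_self M
  have : NeZero N := ⟨hN.ne'⟩
  obtain ⟨ν, hν⟩ := exists_tendsto_ofNat n
  obtain ⟨ν', hν'⟩ := exists_tendsto_ofNat n'
  obtain ⟨k, h1, h2, h3⟩ := ((eventually_lift_eq ψ hν).and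
    ((hn.eventually_ge hν N).and (eventually_residue_eq N hν))).exists
  obtain ⟨k', h1', h2', h3'⟩ := ((eventually_lift_eq ψ hν').and
    ((hn'.eventually_ge hν' N).and (eventually_residue_eq N hν'))).exists
  rw [← h1, ← h1', hom_ofAdd, hom_ofAdd ψ (ν' k')]
  exact pow_eq_pow_of_natCast_eq (hidem _) h2 h2' (by rw [h3, h3', h])

/-- The product is addition of numbers, and ω has residue 0 for every modulus. -/
theorem IsInfinite.omega_mul {n : ProfiniteNat} (hn : IsInfinite n) : omega * n = n :=
  (hn.mul_left _).eq_of_residue_eq hn fun m _ => by rw [residue_mul, residue_omega, zero_add]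

end ProfiniteNat

/-! ### Counts, alphabets and powers of pseudowords -/

namespace Pseudoword

open ProfiniteCompl ProfiniteNat

variable {A : Type*}

theorem continuous_pow : Continuous fun p : Pseudoword A × ProfiniteNat => pow p.1 p.2 :=
  Completion.continuous_map₂ continuous_fst continuous_snd

theorem continuous_count (a : A) : Continuous (count a) := ProfiniteCompl.continuous_map _

theorem count_mul (a : A) (α β : Pseudoword A) : count a (α * β) = count a α * count a β :=
  ProfiniteCompl.map_mul_apply _ _ _

open Classical in
theorem count_of (a : A) (w : FreeMonoid A) : count a (of w) = ofNat (w.toList.count a) := by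
  rw [count, map_of, ofNat]
  congr 1
  induction w using FreeMonoid.inductionOn' with
  | one => rfl
  | of_mul b w ih =>
    rw [map_mul, ih, FreeMonoid.toList_of_mul, List.count_cons, countHom,
      FreeMonoid.lift_eval_of, ← ofAdd_add, add_comm]
    simp

theorem continuous_alphabet :
    letI : TopologicalSpace (Set A) := ⊥; Continuous (alphabet : Pseudoword A → Set A) := by
  let _ : UniformSpace (Set A) := ⊥
  have : DiscreteUniformity (Set A) := ⟨rfl⟩
  exact Completion.continuous_extension

theorem eventually_alphabet_eq {ι : Type*} {F : Filter ι} {g : ι → FreeMonoid A}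
    {α : Pseudoword A} (h : Tendsto (fun i => of (g i)) F (𝓝 α)) :
    ∀ᶠ i in F, {a | a ∈ (g i).toList} = alphabet α := by
  filter_upwards [eventually_eq_of_continuous continuous_alphabet h] with i hi
  rw [← hi, alphabet_of]

theorem alphabet_letter (a : A) : alphabet (letter a) = {a} := by
  rw [letter, alphabet_of]
  ext b
  simp

theorem tendsto_pow {ι : Type*} {F : Filter ι} {g : ι → FreeMonoid A} {ν : ι → ℕ}
    {α : Pseudoword A} {n : ProfiniteNat} (hg : Tendsto (fun i => of (g i)) F (𝓝 α))
    (hν : Tendsto (fun i => ofNat (ν i)) F (𝓝 n)) :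
    Tendsto (fun i => of (g i ^ ν i)) F (𝓝 (pow α n)) := by
  simp only [← pow_of]
  exact (continuous_pow.tendsto (α, n)).comp (hg.prodMk_nhds hν)

end Pseudoword

/-! ### An equational criterion for membership in `DAb` -/

section FiniteMonoid

variable {M : Type*} [Monoid M]

/-- The elements of the group of units of the local monoid `e * M * e`. -/
def localUnits (e : M) : Set M := {t | e * t = t ∧ t * e = t ∧ ∃ t', t * t' = e ∧ t' * t = e}

theorem self_mem_localUnits {e : M} (he : e * e = e) : e ∈ localUnits e :=
  ⟨he, he, e, he, he⟩

theorem mul_mem_localUnits {e s t : M} (hs : s ∈ localUnits e) (ht : t ∈ localUnits e) :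
    s * t ∈ localUnits e := by
  obtain ⟨hs1, hs2, s', hs3, hs4⟩ := hs
  obtain ⟨ht1, ht2, t', ht3, ht4⟩ := ht
  refine ⟨by rw [← mul_assoc, hs1], by rw [mul_assoc, ht2], t' * s', ?_, ?_⟩
  · rw [mul_assoc, ← mul_assoc t, ht3, ← mul_assoc, hs2, hs3]
  · rw [mul_assoc, ← mul_assoc s', hs4, ht1, ht4]

/-- A left inverse q and a right inverse p' agree after cutting down by e, since q * e = q * p * p'
= e * p'. -/
theorem mem_localUnits_of_mul_eq {e p q p' : M} (hep : e * p = p) (hpe : p * e = p)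
    (hqp : q * p = e) (hpp : p * p' = e) : p ∈ localUnits e := by
  refine ⟨hep, hpe, q * e, ?_, by rw [mul_assoc, hep, hqp]⟩
  have : q * e = e * p' := by rw [← hpp, ← mul_assoc, hqp, hpp]
  rw [this, ← mul_assoc, hpe, hpp]

theorem GreenL.of_mul_eq {s t x y : M} (h : x * s = t) (h' : y * t = s) : GreenL s t :=
  ⟨⟨x, h⟩, y, h'.symm⟩

theorem GreenR.of_mul_eq {s t x y : M} (h : s * x = t) (h' : t * y = s) : GreenR s t :=
  ⟨⟨x, h⟩, y, h'.symm⟩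

theorem greenD_symm {s t : M} (h : GreenD s t) : GreenD t s := by
  induction h with
  | refl => exact .refl
  | tail _ h ih =>
    refine .head ?_ ih
    rcases h with ⟨⟨x, hx⟩, y, hy⟩ | ⟨⟨x, hx⟩, y, hy⟩
    · exact Or.inl (.of_mul_eq hy.symm hx)
    · exact Or.inr (.of_mul_eq hy.symm hx)

theorem GreenL.greenD {s t : M} (h : GreenL s t) : GreenD s t := .single (Or.inl h)

theorem GreenR.greenD {s t : M} (h : GreenR s t) : GreenD s t := .single (Or.inr h)

theorem mul_pow_mul_comm (x y : M) (n : ℕ) : (x * y) ^ n * x = x * (y * x) ^ n := by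
  induction n with
  | zero => simp
  | succ n ih => rw [pow_succ', mul_assoc, ih, pow_succ']; simp only [mul_assoc]

/-- The identity turns a one-sided inverse along an 𝓛- or 𝓡-step into a two-sided one, so no step
leaves the unit group at e. -/
theorem greenD_mem_localUnits {n : ℕ} (hn : 0 < n) (h : ∀ x y : M, (x * y) ^ n = (y * x) ^ n)
    {e : M} (he : e * e = e) {s : M} (hs : GreenD e s) : s ∈ localUnits e := by
  have hen : e ^ n = e := IsIdempotentElem.pow_eq (show IsIdempotentElem e from he) hn.ne'
  obtain ⟨k, rfl⟩ : ∃ k, n = k + 1 := ⟨n - 1, by omega⟩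
  induction hs with
  | refl => exact self_mem_localUnits he
  | @tail t r _ htr ih =>
    obtain ⟨ht1, ht2, t', ht3, ht4⟩ := ih
    rcases htr with ⟨⟨x, hx⟩, y, hy⟩ | ⟨⟨x, hx⟩, y, hy⟩
    · have hre : r * e = r := by rw [← hx, mul_assoc, ht2]
      have hq : (t' * y) * r = e := by rw [mul_assoc, ← hy, ht4]
      -- With q = t' * y, q * r = e is idempotent, so the identity carries it over to the power of r
      -- * q.
      have hpow : (r * (t' * y)) ^ (k + 1) = e := by rw [h, hq, hen]
      have her : e * r = r := by
        rw [← hpow, mul_pow_mul_comm, hq, hen, hre]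
      refine mem_localUnits_of_mul_eq her hre hq (p' := (t' * y) * (r * (t' * y)) ^ k) ?_
      rw [← mul_assoc, ← pow_succ', hpow]
    · have her : e * r = r := by rw [← hx, ← mul_assoc, ht1]
      have hq : r * (y * t') = e := by rw [← mul_assoc, ← hy, ht3]
      have hpow : ((y * t') * r) ^ (k + 1) = e := by rw [h, hq, hen]
      have hre : r * e = r := by
        rw [← hpow, ← mul_pow_mul_comm, hq, hen, her]
      refine mem_localUnits_of_mul_eq her hre (q := ((y * t') * r) ^ k * (y * t')) ?_ hq
      rw [mul_assoc, ← pow_succ, hpow]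

/-- The first identity makes each regular 𝓓-class the unit group of an idempotent. In such a group
some multiple of n kills every element, so the second identity reduces to commutativity. -/
theorem isDAb_of_pow_eq [Finite M] {n : ℕ} (hn : 0 < n) (h1 : ∀ x y : M, (x * y) ^ n = (y * x) ^ n)
    (h2 : ∀ x y : M, (x * y) ^ n * (x * y) = (x * y) ^ n * (y * x)) : IsDAb M := by
  refine ⟨inferInstance, ?_⟩
  rintro s ⟨e, hse, he⟩
  have hset : {t : M | GreenD s t} = localUnits e := by
    ext t
    refine ⟨fun ht => greenD_mem_localUnits hn h1 he ((greenD_symm hse).trans ht), ?_⟩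
    rintro ⟨ht1, ht2, t', ht3, ht4⟩
    exact hse.trans (GreenL.of_mul_eq ht2 ht4).greenD
  rw [hset]
  refine ⟨fun x hx y hy => mul_mem_localUnits hx hy, fun x hx y hy => ?_,
    e, self_mem_localUnits he, fun x hx => hx.1, ?_⟩
  · obtain ⟨k, hk, hidem⟩ := exists_pow_mul_pow_self M
    have hone : ∀ z ∈ localUnits e, z ^ (n * k) = e := by
      intro z hz
      have hz' : z ^ (n * k) * z ^ (n * k) = z ^ (n * k) := by
        rw [mul_comm n, pow_mul]
        exact IsIdempotentElem.pow n (hidem z)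
      have hmem : ∀ j, z ^ (j + 1) ∈ localUnits e := by
        intro j
        induction j with
        | zero => simpa using hz
        | succ j ih => rw [pow_succ]; exact mul_mem_localUnits ih hz
      obtain ⟨j, hj⟩ : ∃ j, n * k = j + 1 := ⟨n * k - 1, by have := Nat.mul_pos hn hk; omega⟩
      rw [hj] at hz' ⊢
      obtain ⟨h3, h4, w, h5, h6⟩ := hmem j
      rw [← h5]
      nth_rewrite 2 [← hz']
      rw [mul_assoc, h5, h4]
    have hxy := mul_mem_localUnits hx hy
    have hyx := mul_mem_localUnits hy hx
    obtain ⟨j, rfl⟩ : ∃ j, k = j + 1 := ⟨k - 1, by omega⟩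
    have hsplit : (x * y) ^ (n * (j + 1)) = (x * y) ^ (n * j) * (x * y) ^ n := by
      rw [← pow_add]; rfl
    rw [← hxy.1, ← hyx.1, ← hone _ hxy, hsplit, mul_assoc, h2, ← mul_assoc]
  · rintro x ⟨hx1, hx2, x', hx3, hx4⟩
    refine ⟨e * x' * e, ⟨?_, ?_, x, ?_, ?_⟩, ?_⟩
    · simp only [← mul_assoc, he]
    · simp only [mul_assoc, he]
    · rw [mul_assoc, hx1, mul_assoc, hx4, he]
    · rw [← mul_assoc, ← mul_assoc, hx2, hx3, he]
    · rw [← mul_assoc, ← mul_assoc, hx2, hx3, he]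

theorem IsDAb.of_mulEquiv {M' : Type*} [Monoid M'] (f : M ≃* M') [Finite M] {n : ℕ} (hn : 0 < n)
    (h1 : ∀ x y : M, (x * y) ^ n = (y * x) ^ n)
    (h2 : ∀ x y : M, (x * y) ^ n * (x * y) = (x * y) ^ n * (y * x)) : IsDAb M' := by
  have : Finite M' := Finite.of_equiv M f.toEquiv
  refine isDAb_of_pow_eq hn (fun x y => f.symm.injective ?_) fun x y => f.symm.injective ?_
  · simpa using h1 _ _
  · simpa using h2 _ _

/-! ### Idempotents in monoids of `DAb` -/

namespace IsDAb

/-- A group contains only one idempotent. -/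
theorem eq_of_greenD (hM : IsDAb M) {e f : M} (he : e * e = e) (hf : f * f = f)
    (h : GreenD e f) : e = f := by
  obtain ⟨-, hcomm, d, hd, hd1, hd2⟩ := hM.formsAbelianGroup e ⟨e, .refl, he⟩
  have key : ∀ g ∈ {t : M | GreenD e t}, g * g = g → g = d := by
    intro g hg hgg
    obtain ⟨y, hy, hgy⟩ := hd2 g hg
    rw [← hgy]
    nth_rewrite 2 [← hgg]
    rw [mul_assoc, hgy, hcomm g hg d hd, hd1 g hg]
  rw [key e .refl he, key f h hf]

theorem mul_comm_of_greenD (hM : IsDAb M) {e s t : M} (he : e * e = e) (hs : GreenD e s)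
    (ht : GreenD e t) : s * t = t * s :=
  (hM.formsAbelianGroup e ⟨e, .refl, he⟩).2.1 s hs t ht

theorem mul_idempotent_of_greenD (hM : IsDAb M) {e s : M} (he : e * e = e) (hs : GreenD e s) :
    e * s = s := by
  obtain ⟨-, hcomm, d, hd, hd1, hd2⟩ := hM.formsAbelianGroup e ⟨e, .refl, he⟩
  obtain ⟨y, hy, hey⟩ := hd2 e .refl
  have : e = d := by
    rw [← hey]
    nth_rewrite 2 [← he]
    rw [mul_assoc, hey, hcomm e .refl d hd, hd1 e .refl]
  rw [this, hd1 s hs]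

theorem idempotent_mul_of_greenD (hM : IsDAb M) {e s : M} (he : e * e = e) (hs : GreenD e s) :
    s * e = s := by
  rw [← hM.mul_comm_of_greenD he .refl hs, hM.mul_idempotent_of_greenD he hs]

/-- An idempotent power absorbs the factors of its base. -/
theorem greenD_mul (hM : IsDAb M) {n : ℕ} (hn : 0 < n) (hidem : ∀ x : M, x ^ n * x ^ n = x ^ n)
    (x b y : M) : GreenD ((x * b * y) ^ n) ((x * b * y) ^ n * b) ∧
      GreenD ((x * b * y) ^ n) (b * (x * b * y) ^ n) := by
  -- The two idempotents are linked through v * (u * v)ⁿ, which is 𝓛-related to one and 𝓡-related to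
  -- the other. Conjugating the base then brings b to its end or its beginning.
  have hconj : ∀ u v : M, (u * v) ^ n = (v * u) ^ n := by
    intro u v
    refine hM.eq_of_greenD (hidem _) (hidem _) ?_
    obtain ⟨k, rfl⟩ : ∃ k, n = k + 1 := ⟨n - 1, by omega⟩
    have h1 : v * (u * v) ^ (k + 1) = (v * u) ^ (k + 1) * v := (mul_pow_mul_comm v u _).symm
    have h2 : (v * u) ^ (k + 1) * (v * (u * (v * u) ^ k)) = (v * u) ^ (k + 1) := by
      rw [← mul_assoc v, ← pow_succ', hidem]
    refine (GreenL.of_mul_eq (x := v) (y := u * (v * u) ^ k) rfl ?_).greenD.trans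
      (GreenR.of_mul_eq (x := u * (v * u) ^ k) (y := v) ?_ h1.symm).greenD
    · rw [← mul_assoc, mul_assoc u, mul_pow_mul_comm v u, ← mul_assoc, ← pow_succ', hidem]
    · rw [h1, mul_assoc, h2]
  obtain ⟨k, rfl⟩ : ∃ k, n = k + 1 := ⟨n - 1, by omega⟩
  constructor
  · rw [show x * b * y = x * (b * y) by rw [mul_assoc], hconj, mul_assoc]
    refine (GreenR.of_mul_eq (x := b) (y := (y * x) * (b * (y * x)) ^ k) rfl ?_).greenD
    rw [mul_assoc, ← mul_assoc b, ← mul_assoc b, mul_assoc b y x, ← pow_succ', hidem]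
  · rw [hconj, ← mul_assoc]
    refine (GreenL.of_mul_eq (x := b) (y := (y * x * b) ^ k * (y * x)) rfl ?_).greenD
    rw [← mul_assoc, mul_assoc _ _ b, ← pow_succ, hidem]

end IsDAb

end FiniteMonoid

/-! ### Words with many full factors in monoids of `DAb` -/

section Words

variable {A M : Type*} [Monoid M]

/-- The value of a word under an assignment of the letters to elements of a monoid. -/
def wordValue (ψ : A → M) (w : List A) : M := (w.map ψ).prod

@[simp] theorem wordValue_nil (ψ : A → M) : wordValue ψ [] = 1 := rfl

@[simp] theorem wordValue_cons (ψ : A → M) (a : A) (w : List A) :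
    wordValue ψ (a :: w) = ψ a * wordValue ψ w := by simp [wordValue]

@[simp] theorem wordValue_append (ψ : A → M) (u v : List A) :
    wordValue ψ (u ++ v) = wordValue ψ u * wordValue ψ v := by simp [wordValue]

/-- The word `w` starts with `k` factors each of which contains all letters of `l`. -/
def HasFull (l : List A) : ℕ → List A → Prop
  | 0, _ => True
  | k + 1, w => ∃ x y, w = x ++ y ∧ l ⊆ x ∧ HasFull l k y

theorem HasFull.mono_right {l : List A} {k : ℕ} {w : List A} (h : HasFull l k w) (v : List A) :
    HasFull l k (w ++ v) := by
  induction k generalizing w with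
  | zero => trivial
  | succ k ih =>
    obtain ⟨x, y, rfl, hx, hy⟩ := h
    exact ⟨x, y ++ v, by simp, hx, ih hy⟩

theorem HasFull.mono_left {l : List A} {k : ℕ} {w : List A} (h : HasFull l k w) (v : List A) :
    HasFull l k (v ++ w) := by
  cases k with
  | zero => trivial
  | succ k =>
    obtain ⟨x, y, rfl, hx, hy⟩ := h
    exact ⟨v ++ x, y, by simp, fun a ha => List.mem_append_right _ (hx ha), hy⟩

theorem HasFull.le_count [DecidableEq A] {l : List A} {k : ℕ} {w : List A} (h : HasFull l k w)
    {a : A} (ha : a ∈ l) : k ≤ w.count a := by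
  induction k generalizing w with
  | zero => exact Nat.zero_le _
  | succ k ih =>
    obtain ⟨x, y, rfl, hx, hy⟩ := h
    have := ih hy
    have := List.count_pos_iff.2 (hx ha)
    rw [List.count_append]
    omega

theorem hasFull_flatten_replicate (l : List A) (k : ℕ) :
    HasFull l k (List.replicate k l).flatten := by
  induction k with
  | zero => trivial
  | succ k ih => exact ⟨l, _, by simp [List.replicate_succ], fun _ h => h, ih⟩

/-- The j-th prefix consists of the first j full factors, so any two of the prefixes differ by a
word containing all of `l`. This prepares a pigeonhole argument on their values. -/
theorem HasFull.exists_prefixes {l : List A} {k : ℕ} {w : List A} (h : HasFull l k w) :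
    ∃ p : ℕ → List A, (∀ j, j ≤ k → ∃ r, w = p j ++ r) ∧
      ∀ i j, i < j → j ≤ k → ∃ z, p j = p i ++ z ∧ l ⊆ z := by
  induction k generalizing w with
  | zero => exact ⟨fun _ => [], fun j _ => ⟨w, rfl⟩, fun i j hij hj => by omega⟩
  | succ k ih =>
    obtain ⟨x, y, rfl, hx, hy⟩ := h
    obtain ⟨p, hp0, hp⟩ := ih hy
    refine ⟨fun j => if j = 0 then [] else x ++ p (j - 1), fun j hj => ?_, fun i j hij hj => ?_⟩
    · rcases Nat.eq_zero_or_pos j with rfl | hj0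
      · exact ⟨x ++ y, rfl⟩
      · obtain ⟨r, hr⟩ := hp0 (j - 1) (by omega)
        exact ⟨r, by simp [hj0.ne', ← hr]⟩
    · have hj0 : j ≠ 0 := by omega
      rcases Nat.eq_zero_or_pos i with rfl | hi
      · exact ⟨x ++ p (j - 1), by simp [hj0], fun a ha => List.mem_append_left _ (hx ha)⟩
      · obtain ⟨z, h1, h2⟩ := hp (i - 1) (j - 1) (by omega) (by omega)
        exact ⟨z, by simp [hj0, hi.ne', h1], h2⟩

namespace IsDAb

variable {ψ : A → M} {n : ℕ} {l : List A}

theorem greenD_wordValue (hM : IsDAb M) (hn : 0 < n) (hidem : ∀ x : M, x ^ n * x ^ n = x ^ n)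
    {a : A} (ha : a ∈ l) : GreenD (wordValue ψ l ^ n) (wordValue ψ l ^ n * ψ a) ∧
      GreenD (wordValue ψ l ^ n) (ψ a * wordValue ψ l ^ n) := by
  obtain ⟨u, v, rfl⟩ := List.append_of_mem ha
  have := hM.greenD_mul hn hidem (wordValue ψ u) (ψ a) (wordValue ψ v)
  simpa [mul_assoc] using this

theorem idempotent_comm (hM : IsDAb M) (hn : 0 < n) (hidem : ∀ x : M, x ^ n * x ^ n = x ^ n)
    {a : A} (ha : a ∈ l) : wordValue ψ l ^ n * ψ a = ψ a * wordValue ψ l ^ n := by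
  obtain ⟨h1, h2⟩ := hM.greenD_wordValue (ψ := ψ) hn hidem ha
  rw [← hM.idempotent_mul_of_greenD (hidem _) h1, ← hM.mul_idempotent_of_greenD (hidem _) h2,
    mul_assoc]

theorem idempotent_comm_word (hM : IsDAb M) (hn : 0 < n)
    (hidem : ∀ x : M, x ^ n * x ^ n = x ^ n) {w : List A} (hw : w ⊆ l) :
    wordValue ψ l ^ n * wordValue ψ w = wordValue ψ w * wordValue ψ l ^ n := by
  induction w with
  | nil => simp
  | cons a w ih =>
    rw [List.cons_subset] at hw
    rw [wordValue_cons, ← mul_assoc, hM.idempotent_comm hn hidem hw.1, mul_assoc, ih hw.2,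
      mul_assoc]

/-- After multiplication by the idempotent, letters of `l` become elements of one Abelian group. -/
theorem idempotent_perm (hM : IsDAb M) (hn : 0 < n) (hidem : ∀ x : M, x ^ n * x ^ n = x ^ n)
    {u v : List A} (h : u.Perm v) (hu : u ⊆ l) :
    wordValue ψ l ^ n * wordValue ψ u = wordValue ψ l ^ n * wordValue ψ v := by
  induction h with
  | nil => rfl
  | @cons a u v _ ih =>
    rw [List.cons_subset] at hu
    rw [wordValue_cons, wordValue_cons, ← mul_assoc, hM.idempotent_comm hn hidem hu.1, mul_assoc,
      ih hu.2, ← mul_assoc, ← hM.idempotent_comm hn hidem hu.1, mul_assoc]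
  | swap a b u =>
    simp only [List.cons_subset] at hu
    have ha := (hM.greenD_wordValue (ψ := ψ) hn hidem hu.2.1).1
    have hb := (hM.greenD_wordValue (ψ := ψ) hn hidem hu.1).1
    -- The idempotent is duplicated and moved past a letter, so that each of the two letters gets
    -- its own copy.
    have key : ∀ c ∈ l, ∀ d ∈ l, wordValue ψ l ^ n * (ψ c * ψ d) =
        (wordValue ψ l ^ n * ψ c) * (wordValue ψ l ^ n * ψ d) := by
      intro c hc d hd
      rw [mul_assoc, ← mul_assoc (ψ c), ← hM.idempotent_comm hn hidem hc, mul_assoc _ (ψ c),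
        ← mul_assoc (_ ^ n) (_ ^ n), hidem]
    simp only [wordValue_cons, ← mul_assoc]
    congr 1
    rw [mul_assoc, key b hu.1 a hu.2.1, mul_assoc _ (ψ a), key a hu.2.1 b hu.1]
    exact hM.mul_comm_of_greenD (hidem _) hb ha
  | trans h1 _ ih1 ih2 => rw [ih1 hu, ih2 fun a ha => hu (h1.symm.subset ha)]

theorem greenD_idempotent_mul_word (hM : IsDAb M) (hn : 0 < n)
    (hidem : ∀ x : M, x ^ n * x ^ n = x ^ n) {w : List A} (hw : w ⊆ l) :
    GreenD (wordValue ψ l ^ n) (wordValue ψ l ^ n * wordValue ψ w) := by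
  obtain ⟨hmul, -⟩ := hM.formsAbelianGroup (wordValue ψ l ^ n) ⟨_, .refl, hidem _⟩
  induction w with
  | nil => rw [wordValue_nil, mul_one]; exact .refl
  | cons a w ih =>
    rw [List.cons_subset] at hw
    have h1 := hmul _ (hM.greenD_wordValue (ψ := ψ) hn hidem hw.1).1 _ (ih hw.2)
    rwa [hM.idempotent_comm hn hidem hw.1, mul_assoc, ← mul_assoc (_ ^ n), hidem, ← mul_assoc,
      ← hM.idempotent_comm hn hidem hw.1, mul_assoc, ← wordValue_cons] at h1

/-- The left side is an idempotent power of an element of the group around the idempotent of `l`,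
hence its identity. -/
theorem idempotent_mul_pow (hM : IsDAb M) (hn : 0 < n)
    (hidem : ∀ x : M, x ^ n * x ^ n = x ^ n) {w : List A} (hw : w ⊆ l) :
    wordValue ψ l ^ n * wordValue ψ w ^ n = wordValue ψ l ^ n := by
  have hc : Commute (wordValue ψ l ^ n) (wordValue ψ w) := hM.idempotent_comm_word hn hidem hw
  have hg := hM.greenD_idempotent_mul_word (ψ := ψ) hn hidem hw
  have h1 : wordValue ψ l ^ n * wordValue ψ w ^ n = (wordValue ψ l ^ n * wordValue ψ w) ^ n := by
    rw [hc.mul_pow, IsIdempotentElem.pow_eq (hidem _) hn.ne']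
  have h2 : ∀ k, GreenD (wordValue ψ l ^ n) ((wordValue ψ l ^ n * wordValue ψ w) ^ (k + 1)) := by
    obtain ⟨hmul, -⟩ := hM.formsAbelianGroup (wordValue ψ l ^ n) ⟨_, .refl, hidem _⟩
    intro k
    induction k with
    | zero => simpa using hg
    | succ k ih => rw [pow_succ]; exact hmul _ ih _ hg
  rw [h1]
  refine (hM.eq_of_greenD (hidem _) (hidem _) ?_).symm
  have := h2 (n - 1)
  rwa [Nat.sub_add_cancel hn] at this

theorem idempotent_eq (hM : IsDAb M) (hn : 0 < n) (hidem : ∀ x : M, x ^ n * x ^ n = x ^ n)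
    {w : List A} (hw : w ⊆ l) (hl : l ⊆ w) : wordValue ψ w ^ n = wordValue ψ l ^ n := by
  have h1 := hM.idempotent_mul_pow (ψ := ψ) hn hidem hw
  have h2 := hM.idempotent_mul_pow (ψ := ψ) hn hidem hl
  have h3 : Commute (wordValue ψ l ^ n) (wordValue ψ w) := hM.idempotent_comm_word hn hidem hw
  rw [← h1, (h3.pow_right n).eq, h2]

/-- Among card M + 1 prefixes two have the same value. The word z between them can be repeated n
times at no cost, and its n-th power is the idempotent of `l`, since z has the same letters. -/
theorem idempotent_mul_of_hasFull (hM : IsDAb M) (hn : 0 < n)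
    (hidem : ∀ x : M, x ^ n * x ^ n = x ^ n) {w : List A} (hw : w ⊆ l)
    (h : HasFull l (Nat.card M) w) : wordValue ψ l ^ n * wordValue ψ w = wordValue ψ w := by
  have := hM.finite
  obtain ⟨p, hp0, hp⟩ := h.exists_prefixes
  have := Fintype.ofFinite M
  obtain ⟨i, j, hij, heq⟩ := Fintype.exists_ne_map_eq_of_card_lt
    (fun i : Fin (Nat.card M + 1) => wordValue ψ (p i)) (by simp [Nat.card_eq_fintype_card])
  wlog hlt : (i : ℕ) < j generalizing i j
  · exact this j i hij.symm heq.symm (lt_of_le_of_ne (not_lt.1 hlt) fun h => hij (Fin.ext h.symm))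
  obtain ⟨z, h1, h2⟩ := hp i j hlt (by omega)
  obtain ⟨r, h4⟩ := hp0 j (by omega)
  have h6 : wordValue ψ (p i) = wordValue ψ (p i) * wordValue ψ z := by
    rw [← wordValue_append, ← h1]; exact heq
  have h7 : ∀ k, wordValue ψ (p i) * wordValue ψ z ^ k = wordValue ψ (p i) := by
    intro k
    induction k with
    | zero => simp
    | succ k ih => rw [pow_succ', ← mul_assoc, ← h6, ih]
  have h8 : w = p i ++ (z ++ r) := by rw [h4, h1, List.append_assoc]
  have h9 : p i ⊆ l := fun a ha => hw (by rw [h8]; exact List.mem_append_left _ ha)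
  have h3 : z ⊆ l := fun a ha => hw (by simp [h8, ha])
  rw [h8, wordValue_append, ← mul_assoc, hM.idempotent_comm_word hn hidem h9,
    ← hM.idempotent_eq hn hidem h3 h2, h7]

end IsDAb

end Words

/-! ### Words over a finite set of letters -/

section Compactness

open ProfiniteCompl

variable {A : Type*}

/-- The words all of whose letters are in `S`. -/
def wordsOver (S : Set A) : Set (FreeMonoid A) := {w | ∀ a ∈ w.toList, a ∈ S}

/-- A set with `n` elements without a distinguished multiplication. -/
def FinCarrier (n : ℕ) : Type := Fin n

instance (n : ℕ) : Finite (FinCarrier n) := inferInstanceAs (Finite (Fin n))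

instance (n : ℕ) : Finite (Monoid (FinCarrier n)) :=
  Finite.of_injective (fun m : Monoid (FinCarrier n) => m.mul) fun _ _ h => Monoid.ext h

/-- Up to distance ε, a word over S is determined by its values under all assignments of S to all
monoid structures on sets with at most n elements. These are finitely many data, so the words are
totally bounded, and the completion is complete. -/
theorem isCompact_closure_wordsOver {S : Set A} (hS : S.Finite) :
    IsCompact (closure (of '' wordsOver S)) := by
  classical
  have := hS.to_subtype
  have htb : TotallyBounded {w : WithProfinite (FreeMonoid A) | ofProfinite w ∈ wordsOver S} := by
    refine Metric.totallyBounded_of_finite_discretization fun ε hε => ?_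
    obtain ⟨n, hn⟩ := exists_pow_lt_of_lt_one hε (show (2⁻¹ : ℝ) < 1 by norm_num)
    refine ⟨(c : Fin (n + 1)) → (_ : Monoid (FinCarrier c)) → (S → FinCarrier c) → FinCarrier c, Fintype.ofFinite _,
      fun w _ _ θ => FreeMonoid.lift (fun a => if h : a ∈ S then θ ⟨a, h⟩ else 1)
        (ofProfinite w.1), ?_⟩
    rintro ⟨u, hu⟩ ⟨v, hv⟩ huv
    change profiniteDist (ofProfinite u) (ofProfinite v) < ε
    by_cases he : ofProfinite u = ofProfinite v
    · rw [profiniteDist, if_pos he]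
      exact hε
    obtain ⟨m, ⟨M, _, _, hM, φ, hφ⟩, hd⟩ := exists_separatedBy_profiniteDist_eq he
    rw [hd]
    refine lt_of_le_of_lt (pow_le_pow_of_le_one (by norm_num) (by norm_num) ?_) hn
    by_contra! hlt
    let e : M ≃ FinCarrier m := Finite.equivFinOfCardEq hM
    let i : Monoid (FinCarrier m) := e.symm.monoid
    let f : M ≃* FinCarrier m := (Equiv.mulEquiv e.symm).symm
    have key : ∀ w ∈ wordsOver S, f (φ w) = FreeMonoid.lift
        (fun a => if h : a ∈ S then f (φ (FreeMonoid.of a)) else 1) w := by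
      intro w hw
      have h1 : f (φ w) = FreeMonoid.lift (fun a => f (φ (FreeMonoid.of a))) w := by
        have : (f.toMonoidHom.comp φ) = FreeMonoid.lift (fun a => f (φ (FreeMonoid.of a))) := by
          ext a
          simp
        exact DFunLike.congr_fun this w
      rw [h1, FreeMonoid.lift_apply, FreeMonoid.lift_apply]
      congr 1
      refine List.map_congr_left fun a ha => ?_
      rw [dif_pos (hw a ha)]
    refine hφ (f.injective ?_)
    refine (key _ hu).trans (Eq.trans ?_ (key _ hv).symm)
    exact congrFun (congrFun (congrFun huv ⟨m, by omega⟩) i) fun a => f (φ (FreeMonoid.of a.1))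
  exact (htb.image (Completion.uniformContinuous_coe _)).closure.isCompact_of_isClosed
    isClosed_closure

end Compactness

/-! ### Blocks -/

/-- A letter, or an infinite block given by its letters and their exponents. -/
inductive Block (A : Type*) where
  | letter (a : A) : Block A
  | infinite (l : List A) (n : A → ProfiniteNat) : Block A

namespace Block

variable {A : Type*}

/-- The pseudoword of a block. -/
noncomputable def eval : Block A → Pseudoword A
  | letter a => Pseudoword.letter a
  | infinite l n => Pseudoword.pow (l.map Pseudoword.letter).prod ProfiniteNat.omega *
      (l.map fun a => Pseudoword.pow (Pseudoword.letter a) (n a)).prod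

/-- The letters of a block. -/
def letters : Block A → List A
  | letter a => [a]
  | infinite l _ => l

/-- The block is infinite. -/
def IsInf : Block A → Prop
  | letter _ => False
  | infinite _ _ => True

/-- The letters of an infinite block are listed in increasing order, and their exponents are
infinite. -/
def Valid [LinearOrder A] : Block A → Prop
  | letter _ => True
  | infinite l n => l ≠ [] ∧ l.Pairwise (· < ·) ∧ ∀ a ∈ l, ProfiniteNat.IsInfinite (n a)

end Block

/-! ### Pseudowords with unboundedly many full factors -/

section Full

open ProfiniteCompl ProfiniteNat Pseudoword

variable {A : Type*}

theorem dAbSatisfies_refl (α : Pseudoword A) : DAbSatisfies α α := fun _ _ _ _ _ => rfl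

theorem DAbSatisfies.symm {α β : Pseudoword A} (h : DAbSatisfies α β) : DAbSatisfies β α :=
  fun M _ hM φ hφ => (h M hM φ hφ).symm

theorem DAbSatisfies.trans {α β γ : Pseudoword A} (h : DAbSatisfies α β) (h' : DAbSatisfies β γ) :
    DAbSatisfies α γ :=
  fun M _ hM φ hφ => (h M hM φ hφ).trans (h' M hM φ hφ)

theorem DAbSatisfies.mul {α β γ δ : Pseudoword A} (h : DAbSatisfies α β)
    (h' : DAbSatisfies γ δ) : DAbSatisfies (α * γ) (β * δ) :=
  fun M _ hM φ hφ => by rw [map_mul, map_mul, h M hM φ hφ, h' M hM φ hφ]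

/-- The words over the letters of `l` which start with `k` factors containing all these letters. -/
def fullWords (l : List A) (k : ℕ) : Set (FreeMonoid A) :=
  {w | w.toList ⊆ l ∧ HasFull l k w.toList}

/-- The pseudoword is, for each `k`, a limit of words over `l` that start with `k` factors
containing all letters of `l`. -/
def Full (l : List A) (α : Pseudoword A) : Prop := ∀ k, α ∈ closure (of '' fullWords l k)

theorem Full.mul_right {l : List A} {α β : Pseudoword A} (hα : Full l α)
    (hβ : β ∈ closure (of '' wordsOver {a | a ∈ l})) : Full l (α * β) := by
  intro k
  refine map_mem_closure₂ ProfiniteCompl.continuous_mul (hα k) hβ ?_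
  rintro _ ⟨u, hu, rfl⟩ _ ⟨v, hv, rfl⟩
  refine ⟨u * v, ⟨?_, ?_⟩, of_mul u v⟩
  · rw [FreeMonoid.toList_mul]
    exact List.append_subset.2 ⟨hu.1, hv⟩
  · rw [FreeMonoid.toList_mul]
    exact hu.2.mono_right _

theorem Full.mul_left {l : List A} {α β : Pseudoword A} (hα : Full l α)
    (hβ : β ∈ closure (of '' wordsOver {a | a ∈ l})) : Full l (β * α) := by
  intro k
  refine map_mem_closure₂ ProfiniteCompl.continuous_mul hβ (hα k) ?_
  rintro _ ⟨v, hv, rfl⟩ _ ⟨u, hu, rfl⟩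
  refine ⟨v * u, ⟨?_, ?_⟩, of_mul v u⟩
  · rw [FreeMonoid.toList_mul]
    exact List.append_subset.2 ⟨hv, hu.1⟩
  · rw [FreeMonoid.toList_mul]
    exact hu.2.mono_left _

theorem mul_mem_closure_wordsOver {S : Set A} {α β : Pseudoword A}
    (hα : α ∈ closure (of '' wordsOver S)) (hβ : β ∈ closure (of '' wordsOver S)) :
    α * β ∈ closure (of '' wordsOver S) := by
  refine map_mem_closure₂ ProfiniteCompl.continuous_mul hα hβ ?_
  rintro _ ⟨u, hu, rfl⟩ _ ⟨v, hv, rfl⟩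
  refine ⟨u * v, fun a ha => ?_, of_mul u v⟩
  rw [FreeMonoid.toList_mul, List.mem_append] at ha
  exact ha.elim (hu a) (hv a)

theorem prod_mem_closure_wordsOver {S : Set A} {l : List (Pseudoword A)}
    (h : ∀ α ∈ l, α ∈ closure (of '' wordsOver S)) : l.prod ∈ closure (of '' wordsOver S) := by
  induction l with
  | nil => exact subset_closure ⟨1, fun a ha => by simp at ha, rfl⟩
  | cons α l ih =>
    rw [List.prod_cons]
    exact mul_mem_closure_wordsOver (h α (by simp)) (ih fun β hβ => h β (by simp [hβ]))

theorem pow_mem_closure_wordsOver {S : Set A} {α : Pseudoword A} (n : ProfiniteNat)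
    (hα : α ∈ closure (of '' wordsOver S)) : pow α n ∈ closure (of '' wordsOver S) := by
  refine map_mem_closure₂ continuous_pow hα (denseRange_of n) ?_
  rintro _ ⟨u, hu, rfl⟩ _ ⟨k, rfl⟩
  refine ⟨u ^ k.toAdd, ?_, (pow_of u k.toAdd).symm⟩
  induction k.toAdd with
  | zero => intro a ha; simp at ha
  | succ k ih =>
    intro a ha
    rw [pow_succ, FreeMonoid.toList_mul, List.mem_append] at ha
    exact ha.elim (ih a) (hu a)

theorem letter_mem_closure_wordsOver {S : Set A} {a : A} (ha : a ∈ S) :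
    letter a ∈ closure (of '' wordsOver S) :=
  subset_closure ⟨FreeMonoid.of a, fun b hb => by simp at hb; exact hb ▸ ha, rfl⟩

theorem Block.eval_mem_closure_wordsOver (b : Block A) {S : Set A} (h : ∀ a ∈ b.letters, a ∈ S) :
    b.eval ∈ closure (of '' wordsOver S) := by
  cases b with
  | letter a => exact letter_mem_closure_wordsOver (h a (by simp [letters]))
  | infinite l n =>
    refine mul_mem_closure_wordsOver (pow_mem_closure_wordsOver _ (prod_mem_closure_wordsOver ?_))
      (prod_mem_closure_wordsOver ?_)
    · intro α hα
      obtain ⟨a, ha, rfl⟩ := List.mem_map.1 hα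
      exact letter_mem_closure_wordsOver (h a ha)
    · intro α hα
      obtain ⟨a, ha, rfl⟩ := List.mem_map.1 hα
      exact pow_mem_closure_wordsOver _ (letter_mem_closure_wordsOver (h a ha))

theorem prod_map_letter (l : List A) : (l.map letter).prod = of (FreeMonoid.ofList l) := by
  induction l with
  | nil => rfl
  | cons a l ih => rw [List.map_cons, List.prod_cons, ih, FreeMonoid.ofList_cons, of_mul]; rfl

theorem toList_ofList_pow (l : List A) (k : ℕ) :
    (FreeMonoid.ofList l ^ k).toList = (List.replicate k l).flatten := by
  induction k with
  | zero => rfl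
  | succ k ih =>
    rw [pow_succ', FreeMonoid.toList_mul, ih, List.replicate_succ, List.flatten_cons]
    rfl

theorem full_pow_omega (l : List A) : Full l (pow (l.map letter).prod omega) := by
  intro k
  rw [prod_map_letter]
  refine mem_closure_of_tendsto (tendsto_pow tendsto_const_nhds tendsto_omega) ?_
  filter_upwards [tendsto_factorial.eventually_ge_atTop k] with j hj
  refine ⟨_, ⟨?_, ?_⟩, rfl⟩
  · rw [toList_ofList_pow]
    intro a ha
    obtain ⟨l', hl', ha'⟩ := List.mem_flatten.1 ha
    rwa [(List.mem_replicate.1 hl').2] at ha'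
  · rw [toList_ofList_pow]
    obtain ⟨d, hd⟩ := Nat.exists_eq_add_of_le hj
    rw [hd, List.replicate_add, List.flatten_append]
    exact (hasFull_flatten_replicate l k).mono_right _

theorem Block.full_eval (l : List A) (n : A → ProfiniteNat) : Full l (Block.infinite l n).eval := by
  refine (full_pow_omega l).mul_right (prod_mem_closure_wordsOver ?_)
  intro α hα
  obtain ⟨a, ha, rfl⟩ := List.mem_map.1 hα
  exact pow_mem_closure_wordsOver _ (letter_mem_closure_wordsOver ha)

theorem hom_of {M : Type*} [Monoid M] (φ : Pseudoword A →* M) (w : FreeMonoid A) :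
    φ (of w) = wordValue (fun a => φ (letter a)) w.toList := by
  induction w using FreeMonoid.inductionOn' with
  | one => rw [of_one, map_one]; rfl
  | of_mul a w ih => rw [of_mul, map_mul, ih, FreeMonoid.toList_of_mul, wordValue_cons]; rfl

theorem hom_pow_omega {M : Type*} [Monoid M] {φ : Pseudoword A →* M}
    (hφ : letI : TopologicalSpace M := ⊥; Continuous φ) {n : ℕ} (hn : 0 < n)
    (hidem : ∀ x : M, x ^ n * x ^ n = x ^ n) (w : FreeMonoid A) :
    φ (pow (of w) omega) = φ (of w) ^ n := by
  obtain ⟨k, hk, hk'⟩ := ((eventually_eq_of_continuous hφ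
    (tendsto_pow (tendsto_const_nhds (x := of w)) tendsto_omega)).and
      (eventually_ge_atTop n)).exists
  obtain ⟨t, ht⟩ := Nat.dvd_factorial hn hk'
  have ht0 : 0 < t := Nat.pos_of_ne_zero fun h => k.factorial_ne_zero (by rw [ht, h, mul_zero])
  have hpow : ∀ j : ℕ, of (w ^ j) = of w ^ j := by
    intro j
    induction j with
    | zero => rw [_root_.pow_zero, _root_.pow_zero, of_one]
    | succ j ih => rw [pow_succ, pow_succ, of_mul, ih]
  rw [← hk, hpow, map_pow, ht, pow_mul_eq_pow_of_idempotent (hidem _) ht0]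

theorem perm_flatMap_replicate [DecidableEq A] {l w : List A} (hl : l.Nodup) (hw : w ⊆ l) :
    w.Perm (l.flatMap fun a => List.replicate (w.count a) a) := by
  have key : ∀ l : List A, l.Nodup → ∀ b, (l.flatMap fun a => List.replicate (w.count a) a).count b =
      if b ∈ l then w.count b else 0 := by
    intro l hl b
    induction l with
    | nil => simp
    | cons a l ih =>
      rw [List.nodup_cons] at hl
      rw [List.flatMap_cons, List.count_append, ih hl.2, List.count_replicate]
      by_cases hab : a = b
      · subst hab
        simp [hl.1]
      · simp [hab, Ne.symm hab]
  rw [List.perm_iff_count]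
  intro b
  rw [key l hl b]
  split_ifs with hb
  · rfl
  · exact List.count_eq_zero.2 fun h => hb (hw h)

/-- Both sides depend continuously on α, so for a given M it suffices to check words with card M
full factors. Such a word absorbs the idempotent, after which its letters can be sorted. -/
theorem Full.dAbSatisfies {l : List A} {α : Pseudoword A} (hl : l.Nodup) (h : Full l α) :
    DAbSatisfies α (Block.infinite l fun a => count a α).eval := by
  classical
  intro M _ hM φ hφ
  have := hM.finite
  obtain ⟨n, hn, hidem⟩ := exists_pow_mul_pow_self M
  have hcont : Continuous fun α : Pseudoword A => (Block.infinite l fun a => count a α).eval := by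
    refine continuous_const.mul (continuous_list_prod l fun a _ => ?_)
    exact continuous_pow.comp (continuous_const.prodMk (continuous_count a))
  have hcl : IsClosed {α | φ α = φ (Block.infinite l fun a => count a α).eval} := by
    let _ : TopologicalSpace M := ⊥
    exact isClosed_eq_discrete hφ (hφ.comp hcont)
  refine closure_minimal ?_ hcl (h (Nat.card M))
  rintro _ ⟨w, ⟨hw, hfull⟩, rfl⟩
  change φ (of w) = φ (_ * _)
  have h1 : ∀ l : List A, φ (l.map fun a => pow (letter a) (count a (of w))).prod =
      wordValue (fun a => φ (letter a))
        (l.flatMap fun a => List.replicate (w.toList.count a) a) := by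
    intro l
    induction l with
    | nil => simp
    | cons a l ih =>
      rw [List.map_cons, List.prod_cons, map_mul, ih, List.flatMap_cons, wordValue_append,
        count_of, letter, pow_of, hom_of]
      congr 2
      induction w.toList.count a with
      | zero => rfl
      | succ k ih => rw [pow_succ', FreeMonoid.toList_of_mul, ih, List.replicate_succ]
  rw [map_mul, h1, prod_map_letter, hom_pow_omega hφ hn hidem, hom_of, hom_of,
    ← hM.idempotent_mul_of_hasFull hn hidem hw hfull]
  exact hM.idempotent_perm hn hidem (perm_flatMap_replicate hl hw) hw

/-- Words with m + 1 full factors contain the letter more than m times, and m is an isolated point.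
-/
theorem Full.isInfinite_count {l : List A} {α : Pseudoword A} (h : Full l α) {a : A}
    (ha : a ∈ l) : IsInfinite (count a α) := by
  classical
  rintro ⟨m, hm⟩
  have hcl : IsClosed {β : Pseudoword A | count a β ∉ ({ofNat m} : Set ProfiniteNat)} :=
    ((isOpen_singleton_ofNat m).preimage (continuous_count a)).isClosed_compl
  refine closure_minimal ?_ hcl (h (m + 1)) hm.symm
  rintro _ ⟨w, ⟨hw, hfull⟩, rfl⟩ heq
  rw [count_of] at heq
  have := ofNat_injective heq
  have := hfull.le_count ha
  omega

theorem Full.valid [LinearOrder A] {l : List A} {α : Pseudoword A} (h : Full l α) (hl : l ≠ [])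
    (hl' : l.Pairwise (· < ·)) : (Block.infinite l fun a => count a α).Valid :=
  ⟨hl, hl', fun _ ha => h.isInfinite_count ha⟩

end Full

/-! ### Every pseudoword is a product of blocks -/

section Factorization

open ProfiniteCompl ProfiniteNat Pseudoword

variable {A : Type*} [LinearOrder A]

/-- The variety `DAb` satisfies an equation between the pseudoword and a product of blocks. -/
def IsBlockProduct (α : Pseudoword A) : Prop :=
  ∃ bs : List (Block A), (∀ b ∈ bs, b.Valid) ∧ DAbSatisfies α (bs.map Block.eval).prod

theorem IsBlockProduct.mul {α β : Pseudoword A} (hα : IsBlockProduct α) (hβ : IsBlockProduct β) :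
    IsBlockProduct (α * β) := by
  obtain ⟨bs, h1, h2⟩ := hα
  obtain ⟨bs', h1', h2'⟩ := hβ
  refine ⟨bs ++ bs', fun b hb => (List.mem_append.1 hb).elim (h1 b) (h1' b), ?_⟩
  rw [List.map_append, List.prod_append]
  exact h2.mul h2'

theorem isBlockProduct_letter (a : A) : IsBlockProduct (letter a) :=
  ⟨[Block.letter a], by simp [Block.Valid], by simpa [Block.eval] using dAbSatisfies_refl _⟩

/-- The letter that completes the shortest prefix containing all of `l` has not occurred before it.
The remaining prefix therefore has a smaller alphabet. -/
theorem exists_minimal_full_prefix {l w : List A} (hl : l ≠ []) (hw : l ⊆ w) :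
    ∃ x b y, w = x ++ b :: y ∧ b ∈ l ∧ b ∉ x ∧ l ⊆ x ++ [b] := by
  induction w using List.reverseRecOn with
  | nil => exact absurd (List.subset_nil.1 hw) hl
  | append_singleton v c ih =>
    by_cases hv : l ⊆ v
    · obtain ⟨x, b, y, rfl, h⟩ := ih hv
      exact ⟨x, b, y ++ [c], by simp, h⟩
    · obtain ⟨d, hd, hdv⟩ : ∃ d ∈ l, d ∉ v := by simpa [List.subset_def] using hv
      obtain rfl : d = c := by
        have := hw hd
        simpa [hdv] using this
      exact ⟨v, d, [], rfl, hd, hdv, hw⟩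

open Pointwise in
theorem isBlockProduct_of_mem_closure (S : Finset A) {α : Pseudoword A}
    (hα : α ∈ closure (of '' wordsOver (S : Set A))) : IsBlockProduct α := by
  induction S using Finset.strongInduction generalizing α with
  | H S ih =>
  rcases S.eq_empty_or_nonempty with rfl | hS
  · refine ⟨[], by simp, ?_⟩
    have : closure (of '' wordsOver ((∅ : Finset A) : Set A)) ⊆ {1} := by
      refine closure_minimal ?_ isClosed_singleton
      rintro _ ⟨w, hw, rfl⟩
      have : w = 1 := FreeMonoid.toList.injective (List.eq_nil_iff_forall_not_mem.2 fun a ha => by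
        simpa using hw a ha)
      rw [this]
      rfl
    rw [this hα]
    exact dAbSatisfies_refl _
  let l := S.sort (· ≤ ·)
  have hl : ∀ a, a ∈ l ↔ a ∈ S := fun a => Finset.mem_sort _
  have hne : l ≠ [] := by
    obtain ⟨a, ha⟩ := hS
    exact List.ne_nil_of_mem ((hl a).2 ha)
  -- Limits of words with fewer than k full factors are handled by an inner induction on k; the
  -- outer induction supplies the smaller alphabets.
  have key : ∀ k, ∀ β ∈ closure (of '' {w | w ∈ wordsOver (S : Set A) ∧ ¬ HasFull l k w.toList}),
      IsBlockProduct β := by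
    intro k
    induction k with
    | zero =>
      intro β hβ
      have : {w | w ∈ wordsOver (S : Set A) ∧ ¬ HasFull l 0 w.toList} = ∅ := by
        ext w
        simp [HasFull]
      simp [this] at hβ
    | succ k ihk =>
      set W := {w | w ∈ wordsOver (S : Set A) ∧ ¬ HasFull l k w.toList} with hW
      let K : A → Set (Pseudoword A) := fun b => closure (of '' wordsOver (S.erase b : Set A))
      have hK : ∀ b, IsCompact (K b) := fun b => isCompact_closure_wordsOver (Finset.finite_toSet _)
      have hWc : IsCompact (closure (of '' W)) :=
        (isCompact_closure_wordsOver S.finite_toSet).of_isClosed_subset isClosed_closure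
          (closure_mono (Set.image_mono fun w hw => hw.1))
      -- Products of compact sets are compact and hence closed, so the factorization of words passes
      -- to their limits.
      let Z : Set (Pseudoword A) := ⋃ b ∈ S, (K b ∪ K b * {letter b} * closure (of '' W))
      have hZ : IsClosed Z := S.finite_toSet.isClosed_biUnion fun b _ =>
        ((hK b).union (((hK b).mul isCompact_singleton).mul hWc)).isClosed
      intro β hβ
      have hβZ : β ∈ Z := by
        refine closure_minimal ?_ hZ hβ
        rintro _ ⟨w, ⟨hw, hnf⟩, rfl⟩
        by_cases hlw : l ⊆ w.toList
        · obtain ⟨x, b, y, h1, h2, h3, h4⟩ := exists_minimal_full_prefix hne hlw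
          have hw' : ∀ a ∈ x ++ b :: y, a ∈ S := fun a ha => hw a (h1 ▸ ha)
          refine Set.mem_biUnion ((hl b).1 h2) (Or.inr ?_)
          have hfac : of w = of (FreeMonoid.ofList x) * letter b * of (FreeMonoid.ofList y) := by
            rw [letter, ← of_mul, ← of_mul]
            congr 1
            refine FreeMonoid.toList.injective ?_
            rw [h1]
            simp
          rw [hfac]
          refine Set.mul_mem_mul (Set.mul_mem_mul (subset_closure ⟨_, ?_, rfl⟩) rfl)
            (subset_closure ⟨_, ⟨?_, ?_⟩, rfl⟩)
          · intro a ha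
            rw [FreeMonoid.toList_ofList] at ha
            exact Finset.mem_coe.2 (Finset.mem_erase.2
              ⟨fun h => h3 (h ▸ ha), hw' a (List.mem_append_left _ ha)⟩)
          · intro a ha
            rw [FreeMonoid.toList_ofList] at ha
            exact hw' a (by simp [ha])
          -- Together with the cut-off prefix, k full factors of the remainder would give k + 1 full
          -- factors of the word.
          · intro hy
            refine hnf ⟨x ++ [b], y, by simpa using h1, h4, hy⟩
        · obtain ⟨d, hd, hdw⟩ : ∃ d ∈ l, d ∉ w.toList := by simpa [List.subset_def] using hlw
          refine Set.mem_biUnion ((hl d).1 hd) (Or.inl (subset_closure ⟨w, fun a ha => ?_, rfl⟩))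
          exact Finset.mem_coe.2 (Finset.mem_erase.2 ⟨fun h => hdw (h ▸ ha), hw a ha⟩)
      obtain ⟨b, hb, hβb⟩ := Set.mem_iUnion₂.1 hβZ
      rcases hβb with hβb | hβb
      · exact ih _ (Finset.erase_ssubset hb) hβb
      · obtain ⟨_, ⟨β₁, h1, _, rfl, rfl⟩, β₂, h2, rfl⟩ := hβb
        exact ((ih _ (Finset.erase_ssubset hb) h1).mul (isBlockProduct_letter b)).mul (ihk _ h2)
  by_cases hex : ∃ k, α ∈ closure (of '' {w | w ∈ wordsOver (S : Set A) ∧ ¬ HasFull l k w.toList})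
  · obtain ⟨k, hk⟩ := hex
    exact key k α hk
  · have hfull : Full l α := by
      intro k
      have hsub : of '' wordsOver (S : Set A) ⊆ of '' fullWords l k ∪
          of '' {w | w ∈ wordsOver (S : Set A) ∧ ¬ HasFull l k w.toList} := by
        rintro _ ⟨w, hw, rfl⟩
        by_cases h : HasFull l k w.toList
        · exact Or.inl ⟨w, ⟨fun a ha => (hl a).2 (hw a ha), h⟩, rfl⟩
        · exact Or.inr ⟨w, ⟨hw, h⟩, rfl⟩
      have := closure_mono hsub hα
      rw [closure_union] at this
      exact this.resolve_right fun h => hex ⟨k, h⟩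
    have hsort : l.Pairwise (· < ·) := (Finset.sortedLT_sort S).pairwise
    refine ⟨[Block.infinite l fun a => count a α], ?_, ?_⟩
    · simpa using hfull.valid hne hsort
    · simpa using hfull.dAbSatisfies (Finset.sort_nodup S _)

/-- The alphabet of a convergent sequence of words is eventually constant, so finitely many letters
suffice even over an infinite alphabet. -/
theorem isBlockProduct (α : Pseudoword A) : IsBlockProduct α := by
  obtain ⟨g, hg⟩ := exists_tendsto_of α
  have hev := eventually_alphabet_eq hg
  obtain ⟨k₀, hk₀⟩ := hev.exists
  refine isBlockProduct_of_mem_closure (g k₀).toList.toFinset ?_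
  refine mem_closure_of_tendsto hg ?_
  filter_upwards [hev] with k hk
  refine ⟨_, fun a ha => ?_, rfl⟩
  have : a ∈ {a | a ∈ (g k₀).toList} := by rw [hk₀, ← hk]; exact ha
  simpa using this

end Factorization

/-! ### Letters and exponents of blocks -/

section BlockInvariants

open ProfiniteCompl ProfiniteNat Pseudoword

variable {A : Type*}

theorem alphabet_subset_of_mem_closure {S : Set A} {α : Pseudoword A}
    (h : α ∈ closure (of '' wordsOver S)) : alphabet α ⊆ S := by
  obtain ⟨x, hx, hlim⟩ := mem_closure_iff_seq_limit.1 h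
  choose g hg hgx using hx
  obtain ⟨k, hk⟩ := (eventually_eq_of_continuous continuous_alphabet hlim).exists
  rw [← hk, ← hgx, alphabet_of]
  exact hg k

theorem Full.subset_alphabet {l : List A} {α : Pseudoword A} (h : Full l α) :
    {a | a ∈ l} ⊆ alphabet α := by
  obtain ⟨x, hx, hlim⟩ := mem_closure_iff_seq_limit.1 (h 1)
  choose g hg hgx using hx
  obtain ⟨k, hk⟩ := (eventually_eq_of_continuous continuous_alphabet hlim).exists
  rw [← hk, ← hgx, alphabet_of]
  obtain ⟨y, z, hyz, hy, -⟩ := (hg k).2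
  intro a ha
  change a ∈ (g k).toList
  rw [hyz]
  exact List.mem_append_left _ (hy ha)

theorem Block.alphabet_eval (b : Block A) : alphabet b.eval = {a | a ∈ b.letters} := by
  cases b with
  | letter a =>
    rw [eval, alphabet_letter]
    ext c
    simp [letters]
  | infinite l n =>
    exact (alphabet_subset_of_mem_closure (eval_mem_closure_wordsOver _ fun a ha => ha)).antisymm
      (full_eval l n).subset_alphabet

-- Profinite numbers are written multiplicatively, so the final `1` stands for the number zero,
-- whereas in the hypotheses 1 and 0 are ordinary counts.
open Classical in
theorem count_pow_of (a : A) (w : FreeMonoid A) (n : ProfiniteNat) :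
    (w.toList.count a = 1 → count a (pow (of w) n) = n) ∧
      (w.toList.count a = 0 → count a (pow (of w) n) = 1) := by
  have hc : Continuous fun n => count a (pow (of w) n) :=
    (continuous_count a).comp (continuous_pow.comp (continuous_const.prodMk continuous_id))
  have key : ∀ k : ℕ, count a (pow (of w) (ofNat k)) = ofNat (k * w.toList.count a) := by
    intro k
    rw [pow_of, count_of]
    congr 1
    induction k with
    | zero => simp
    | succ k ih =>
      rw [pow_succ, FreeMonoid.toList_mul, List.count_append, ih]
      ring
  constructor
  · intro h
    refine congrFun (denseRange_of.equalizer hc continuous_id ?_) n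
    ext k
    exact (key k.toAdd).trans (by rw [h, mul_one]; rfl)
  · intro h
    refine congrFun (denseRange_of.equalizer hc (continuous_const (y := (1 : ProfiniteNat))) ?_) n
    ext k
    exact (key k.toAdd).trans (by rw [h, mul_zero, ofNat_zero]; rfl)

theorem count_one (a : A) : count a (1 : Pseudoword A) = 1 := by
  rw [← of_one, count_of]
  rfl

theorem count_prod_pow_letter (a : A) (n : A → ProfiniteNat) {l : List A} (hl : l.Nodup) :
    (a ∈ l → count a (l.map fun b => pow (letter b) (n b)).prod = n a) ∧
      (a ∉ l → count a (l.map fun b => pow (letter b) (n b)).prod = 1) := by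
  classical
  induction l with
  | nil => exact ⟨fun h => by simp at h, fun _ => count_one a⟩
  | cons b l ih =>
    rw [List.nodup_cons] at hl
    obtain ⟨ih1, ih2⟩ := ih hl.2
    rw [List.map_cons, List.prod_cons, count_mul, letter]
    by_cases hab : b = a
    · subst hab
      refine ⟨fun _ => ?_, fun h => absurd (List.mem_cons_self) h⟩
      rw [(count_pow_of b (FreeMonoid.of b) (n b)).1 (by simp), ih2 hl.1, mul_one]
    · rw [(count_pow_of a (FreeMonoid.of b) (n b)).2 (by simp [hab]), one_mul]
      exact ⟨fun h => ih1 ((List.mem_cons.1 h).resolve_left (Ne.symm hab)),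
        fun h => ih2 fun h' => h (List.mem_cons_of_mem _ h')⟩

/-- The leading ω-power contributes ω, which an infinite exponent absorbs. -/
theorem Block.count_eval {l : List A} (hl : l.Nodup) {n : A → ProfiniteNat} {a : A} (ha : a ∈ l)
    (hn : IsInfinite (n a)) : count a (infinite l n).eval = n a := by
  classical
  rw [eval, count_mul, (count_prod_pow_letter a n hl).1 ha, prod_map_letter,
    (count_pow_of a (FreeMonoid.ofList l) _).1, hn.omega_mul]
  exact List.count_eq_one_of_mem hl ha

theorem Block.eval_congr {l : List A} {n n' : A → ProfiniteNat} (h : ∀ a ∈ l, n a = n' a) :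
    (infinite l n).eval = (infinite l n').eval := by
  rw [eval, eval]
  congr 2
  exact List.map_congr_left fun a ha => by rw [h a ha]

theorem Block.isInfiniteBlock_eval [LinearOrder A] {l : List A} {n : A → ProfiniteNat}
    (h : (infinite l n).Valid) : IsInfiniteBlock (infinite l n).eval := by
  obtain ⟨h1, h2, h3⟩ := h
  refine ⟨l.length, l.get, fun j => n (l.get j), List.length_pos_iff.2 h1, ?_,
    fun j => h3 _ (List.get_mem l j), ?_⟩
  · exact List.pairwise_iff_get.1 h2
  · have key : ∀ f : A → Pseudoword A, List.ofFn (fun j => f (l.get j)) = l.map f := by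
      intro f
      rw [← Function.comp_def, ← List.map_ofFn, List.ofFn_get]
    rw [key Pseudoword.letter, key fun a => pow (Pseudoword.letter a) (n a), eval]

theorem Block.exists_of_isInfiniteBlock [LinearOrder A] {α : Pseudoword A}
    (h : IsInfiniteBlock α) : ∃ l n, (infinite l n).Valid ∧ (infinite l n).eval = α := by
  obtain ⟨ℓ, a, n, h1, h2, h3, rfl⟩ := h
  have hext : ∀ j, Function.extend a n (fun _ => omega) (a j) = n j :=
    fun j => h2.injective.extend_apply n _ j
  refine ⟨List.ofFn a, Function.extend a n fun _ => omega, ⟨?_, ?_, ?_⟩, ?_⟩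
  · intro h
    have := congrArg List.length h
    simp at this
    omega
  · exact List.pairwise_ofFn.2 fun i j hij => h2 hij
  · intro b hb
    obtain ⟨j, rfl⟩ := (List.mem_ofFn' a b).1 hb
    rw [hext]
    exact h3 j
  · rw [eval, List.map_ofFn, List.map_ofFn]
    simp only [Function.comp_def, hext]

end BlockInvariants

/-! ### Existence of normal forms -/

section Existence

open ProfiniteCompl ProfiniteNat Pseudoword

variable {A : Type*}

/-- Neither of two consecutive blocks is an infinite block that contains all letters of the
other. -/
def Block.Incomparable (b b' : Block A) : Prop :=
  (b.IsInf → ¬ b'.letters ⊆ b.letters) ∧ (b'.IsInf → ¬ b.letters ⊆ b'.letters)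

/-- The letters of the second block that occur in the first have exponent `ω`. -/
def Block.OmegaShared (b b' : Block A) : Prop :=
  ∀ l n, b' = infinite l n → ∀ a ∈ b.letters, a ∈ l → n a = omega

theorem Block.Valid.pairwise [LinearOrder A] {l : List A} {n : A → ProfiniteNat}
    (h : (Block.infinite l n).Valid) : l.Pairwise (· < ·) := h.2.1

theorem Block.Valid.nodup [LinearOrder A] {l : List A} {n : A → ProfiniteNat}
    (h : (Block.infinite l n).Valid) : l.Nodup := h.pairwise.imp fun h => h.ne

/-- If an infinite block contains all letters of its neighbour, the product of the two is still
`Full` over the letters of that block, hence a single infinite block in `DAb`. -/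
theorem Block.exists_merge [LinearOrder A] {b b' : Block A} (hb : b.Valid) (hb' : b'.Valid)
    (h : ¬ b.Incomparable b') : ∃ c : Block A, c.Valid ∧ DAbSatisfies (b.eval * b'.eval) c.eval := by
  rw [Incomparable, not_and_or] at h
  push Not at h
  rcases h with ⟨hinf, hsub⟩ | ⟨hinf, hsub⟩
  · match b, hb, hinf with
    | infinite l n, hb, _ =>
      have hf : Full l ((infinite l n).eval * b'.eval) :=
        (full_eval l n).mul_right (b'.eval_mem_closure_wordsOver hsub)
      exact ⟨_, hf.valid hb.1 hb.pairwise, hf.dAbSatisfies hb.nodup⟩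
  · match b', hb', hinf with
    | infinite l n, hb', _ =>
      have hf : Full l (b.eval * (infinite l n).eval) :=
        (full_eval l n).mul_left (b.eval_mem_closure_wordsOver hsub)
      exact ⟨_, hf.valid hb'.1 hb'.pairwise, hf.dAbSatisfies hb'.nodup⟩

/-- Each merge shortens the list, so merging terminates. -/
theorem exists_isChain_incomparable [LinearOrder A] (bs : List (Block A))
    (hbs : ∀ b ∈ bs, b.Valid) : ∃ bs' : List (Block A), (∀ b ∈ bs', b.Valid) ∧
      DAbSatisfies (bs.map Block.eval).prod (bs'.map Block.eval).prod ∧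
      bs'.IsChain Block.Incomparable := by
  induction hk : bs.length using Nat.strong_induction_on generalizing bs with
  | _ k ih =>
  by_cases hc : bs.IsChain Block.Incomparable
  · exact ⟨bs, hbs, dAbSatisfies_refl _, hc⟩
  obtain ⟨i, hi, hnot⟩ := List.exists_not_getElem_of_not_isChain hc
  obtain ⟨c, hcv, hce⟩ := Block.exists_merge (hbs _ (List.getElem_mem _))
    (hbs _ (List.getElem_mem _)) hnot
  have hsplit : bs = bs.take i ++ bs[i] :: bs[i + 1] :: bs.drop (i + 2) := by
    rw [← List.drop_eq_getElem_cons, ← List.drop_eq_getElem_cons, List.take_append_drop]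
  obtain ⟨bs', h1, h2, h3⟩ := ih (bs.take i ++ c :: bs.drop (i + 2)).length
    (by simp; omega) (bs.take i ++ c :: bs.drop (i + 2)) (by
      intro b hb
      rcases List.mem_append.1 hb with hb | hb
      · exact hbs b (List.mem_of_mem_take hb)
      · rcases List.mem_cons.1 hb with rfl | hb
        · exact hcv
        · exact hbs b (List.mem_of_mem_drop hb)) rfl
  refine ⟨bs', h1, DAbSatisfies.trans ?_ h2, h3⟩
  nth_rewrite 1 [hsplit]
  simp only [List.map_append, List.map_cons, List.prod_append, List.prod_cons]
  rw [← mul_assoc (Block.eval bs[i])]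
  exact (dAbSatisfies_refl _).mul (hce.mul (dAbSatisfies_refl _))

theorem ProfiniteNat.IsInfinite.mul_omega {n : ProfiniteNat} (hn : IsInfinite n) :
    n * omega = n :=
  (isInfinite_omega.mul_left n).eq_of_residue_eq hn fun m _ => by
    rw [residue_mul, residue_omega, add_zero]

/-- The powers of the shared letters are split off to the left of the second block, which keeps
exponent ω for them, and are then absorbed by the first block. -/
theorem Block.exists_shift [LinearOrder A] {l l' : List A} {n n' : A → ProfiniteNat}
    (h : (infinite l n).Valid) (h' : (infinite l' n').Valid) :
    ∃ m m' : A → ProfiniteNat, (infinite l m).Valid ∧ (infinite l' m').Valid ∧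
      (∀ a ∈ l, a ∈ l' → m' a = omega) ∧
      DAbSatisfies ((infinite l n).eval * (infinite l' n').eval)
        ((infinite l m).eval * (infinite l' m').eval) := by
  classical
  let x : Pseudoword A := ((l'.filter (· ∈ l)).map fun a => pow (Pseudoword.letter a) (n' a)).prod
  have hxmem : ∀ {S : Set A}, (∀ a ∈ l', a ∈ l → a ∈ S) → x ∈ closure (of '' wordsOver S) := by
    intro S hS
    refine prod_mem_closure_wordsOver fun α hα => ?_
    obtain ⟨a, ha, rfl⟩ := List.mem_map.1 hα
    simp only [List.mem_filter, decide_eq_true_eq] at ha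
    exact pow_mem_closure_wordsOver _ (letter_mem_closure_wordsOver (hS a ha.1 ha.2))
  have hf : Full l ((infinite l n).eval * x) :=
    (full_eval l n).mul_right (hxmem fun a _ ha => ha)
  let m' : A → ProfiniteNat := fun a => if a ∈ l then omega else n' a
  have hm' : ∀ a ∈ l', IsInfinite (m' a) := by
    intro a ha
    simp only [m']
    split_ifs
    · exact isInfinite_omega
    · exact h'.2.2 a ha
  have hf' : Full l' (x * (infinite l' m').eval) :=
    (full_eval l' m').mul_left (hxmem fun a ha _ => ha)
  -- Both sides are `Full` over `l'` with equal counts, because adding ω to an infinite number does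
  -- not change it.
  have hx : DAbSatisfies (infinite l' n').eval (x * (infinite l' m').eval) := by
    refine ((full_eval l' n').dAbSatisfies h'.nodup).trans ?_
    rw [eval_congr (n' := fun a => count a (x * (infinite l' m').eval))]
    · exact (hf'.dAbSatisfies h'.nodup).symm
    · intro a ha
      have hcx : (a ∈ l'.filter (· ∈ l) → count a x = n' a) ∧
          (a ∉ l'.filter (· ∈ l) → count a x = 1) := 
        count_prod_pow_letter a n' (h'.nodup.filter (· ∈ l))
      rw [count_eval h'.nodup ha (h'.2.2 a ha), count_mul, count_eval h'.nodup ha (hm' a ha)]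
      simp only [m']
      split_ifs with hal
      · rw [hcx.1 (by simp [ha, hal]), (h'.2.2 a ha).mul_omega]
      · rw [hcx.2 (by simp [hal]), one_mul]
  refine ⟨_, m', hf.valid h.1 h.pairwise, ⟨h'.1, h'.pairwise, hm'⟩,
    fun a ha _ => if_pos ha, ?_⟩
  refine ((dAbSatisfies_refl _).mul hx).trans ?_
  rw [← mul_assoc]
  exact (hf.dAbSatisfies h.nodup).mul (dAbSatisfies_refl _)

/-- The list is treated from right to left. A shift changes exponents only, while incomparability
and the demands on the next block involve the left block only through its letters and type. The
clause on the head of the list carries this information through the induction. -/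
theorem exists_isChain_omegaShared [LinearOrder A] (bs : List (Block A))
    (hbs : ∀ b ∈ bs, b.Valid) (hc : bs.IsChain Block.Incomparable) :
    ∃ bs' : List (Block A), (∀ b ∈ bs', b.Valid) ∧
      DAbSatisfies (bs.map Block.eval).prod (bs'.map Block.eval).prod ∧
      bs'.IsChain Block.Incomparable ∧ bs'.IsChain Block.OmegaShared ∧
      bs'.head?.map (fun b => (b.letters, b.IsInf)) =
        bs.head?.map (fun b => (b.letters, b.IsInf)) := by
  induction bs with
  | nil => exact ⟨[], by simp, dAbSatisfies_refl _, .nil, .nil, rfl⟩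
  | cons b bs ih =>
    obtain ⟨hcb, hcs⟩ := List.isChain_cons.1 hc
    obtain ⟨bs', h1, h2, h3, h4, h5⟩ := ih (fun b hb => hbs b (by simp [hb])) hcs
    have hb := hbs b (by simp)
    have h2' : DAbSatisfies ((b :: bs).map Block.eval).prod ((b :: bs').map Block.eval).prod := by
      simp only [List.map_cons, List.prod_cons]
      exact (dAbSatisfies_refl _).mul h2
    cases bs' with
    | nil =>
      exact ⟨[b], by simpa using hb, h2', .singleton _, .singleton _, rfl⟩
    | cons b' r =>
      have hinc : b.Incomparable b' := by
        cases bs with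
        | nil => simp at h5
        | cons b₀ bs =>
          simp only [List.head?_cons, Option.map_some, Option.some.injEq, Prod.mk.injEq] at h5
          have := hcb b₀ (by simp)
          rwa [Block.Incomparable, h5.1, h5.2]
      have hdone : b.OmegaShared b' → ∃ bs' : List (Block A), (∀ b ∈ bs', b.Valid) ∧
          DAbSatisfies ((b :: bs).map Block.eval).prod (bs'.map Block.eval).prod ∧
          bs'.IsChain Block.Incomparable ∧ bs'.IsChain Block.OmegaShared ∧
          bs'.head?.map (fun b => (b.letters, b.IsInf)) =
            (b :: bs).head?.map (fun b => (b.letters, b.IsInf)) := fun ho =>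
        ⟨b :: b' :: r, by
          intro c hc
          rcases List.mem_cons.1 hc with rfl | hc
          · exact hb
          · exact h1 c hc, h2', .cons_cons hinc h3, .cons_cons ho h4, rfl⟩
      match b, b', hb, h1, hinc, h2', h3, h4, hdone with
      | _, .letter a', _, _, _, _, _, _, hdone => exact hdone fun l n h => by simp at h
      -- A letter to the left of an infinite block does not occur in it, by incomparability, so
      -- nothing is shared.
      | .letter a, .infinite l' n', _, _, hinc, _, _, _, hdone =>
        refine hdone fun l n h c hc hcl => absurd ?_ (hinc.2 trivial)
        obtain ⟨rfl, rfl⟩ := Block.infinite.inj h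
        intro d hd
        rw [show d = c from (List.mem_singleton.1 hd).trans (List.mem_singleton.1 hc).symm]
        exact hcl
      | .infinite l n, .infinite l' n', hb, h1, hinc, h2', h3, h4, _ =>
        obtain ⟨m, m', hm, hm', ho, he⟩ := Block.exists_shift hb (h1 (.infinite l' n') List.mem_cons_self)
        refine ⟨.infinite l m :: .infinite l' m' :: r, ?_, h2'.trans ?_,
          .cons_cons hinc ?_, .cons_cons ?_ ?_, rfl⟩
        · intro c hc
          rcases List.mem_cons.1 hc with rfl | hc
          · exact hm
          rcases List.mem_cons.1 hc with rfl | hc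
          · exact hm'
          · exact h1 c (by simp [hc])
        · simp only [List.map_cons, List.prod_cons, ← mul_assoc]
          exact he.mul (dAbSatisfies_refl _)
        · rw [List.isChain_cons] at h3 ⊢
          exact h3
        · rintro _ _ h a ha ha'
          obtain ⟨rfl, rfl⟩ := Block.infinite.inj h
          exact ho a ha ha'
        · rw [List.isChain_cons] at h4 ⊢
          exact h4

theorem isNormalForm_prod [LinearOrder A] {bs : List (Block A)} (hbs : ∀ b ∈ bs, b.Valid)
    (h1 : bs.IsChain Block.Incomparable) (h2 : bs.IsChain Block.OmegaShared) :
    IsNormalForm (bs.map Block.eval).prod := by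
  rw [List.isChain_iff_getElem] at h1 h2
  have hal : ∀ {b c : Block A}, ¬ c.letters ⊆ b.letters →
      (alphabet c.eval \ alphabet b.eval).Nonempty := by
    intro b c h
    rw [Block.alphabet_eval, Block.alphabet_eval]
    obtain ⟨a, ha, ha'⟩ : ∃ a ∈ c.letters, a ∉ b.letters := by simpa [List.subset_def] using h
    exact ⟨a, ha, ha'⟩
  refine ⟨bs.length, fun i => bs[i].eval, ?_, ?_⟩
  · congr 1
    conv_lhs => rw [← List.ofFn_get bs, List.map_ofFn]
    rfl
  · intro i
    have hv : bs[i].Valid := hbs _ (List.getElem_mem _)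
    match hb : bs[i], hv with
    | .letter a, _ => exact Or.inl ⟨a, by simp only [hb, Block.eval]⟩
    | .infinite l n, hv =>
      simp only [hb]
      refine Or.inr ⟨Block.isInfiniteBlock_eval hv, ?_, ?_⟩
      · rintro j (hj | hj)
        · refine hal ((h1 j (by omega)).2 ?_ ∘ ?_)
          · simp only [hj]
            change Block.IsInf bs[i]
            rw [hb]
            trivial
          · simp only [hj]
            change _ → _ ⊆ Block.letters bs[i]
            rw [hb]
            exact id
        · have := (h1 i (by omega)).1
          change (Block.IsInf bs[i] → ¬ Block.letters bs[(i : ℕ) + 1] ⊆ Block.letters bs[i]) at this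
          rw [hb] at this
          simp only [hj] at this
          exact hal (this trivial)
      · intro j hj a ha
        rw [Block.alphabet_eval, Block.alphabet_eval] at ha
        have := h2 j (by omega) l n (by simp only [hj]; exact hb) a ha.1 ha.2
        rw [Block.count_eval hv.nodup ha.2 (hv.2.2 a ha.2), this]

theorem exists_isNormalForm [LinearOrder A] (α : Pseudoword A) :
    ∃ α', IsNormalForm α' ∧ DAbSatisfies α α' := by
  obtain ⟨bs, h1, h2⟩ := isBlockProduct α
  obtain ⟨bs₁, h3, h4, h5⟩ := exists_isChain_incomparable bs h1
  obtain ⟨bs₂, h6, h7, h8, h9, -⟩ := exists_isChain_omegaShared bs₁ h3 h5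
  exact ⟨_, isNormalForm_prod h6 h8 h9, h2.trans (h4.trans h7)⟩

end Existence

/-! ### Syntactic monoids in `DAb` -/

section Syntactic

open ProfiniteCompl

variable {A : Type*}

/-- The syntactic congruence of a language. -/
def syntacticCon (T : Set (FreeMonoid A)) : Con (FreeMonoid A) where
  r u v := ∀ p q, p * u * q ∈ T ↔ p * v * q ∈ T
  iseqv := ⟨fun _ _ _ => Iff.rfl, fun h p q => (h p q).symm, fun h h' p q => (h p q).trans (h' p q)⟩
  mul' {u v u' v'} h h' p q := by
    have h1 := h p (u' * q)
    have h2 := h' (p * v) q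
    simp only [← mul_assoc] at h1 h2 ⊢
    exact h1.trans h2

/-- The finite invariant τ bounds the syntactic monoid, and the remaining hypotheses give it the
identities of the criterion for `DAb`. One-sided implications are enough where exchanging the two
words gives the converse. -/
theorem eventually_mem_iff_of_dAbSatisfies {T : Set (FreeMonoid A)} {σ : Type*} [Finite σ]
    (τ : FreeMonoid A → σ) (hτ : ∀ u v, τ u = τ v → ∀ p q, p * u * q ∈ T → p * v * q ∈ T)
    {N : ℕ} (hN : 0 < N) (h1 : ∀ x y p q, p * (x * y) ^ N * q ∈ T → p * (y * x) ^ N * q ∈ T)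
    (h2 : ∀ x y p q, p * ((x * y) ^ N * (x * y)) * q ∈ T ↔ p * ((x * y) ^ N * (y * x)) * q ∈ T)
    {α β : Pseudoword A} (h : DAbSatisfies α β) {ι : Type*} {F : Filter ι}
    {u v : ι → FreeMonoid A} (hu : Tendsto (fun k => of (u k)) F (𝓝 α))
    (hv : Tendsto (fun k => of (v k)) F (𝓝 β)) : ∀ᶠ k in F, u k ∈ T ↔ v k ∈ T := by
  let c := syntacticCon T
  have hfin : Finite c.Quotient := by
    refine Finite.of_injective (fun a : c.Quotient => τ (Quotient.out a)) fun a b hab => ?_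
    rw [← Quotient.out_eq a, ← Quotient.out_eq b]
    exact Quotient.sound fun p q => ⟨hτ _ _ hab p q, hτ _ _ hab.symm p q⟩
  -- The alphabet may live in any universe, but the test monoids must lie in `Type`.
  let e : c.Quotient ≃* Shrink.{0} c.Quotient := Shrink.mulEquiv.symm
  have hM : IsDAb (Shrink.{0} c.Quotient) := by
    refine IsDAb.of_mulEquiv e hN ?_ ?_
    · intro x y
      induction x using Con.induction_on with | H x => ?_
      induction y using Con.induction_on with | H y => ?_
      exact (Con.eq c).2 fun p q => ⟨h1 x y p q, h1 y x p q⟩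
    · intro x y
      induction x using Con.induction_on with | H x => ?_
      induction y using Con.induction_on with | H y => ?_
      exact (Con.eq c).2 (h2 x y)
  have := hM.finite
  let ψ : FreeMonoid A →* Shrink.{0} c.Quotient := e.toMonoidHom.comp c.mk'
  have hαβ := h _ hM (lift ψ) (continuous_lift ψ)
  filter_upwards [eventually_lift_eq ψ hu, eventually_lift_eq ψ hv] with k hk hk'
  have h3 : c.mk' (u k) = c.mk' (v k) := e.injective (hk.trans (hαβ.trans hk'.symm))
  have h4 := (Con.eq c).1 h3 1 1
  simpa using h4

end Syntactic

/-! ### Languages given by patterns of blocks -/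

section Lists

variable {A : Type*}

theorem List.Sublist.replace_middle {w a b b' c : List A}
    (h : ∀ w' : List A, w'.Sublist w → w'.Sublist b → w'.Sublist b') (hw : w.Sublist (a ++ b ++ c)) :
    w.Sublist (a ++ b' ++ c) := by
  obtain ⟨w₁₂, w₃, rfl, h12, h3⟩ := List.sublist_append_iff.1 hw
  obtain ⟨w₁, w₂, rfl, h1, h2⟩ := List.sublist_append_iff.1 h12
  refine List.Sublist.append (List.Sublist.append h1 (h _ ?_ h2)) h3
  exact (List.sublist_append_right w₁ w₂).trans (List.sublist_append_left _ w₃)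

theorem List.Sublist.of_cons_append {a : A} {w b c : List A} (ha : a ∉ b)
    (h : (a :: w).Sublist (b ++ c)) : (a :: w).Sublist c := by
  obtain ⟨w₁, w₂, h1, h2, h3⟩ := List.sublist_append_iff.1 h
  cases w₁ with
  | nil => rw [h1]; exact h3
  | cons d w₁ =>
    obtain rfl : a = d := by simpa using congrArg List.head? h1
    exact absurd (h2.subset List.mem_cons_self) ha

theorem List.Sublist.of_concat_append {a : A} {w b c : List A} (ha : a ∉ c)
    (h : (w ++ [a]).Sublist (b ++ c)) : (w ++ [a]).Sublist b := by
  have h' := List.reverse_sublist.2 h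
  rw [List.reverse_append, List.reverse_append] at h'
  have h2 := List.Sublist.of_cons_append (by simpa using ha) h'
  rw [← List.reverse_sublist]
  simpa using h2

theorem List.sublist_flatten_replicate {w v : List A} (h : w ⊆ v) {k : ℕ} (hk : w.length ≤ k) :
    w.Sublist (List.replicate k v).flatten := by
  induction w generalizing k with
  | nil => exact List.nil_sublist _
  | cons a w ih =>
    rw [List.cons_subset] at h
    obtain ⟨k, rfl⟩ : ∃ j, k = j + 1 := ⟨k - 1, by simp at hk; omega⟩
    rw [List.replicate_succ, List.flatten_cons]
    exact (List.singleton_sublist.2 h.1).append (ih h.2 (by simpa using hk))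

/-- Each copy of z whose labels are not all equal to the current lower bound raises that bound for
all later copies. With d + 1 copies and labels in an interval of length d, some copy must be
constant. -/
theorem exists_constant_copy {z t : List A} (d lo : ℕ) (xs : List (A × ℕ))
    (hmap : xs.map Prod.fst = (List.replicate (d + 1) z).flatten ++ t)
    (hsort : xs.Pairwise fun e e' => e.2 ≤ e'.2) (hlab : ∀ e ∈ xs, lo ≤ e.2 ∧ e.2 ≤ lo + d) :
    ∃ j X, List.Sublist X xs ∧ X.map Prod.fst = z ∧ ∀ e ∈ X, e.2 = j := by
  induction d generalizing lo xs with
  | zero =>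
    rw [List.replicate_succ, List.flatten_cons, List.append_assoc] at hmap
    obtain ⟨X, Y, rfl, hX, -⟩ := List.map_eq_append_iff.1 hmap
    refine ⟨lo, X, List.sublist_append_left _ _, hX, fun e he => ?_⟩
    have := hlab e (List.mem_append_left _ he)
    omega
  | succ d ih =>
    rw [List.replicate_succ, List.flatten_cons, List.append_assoc] at hmap
    obtain ⟨X, Y, rfl, hX, hY⟩ := List.map_eq_append_iff.1 hmap
    by_cases hc : ∀ e ∈ X, e.2 = lo
    · exact ⟨lo, X, List.sublist_append_left _ _, hX, hc⟩
    push Not at hc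
    obtain ⟨e, he, hne⟩ := hc
    have hel := hlab e (List.mem_append_left _ he)
    rw [List.pairwise_append] at hsort
    obtain ⟨j, X', h1, h2, h3⟩ := ih (lo + 1) Y hY hsort.2.1 fun e' he' => by
      have := hlab e' (List.mem_append_right _ he')
      have := hsort.2.2 e he e' he'
      omega
    exact ⟨j, X', h1.trans (List.sublist_append_right _ _), h2, h3⟩

end Lists

/-- A sequence of `L` blocks given by their letters, where it is recorded which blocks are infinite
and each block has a key word that separates it from infinite neighbours. -/
structure BlockPattern (A : Type*) where
  /-- The number of blocks. -/
  L : ℕ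
  /-- The letters of a block. -/
  B : ℕ → Set A
  /-- The block is infinite. -/
  inf : ℕ → Prop
  /-- The key word of a block. -/
  key : ℕ → List A
  finite : ∀ j, (B j).Finite
  B_eq_empty : ∀ j, L ≤ j → B j = ∅
  key_length : ∀ j, (key j).length ≤ 2
  key_head : ∀ j, inf j → j + 1 < L → ∃ a t, key (j + 1) = a :: t ∧ a ∉ B j
  key_last : ∀ j, inf (j + 1) → j + 1 < L → ∃ t a, key j = t ++ [a] ∧ a ∉ B (j + 1)

namespace BlockPattern

variable {A : Type*}

/-- The letters with label `j` of a labelled word. -/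
def piece (j : ℕ) (x : List (A × ℕ)) : List A := (x.filter fun e => e.2 = j).map Prod.fst

open Classical in
/-- The number of occurrences of a letter with a label at most `j`. -/
noncomputable def cut (j : ℕ) (a : A) (x : List (A × ℕ)) : ℕ :=
  x.countP fun e => e.1 = a ∧ e.2 ≤ j

@[simp] theorem piece_append (j : ℕ) (x y : List (A × ℕ)) :
    piece j (x ++ y) = piece j x ++ piece j y := by simp [piece]

@[simp] theorem cut_append (j : ℕ) (a : A) (x y : List (A × ℕ)) :
    cut j a (x ++ y) = cut j a x + cut j a y := by simp [cut]

theorem mem_piece {j : ℕ} {x : List (A × ℕ)} {a : A} : a ∈ piece j x ↔ (a, j) ∈ x := by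
  simp [piece]

theorem piece_eq_nil {j : ℕ} {x : List (A × ℕ)} (h : ∀ e ∈ x, e.2 ≠ j) : piece j x = [] :=
  List.eq_nil_iff_forall_not_mem.2 fun _ ha => h _ (mem_piece.1 ha) rfl

theorem piece_map_const (i j : ℕ) (s : List A) :
    piece i (s.map fun a => (a, j)) = if i = j then s else [] := by
  split_ifs with h
  · subst h
    simp [piece, List.filter_map, Function.comp_def]
  · refine piece_eq_nil fun e he => ?_
    obtain ⟨a, -, rfl⟩ := List.mem_map.1 he
    exact fun h' => h h'.symm

open Classical in
theorem cut_map_const (i j : ℕ) (a : A) (s : List A) :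
    cut i a (s.map fun a => (a, j)) = if j ≤ i then s.count a else 0 := by
  rw [cut, List.countP_map]
  split_ifs with h
  · simp [Function.comp_def, h, List.count, beq_eq_decide]
  · simp [Function.comp_def, h]

variable (P : BlockPattern A)

/-- A labelled word whose labels split it into the blocks of the pattern. The numbers of occurrences
of letters in prefixes of blocks are prescribed, except for letters of both neighbouring blocks. -/
structure Labelling {m : ℕ} (C : ℕ → A → ZMod m) (x : List (A × ℕ)) : Prop where
  sorted : x.Pairwise fun e e' => e.2 ≤ e'.2
  mem : ∀ e ∈ x, e.1 ∈ P.B e.2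
  key : ∀ j < P.L, (P.key j).Sublist (piece j x)
  short : ∀ j < P.L, ¬ P.inf j → (piece j x).length ≤ 1
  count : ∀ j < P.L, ∀ a, a ∉ P.B j ∨ a ∉ P.B (j + 1) → (cut j a x : ZMod m) = C j a

/-- The language of a pattern. -/
def lang {m : ℕ} (C : ℕ → A → ZMod m) : Set (FreeMonoid A) :=
  {u | ∃ x, P.Labelling C x ∧ x.map Prod.fst = u.toList}

theorem lt_of_mem {j : ℕ} {a : A} (h : a ∈ P.B j) : j < P.L := by
  by_contra! hle
  rw [P.B_eq_empty j hle] at h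
  exact h

/-- Some copy of z lies entirely in one block j, which then contains all letters of s. As z has at
least two letters, j is infinite, so the whole of s' can be labelled j. The rest of the proof shows
that the letters of s with other labels are not needed. -/
theorem replace_mem_lang {m : ℕ} {C : ℕ → A → ZMod m} {p q u s' : FreeMonoid A}
    {s z t : List A} (hs : s = (List.replicate (P.L + 1) z).flatten ++ t) (hz : 2 ≤ z.length)
    (hsub : s ⊆ z) (hperm : s.Perm s'.toList)
    (hsl : ∀ w : List A, w.length ≤ 2 → w ⊆ s → w.Sublist s'.toList)
    (hu : u.toList = s) (h : p * u * q ∈ P.lang C) : p * s' * q ∈ P.lang C := by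
  classical
  obtain ⟨x, hx, hmap⟩ := h
  rw [FreeMonoid.toList_mul, FreeMonoid.toList_mul, hu] at hmap
  obtain ⟨xps, xq, rfl, hps, hq⟩ := List.map_eq_append_iff.1 hmap
  obtain ⟨xp, xs, rfl, hp, hxs⟩ := List.map_eq_append_iff.1 hps
  obtain ⟨hsort, hmem, hkey, hshort, hcount⟩ := hx
  have hsort' := hsort
  rw [List.pairwise_append, List.pairwise_append] at hsort'
  obtain ⟨⟨hsp, hss, hsps⟩, hsq, hspq⟩ := hsort'
  have hlt : ∀ e ∈ xp ++ xs ++ xq, e.2 < P.L := fun e he => P.lt_of_mem (hmem e he)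
  obtain ⟨j, X, hX, hXz, hXj⟩ := exists_constant_copy P.L 0 xs (hxs.trans hs) hss fun e he => by
    have := hlt e (by simp [he])
    omega
  have hXx : X.Sublist (xp ++ xs ++ xq) :=
    hX.trans ((List.sublist_append_right _ _).trans (List.sublist_append_left _ _))
  have hsB : ∀ a ∈ s, a ∈ P.B j := by
    intro a ha
    have ha' := hsub ha
    rw [← hXz] at ha'
    obtain ⟨e, he, rfl⟩ := List.mem_map.1 ha'
    rw [← hXj e he]
    exact hmem e (hXx.subset he)
  obtain ⟨e₀, he₀⟩ : ∃ e, e ∈ X := by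
    refine List.exists_mem_of_length_pos ?_
    have := congrArg List.length hXz
    rw [List.length_map] at this
    omega
  have hej : e₀.2 = j := hXj e₀ he₀
  have he₀s := hX.subset he₀
  have hjL : j < P.L := hej ▸ hlt e₀ (hXx.subset he₀)
  have hinf : P.inf j := by
    by_contra hninf
    have h1 := hshort j hjL hninf
    have h2 : z.Sublist (piece j (xp ++ xs ++ xq)) := by
      rw [← hXz, piece]
      refine List.Sublist.map _ ?_
      have h3 := hXx.filter fun e => decide (e.2 = j)
      rwa [List.filter_eq_self.2 fun e he => by simpa using hXj e he] at h3
    have := h2.length_le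
    omega
  have hmems : ∀ e ∈ xs, e.1 ∈ s := fun e he => by
    rw [← hxs]; exact List.mem_map_of_mem he
  have hple : ∀ e ∈ xp, e.2 ≤ j := fun e he => hej ▸ hsps e he e₀ he₀s
  have hqle : ∀ e ∈ xq, j ≤ e.2 := fun e he => hej ▸ hspq e₀ (by simp [he₀s]) e he
  -- A larger label in s would confine all of piece j + 1 to s, but its key word starts with a
  -- letter outside block j.
  have hub : ∀ e ∈ xs, e.2 ≤ j + 1 := by
    intro e he
    by_contra! hgt
    have hj1 : j + 1 < P.L := hgt.trans (hlt e (by simp [he]))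
    obtain ⟨a, t', hat, haB⟩ := P.key_head j hinf hj1
    have ha := (hkey (j + 1) hj1).subset (hat ▸ List.mem_cons_self)
    rw [mem_piece, List.mem_append, List.mem_append] at ha
    rcases ha with (ha | ha) | ha
    · exact absurd (hple _ ha) (by simp)
    · exact haB (hsB _ (hmems _ ha))
    · have : e.2 ≤ j + 1 := hspq e (by simp [he]) _ ha
      omega
  have hlb : ∀ e ∈ xs, j ≤ e.2 + 1 := by
    intro e he
    by_contra! hgt
    obtain ⟨i, rfl⟩ : ∃ i, j = i + 1 := ⟨j - 1, by omega⟩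
    obtain ⟨t', a, hat, haB⟩ := P.key_last i hinf hjL
    have ha := (hkey i (by omega)).subset (show a ∈ P.key i by rw [hat]; simp)
    rw [mem_piece, List.mem_append, List.mem_append] at ha
    rcases ha with (ha | ha) | ha
    · have : i ≤ e.2 := hsps _ ha e he
      omega
    · exact haB (hsB _ (hmems _ ha))
    · have : i + 1 ≤ i := hqle _ ha
      omega
  have hpieces : ∀ i, ∀ a ∈ piece i xs, a ∈ s := fun i a ha => hmems _ (mem_piece.1 ha)
  refine ⟨xp ++ (s'.toList.map fun a => (a, j)) ++ xq, ⟨?_, ?_, ?_, ?_, ?_⟩, ?_⟩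
  · rw [List.pairwise_append, List.pairwise_append]
    refine ⟨⟨hsp, ?_, ?_⟩, hsq, ?_⟩
    · rw [List.pairwise_map]
      exact List.pairwise_of_forall fun _ _ => le_rfl
    · intro e he e' he'
      obtain ⟨a, -, rfl⟩ := List.mem_map.1 he'
      exact hple e he
    · intro e he e' he'
      rcases List.mem_append.1 he with he | he
      · exact hspq e (by simp [he]) e' he'
      · obtain ⟨a, -, rfl⟩ := List.mem_map.1 he
        exact hqle e' he'
  · intro e he
    rcases List.mem_append.1 he with he | he
    · rcases List.mem_append.1 he with he | he
      · exact hmem e (by simp [he])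
      · obtain ⟨a, ha, rfl⟩ := List.mem_map.1 he
        exact hsB a (hperm.symm.subset ha)
    · exact hmem e (by simp [he])
  · intro i hi
    have hk := hkey i hi
    simp only [piece_append, piece_map_const] at hk ⊢
    rcases lt_trichotomy i j with hij | rfl | hij
    · rw [if_neg (by omega), List.append_nil]
      have hq0 : piece i xq = [] := piece_eq_nil fun e he => by have := hqle e he; omega
      rw [hq0, List.append_nil] at hk ⊢
      -- The last letter of this key word is outside block j, so the key word already embeds in the
      -- part before s.
      by_cases hij' : i + 1 = j
      · subst hij'
        obtain ⟨t', a, hat, haB⟩ := P.key_last i hinf hjL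
        rw [hat] at hk ⊢
        exact List.Sublist.of_concat_append (fun h => haB (hsB _ (hpieces i a h))) hk
      · rwa [piece_eq_nil (x := xs) fun e he => by have := hlb e he; omega, List.append_nil] at hk
    · rw [if_pos rfl]
      -- Key words have at most two letters, so the part embedded in s embeds in s' as well.
      refine List.Sublist.replace_middle (fun w hw hw' => ?_) hk
      exact hsl w (hw.length_le.trans (P.key_length i)) fun a ha => hpieces i a (hw'.subset ha)
    · rw [if_neg (by omega), List.append_nil]
      have hp0 : piece i xp = [] := piece_eq_nil fun e he => by have := hple e he; omega
      rw [hp0, List.nil_append] at hk ⊢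
      by_cases hij' : i = j + 1
      · subst hij'
        obtain ⟨a, t', hat, haB⟩ := P.key_head j hinf hi
        rw [hat] at hk ⊢
        exact List.Sublist.of_cons_append (fun h => haB (hsB _ (hpieces _ a h))) hk
      · rwa [piece_eq_nil (x := xs) fun e he => by have := hub e he; omega, List.nil_append] at hk
  · intro i hi hni
    have hl := hshort i hi hni
    have hij : i ≠ j := fun h => hni (h ▸ hinf)
    simp only [piece_append, piece_map_const, if_neg hij, List.length_append] at hl ⊢
    simp only [List.length_nil]
    omega
  · intro i hi a ha
    rw [← hcount i hi a ha]
    congr 1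
    simp only [cut_append, cut_map_const]
    congr 2
    -- Relabelling moves an occurrence of a across cut i only if a belongs to both blocks at that
    -- cut, and there the count is not prescribed.
    have hiff : ∀ e ∈ xs, e.1 = a → (e.2 ≤ i ↔ j ≤ i) := by
      intro e he hea
      have h1 := hub e he
      have h2 := hlb e he
      have h3 := hsB _ (hmems e he)
      have h4 := hmem e (by simp [he])
      rw [hea] at h3 h4
      by_contra hne
      have h5 : (e.2 = i ∧ j = i + 1) ∨ (e.2 = i + 1 ∧ j = i) := by omega
      rcases h5 with ⟨h5, h6⟩ | ⟨h5, h6⟩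
      · rw [h6] at h3; rw [h5] at h4
        exact ha.elim (· h4) (· h3)
      · rw [h6] at h3; rw [h5] at h4
        exact ha.elim (· h3) (· h4)
    rw [← hperm.count_eq, ← hxs, List.count, List.countP_map, cut]
    split_ifs with hji
    · refine List.countP_congr fun e he => ?_
      have := hiff e he
      simp only [Function.comp_apply, beq_iff_eq, decide_eq_true_eq]
      tauto
    · symm
      rw [List.countP_eq_zero]
      intro e he
      have := hiff e he
      simp only [decide_eq_true_eq]
      tauto
  · simp [hp, hq, Function.comp_def]

/-- The exponent is even so that z can be the square of x, which has at least two letters unless x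
is empty. -/
theorem replace_power_mem_lang {m : ℕ} {C : ℕ → A → ZMod m} {p q x y t t' : FreeMonoid A}
    (hxy : x.toList.Perm y.toList) (ht : t.toList ⊆ x.toList) (htt : t.toList.Perm t'.toList)
    (h : p * (x ^ (2 * (P.L + 1)) * t) * q ∈ P.lang C) :
    p * (y ^ (2 * (P.L + 1)) * t') * q ∈ P.lang C := by
  have hpow : ∀ (x : FreeMonoid A) k, (x ^ k).toList = (List.replicate k x.toList).flatten :=
    fun x k => toList_ofList_pow x.toList k
  have hsub : ∀ (x : FreeMonoid A) k, (x ^ k).toList ⊆ x.toList := by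
    intro x k a ha
    rw [hpow] at ha
    obtain ⟨l, hl, ha⟩ := List.mem_flatten.1 ha
    rwa [(List.mem_replicate.1 hl).2] at ha
  have hsub' : (x ^ (2 * (P.L + 1)) * t).toList ⊆ x.toList := by
    rw [FreeMonoid.toList_mul]
    exact List.append_subset.2 ⟨hsub _ _, ht⟩
  rcases Nat.eq_zero_or_pos x.toList.length with hx0 | hx0
  · have hx : x = 1 := FreeMonoid.toList.injective (List.length_eq_zero_iff.1 hx0)
    have hy : y = 1 := FreeMonoid.toList.injective (by
      have := hxy.length_eq
      exact List.length_eq_zero_iff.1 (by omega))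
    have ht0 : t = 1 := FreeMonoid.toList.injective (List.subset_nil.1 (by
      rw [hx] at ht; exact ht))
    have ht0' : t' = 1 := FreeMonoid.toList.injective (by
      rw [ht0] at htt; exact htt.symm.eq_nil)
    rw [hy, ht0']
    rwa [hx, ht0] at h
  refine P.replace_mem_lang (z := (x * x).toList) (t := t.toList) ?_ ?_ ?_ ?_ ?_ rfl h
  · rw [FreeMonoid.toList_mul, pow_mul, pow_two, hpow]
  · rw [FreeMonoid.toList_mul, List.length_append]
    omega
  · rw [FreeMonoid.toList_mul x x]
    exact fun a ha => List.mem_append_left _ (hsub' ha)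
  · rw [FreeMonoid.toList_mul, FreeMonoid.toList_mul, hpow, hpow]
    refine List.Perm.append ?_ htt
    generalize 2 * (P.L + 1) = k
    induction k with
    | zero => exact .refl _
    | succ k ih =>
      rw [List.replicate_succ, List.replicate_succ, List.flatten_cons, List.flatten_cons]
      exact hxy.append ih
  · intro w hw hws
    rw [FreeMonoid.toList_mul, hpow]
    refine (List.sublist_flatten_replicate (fun a ha => ?_) (by omega)).trans
      (List.sublist_append_left _ _)
    exact hxy.subset (hsub' (hws ha))

/-- The letters of a pattern. -/
def support : Set A := ⋃ j ∈ Set.Iio P.L, P.B j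

theorem finite_support : P.support.Finite :=
  (Set.finite_Iio P.L).biUnion fun j _ => P.finite j

/-- The data of a labelled word which determine how it can be used in words of the language. -/
noncomputable def summary (m : ℕ) (x : List (A × ℕ)) (j : Fin P.L) :
    ({w // w ∈ (P.key j).sublists} → Prop) × Fin 3 × (P.support → ZMod m) :=
  (fun w => w.1.Sublist (piece j x), ⟨min (piece j x).length 2, by omega⟩,
    fun a => cut j a.1 x)

/-- The summaries of all labelled words with a given underlying word. -/
def summaries (m : ℕ) (u : FreeMonoid A) :
    Set ((j : Fin P.L) →
      ({w // w ∈ (P.key j).sublists} → Prop) × Fin 3 × (P.support → ZMod m)) :=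
  {f | ∃ x : List (A × ℕ), x.map Prod.fst = u.toList ∧ (x.Pairwise fun e e' => e.2 ≤ e'.2) ∧
    (∀ e ∈ x, e.1 ∈ P.B e.2) ∧ P.summary m x = f}

/-- A labelled factor with the same summary can be substituted: it meets the conditions on keys,
lengths and counts in the same contexts. -/
theorem mem_lang_of_summaries_eq {m : ℕ} {C : ℕ → A → ZMod m} {u v : FreeMonoid A}
    (huv : P.summaries m u = P.summaries m v) (p q : FreeMonoid A)
    (h : p * u * q ∈ P.lang C) : p * v * q ∈ P.lang C := by
  obtain ⟨x, ⟨hsort, hmem, hkey, hshort, hcount⟩, hmap⟩ := h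
  rw [FreeMonoid.toList_mul, FreeMonoid.toList_mul] at hmap
  obtain ⟨xps, xq, rfl, hps, hq⟩ := List.map_eq_append_iff.1 hmap
  obtain ⟨xp, xu, rfl, hp, hxu⟩ := List.map_eq_append_iff.1 hps
  rw [List.pairwise_append, List.pairwise_append] at hsort
  obtain ⟨⟨hsp, hsu, hspu⟩, hsq, hspq⟩ := hsort
  have hmemu : ∀ e ∈ xu, e.1 ∈ P.B e.2 := fun e he => hmem e (by simp [he])
  have hmemS : P.summary m xu ∈ P.summaries m u := ⟨xu, hxu, hsu, hmemu, rfl⟩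
  rw [huv] at hmemS
  obtain ⟨xv, hxv, hsv, hmemv, hsum⟩ := hmemS
  have hsub : ∀ j < P.L, ∀ w : List A, w.Sublist (P.key j) →
      (w.Sublist (piece j xv) ↔ w.Sublist (piece j xu)) := by
    intro j hj w hw
    have h1 := congrArg Prod.fst (congrFun hsum ⟨j, hj⟩)
    exact iff_of_eq (congrFun h1 ⟨w, List.mem_sublists.2 hw⟩)
  have hlen : ∀ j < P.L, min (piece j xv).length 2 = min (piece j xu).length 2 := by
    intro j hj
    exact congrArg Fin.val (congrArg (fun z => z.2.1) (congrFun hsum ⟨j, hj⟩))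
  have hcut : ∀ j < P.L, ∀ a, (cut j a xv : ZMod m) = cut j a xu := by
    intro j hj a
    by_cases ha : a ∈ P.support
    · exact congrFun (congrArg (fun z => z.2.2) (congrFun hsum ⟨j, hj⟩)) ⟨a, ha⟩
    · have hzero : ∀ x : List (A × ℕ), (∀ e ∈ x, e.1 ∈ P.B e.2) → cut j a x = 0 := by
        intro x hx
        rw [cut, List.countP_eq_zero]
        intro e he hea
        simp only [decide_eq_true_eq] at hea
        refine ha (Set.mem_biUnion (P.lt_of_mem (hx e he)) ?_)
        rw [← hea.1]
        exact hx e he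
      rw [hzero xv hmemv, hzero xu hmemu]
  -- Every label of the new factor already occurs in the old one, so the labels stay sorted in
  -- context.
  have hlab : ∀ e ∈ xv, ∃ e' ∈ xu, e'.2 = e.2 := by
    intro e he
    have h1 := hlen e.2 (P.lt_of_mem (hmemv e he))
    have h2 := List.length_pos_of_mem (mem_piece.2 he)
    obtain ⟨a, ha⟩ := List.exists_mem_of_length_pos (l := piece e.2 xu) (by omega)
    exact ⟨_, mem_piece.1 ha, rfl⟩
  refine ⟨xp ++ xv ++ xq, ⟨?_, ?_, ?_, ?_, ?_⟩, ?_⟩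
  · rw [List.pairwise_append, List.pairwise_append]
    refine ⟨⟨hsp, hsv, ?_⟩, hsq, ?_⟩
    · intro e he e' he'
      obtain ⟨e'', h1, h2⟩ := hlab e' he'
      exact h2 ▸ hspu e he e'' h1
    · intro e he e' he'
      rcases List.mem_append.1 he with he | he
      · exact hspq e (by simp [he]) e' he'
      · obtain ⟨e'', h1, h2⟩ := hlab e he
        exact h2 ▸ hspq e'' (by simp [h1]) e' he'
  · intro e he
    rcases List.mem_append.1 he with he | he
    · rcases List.mem_append.1 he with he | he
      · exact hmem e (by simp [he])
      · exact hmemv e he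
    · exact hmem e (by simp [he])
  · intro j hj
    have hk := hkey j hj
    rw [piece_append, piece_append] at hk ⊢
    exact List.Sublist.replace_middle (fun w hw hw' => (hsub j hj w hw).2 hw') hk
  · intro j hj hni
    have h1 := hshort j hj hni
    have h2 := hlen j hj
    rw [piece_append, piece_append, List.length_append, List.length_append] at h1 ⊢
    omega
  · intro j hj a ha
    rw [← hcount j hj a ha]
    simp only [cut_append, Nat.cast_add, hcut j hj a]
  · simp [hp, hq, hxv]

/-- Summaries take finitely many values, and both identities follow by substitution because x * y
and y * x are permutations of each other. -/
theorem eventually_mem_lang_iff {m : ℕ} [NeZero m] (C : ℕ → A → ZMod m) {α β : Pseudoword A}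
    (h : DAbSatisfies α β) {ι : Type*} {F : Filter ι} {u v : ι → FreeMonoid A}
    (hu : Tendsto (fun k => ProfiniteCompl.of (u k)) F (𝓝 α))
    (hv : Tendsto (fun k => ProfiniteCompl.of (v k)) F (𝓝 β)) :
    ∀ᶠ k in F, u k ∈ P.lang C ↔ v k ∈ P.lang C := by
  have := P.finite_support.to_subtype
  have hkey : ∀ j : Fin P.L, Finite {w // w ∈ (P.key j).sublists} := fun j =>
    (List.finite_toSet (P.key j).sublists).to_subtype
  have : Finite (Set ((j : Fin P.L) →
      ({w // w ∈ (P.key j).sublists} → Prop) × Fin 3 × (P.support → ZMod m))) := inferInstance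
  have hswap : ∀ x y : FreeMonoid A, (x * y).toList.Perm (y * x).toList := fun x y => by
    rw [FreeMonoid.toList_mul, FreeMonoid.toList_mul]
    exact List.perm_append_comm
  refine eventually_mem_iff_of_dAbSatisfies (P.summaries m)
    (fun u v huv p q => P.mem_lang_of_summaries_eq huv p q) (N := 2 * (P.L + 1)) (by omega)
    ?_ ?_ h hu hv
  · intro x y p q hm
    rw [← mul_one ((y * x) ^ _)]
    refine P.replace_power_mem_lang (hswap x y) (t := 1) (by simp) (.refl _) ?_
    rwa [mul_one]
  · intro x y p q
    exact ⟨P.replace_power_mem_lang (.refl _) (fun _ h => h) (hswap x y),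
      P.replace_power_mem_lang (.refl _) (hswap y x).subset (hswap y x)⟩

end BlockPattern

/-! ### Words approximating products of blocks -/

section Approximation

open ProfiniteCompl ProfiniteNat Pseudoword

variable {A : Type*}

/-- A sequence of natural numbers which converges to a profinite natural number. -/
noncomputable def ProfiniteNat.approx (n : ProfiniteNat) : ℕ → ℕ := (exists_tendsto_ofNat n).choose

theorem ProfiniteNat.tendsto_approx (n : ProfiniteNat) :
    Tendsto (fun k => ofNat (n.approx k)) atTop (𝓝 n) := (exists_tendsto_ofNat n).choose_spec

namespace Block

/-- A sequence of words which converges to the pseudoword of a block. -/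
noncomputable def word : Block A → ℕ → List A
  | letter a, _ => [a]
  | infinite l n, k => (List.replicate k.factorial l).flatten ++
      l.flatMap fun a => List.replicate ((n a).approx k) a

theorem tendsto_word (b : Block A) :
    Tendsto (fun k => of (FreeMonoid.ofList (b.word k))) atTop (𝓝 b.eval) := by
  cases b with
  | letter a => exact tendsto_const_nhds
  | infinite l n =>
    have h1 : Tendsto (fun k : ℕ => of (FreeMonoid.ofList (List.replicate k.factorial l).flatten))
        atTop (𝓝 (pow (l.map Pseudoword.letter).prod omega)) := by
      rw [prod_map_letter]
      refine (tendsto_pow tendsto_const_nhds tendsto_omega).congr fun k => ?_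
      rw [← toList_ofList_pow, FreeMonoid.ofList_toList]
    have h2 : ∀ l : List A, Tendsto (fun k : ℕ => of (FreeMonoid.ofList
        (l.flatMap fun a => List.replicate ((n a).approx k) a))) atTop
        (𝓝 (l.map fun a => pow (Pseudoword.letter a) (n a)).prod) := by
      intro l
      induction l with
      | nil => exact tendsto_const_nhds
      | cons a l ih =>
        simp only [List.flatMap_cons, FreeMonoid.ofList_append, of_mul, List.map_cons,
          List.prod_cons]
        refine Tendsto.mul ?_ ih
        refine (tendsto_pow (tendsto_const_nhds (x := Pseudoword.letter a))
          (n a).tendsto_approx).congr fun k => ?_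
        congr 1
        induction (n a).approx k with
        | zero => rfl
        | succ k ih => rw [pow_succ', ih, List.replicate_succ, FreeMonoid.ofList_cons]
    simp only [word, FreeMonoid.ofList_append, of_mul]
    exact h1.mul (h2 l)

theorem subset_letters (b : Block A) (k : ℕ) : b.word k ⊆ b.letters := by
  cases b with
  | letter a => exact fun _ h => h
  | infinite l n =>
    intro a ha
    rcases List.mem_append.1 ha with ha | ha
    · obtain ⟨l', hl', ha⟩ := List.mem_flatten.1 ha
      rwa [(List.mem_replicate.1 hl').2] at ha
    · obtain ⟨c, hc, ha⟩ := List.mem_flatMap.1 ha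
      rwa [(List.mem_replicate.1 ha).2]

open Classical in
/-- The number of occurrences of a letter in a block modulo `m`. -/
noncomputable def res (m : ℕ) [NeZero m] (a : A) : Block A → ZMod m
  | letter c => if c = a then 1 else 0
  | infinite l n => if a ∈ l then residue m (n a) else 0

open Classical in
/-- The number of occurrences of a letter in a word approximating a block. -/
noncomputable def wordCount (k : ℕ) (a : A) (b : Block A) : ℕ := (b.word k).count a

open Classical in
theorem eventually_wordCount_eq (m : ℕ) [NeZero m] {b : Block A}
    (hb : ∀ l n, b = infinite l n → l.Nodup) :
    ∀ᶠ k in atTop, ∀ a, (b.wordCount k a : ZMod m) = b.res m a := by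
  cases b with
  | letter c =>
    refine Eventually.of_forall fun k a => ?_
    rw [wordCount, word, res, List.count_singleton]
    by_cases h : c = a
    · simp [h]
    · simp [h]
  | infinite l n =>
    have hnd := hb l n rfl
    have hev : ∀ᶠ k in atTop, ∀ a ∈ l.toFinset, ((n a).approx k : ZMod m) = residue m (n a) :=
      (Filter.eventually_all_finset _).2 fun a _ => eventually_residue_eq m (n a).tendsto_approx
    filter_upwards [hev, eventually_ge_atTop m] with k hk hkm a
    by_cases ha : a ∈ l
    · have h1 : ∀ N, (List.replicate N l).flatten.count a = N := by
        intro N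
        induction N with
        | zero => rfl
        | succ N ih =>
          rw [List.replicate_succ, List.flatten_cons, List.count_append, ih,
            List.count_eq_one_of_mem hnd ha, add_comm]
      have h2 : ∀ l : List A, l.Nodup → a ∈ l →
          (l.flatMap fun a => List.replicate ((n a).approx k) a).count a = (n a).approx k := by
        intro l
        induction l with
        | nil => intro _ h; simp at h
        | cons c l ih =>
          intro hnd hal
          rw [List.nodup_cons] at hnd
          rw [List.flatMap_cons, List.count_append, List.count_replicate]
          by_cases hca : c = a
          · subst hca
            have : c ∉ l.flatMap fun a => List.replicate ((n a).approx k) a := by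
              rw [List.mem_flatMap]
              rintro ⟨d, hd, hcd⟩
              exact hnd.1 ((List.mem_replicate.1 hcd).2 ▸ hd)
            rw [List.count_eq_zero.2 this]
            simp
          · rw [ih hnd.2 ((List.mem_cons.1 hal).resolve_left (Ne.symm hca))]
            simp [hca]
      rw [wordCount, word, res, if_pos ha, List.count_append, h1, h2 l hnd ha, Nat.cast_add,
        hk a (by simpa using ha),
        (ZMod.natCast_eq_zero_iff _ _).2 (Nat.dvd_factorial (NeZero.pos m) hkm), zero_add]
    · rw [wordCount, res, if_neg ha, List.count_eq_zero.2 fun h => ha (subset_letters _ k h), Nat.cast_zero]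

end Block

/-- The block with a given index; beyond the end of the list it is a block without letters. -/
noncomputable def blockAt (bs : List (Block A)) (j : ℕ) : Block A :=
  (bs[j]?).getD (.infinite [] fun _ => omega)

theorem blockAt_of_lt {bs : List (Block A)} {j : ℕ} (h : j < bs.length) : blockAt bs j = bs[j] := by
  simp [blockAt, h]

theorem blockAt_of_le {bs : List (Block A)} {j : ℕ} (h : bs.length ≤ j) :
    blockAt bs j = .infinite [] fun _ => omega := by
  simp [blockAt, h]

/-- The words approximating the blocks, labelled by the indices of the blocks. -/
noncomputable def labelledWord (k : ℕ) : ℕ → List (Block A) → List (A × ℕ)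
  | _, [] => []
  | i, b :: bs => (b.word k).map (fun a => (a, i)) ++ labelledWord k (i + 1) bs

theorem map_fst_labelledWord (k i : ℕ) (bs : List (Block A)) :
    (labelledWord k i bs).map Prod.fst = (bs.map fun b => b.word k).flatten := by
  induction bs generalizing i with
  | nil => rfl
  | cons b bs ih => simp [labelledWord, ih, Function.comp_def]

theorem mem_labelledWord {k i : ℕ} {bs : List (Block A)} {e : A × ℕ}
    (h : e ∈ labelledWord k i bs) : ∃ j, e.2 = i + j ∧ e.1 ∈ (blockAt bs j).word k := by
  induction bs generalizing i with
  | nil => simp [labelledWord] at h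
  | cons b bs ih =>
    rcases List.mem_append.1 h with h | h
    · obtain ⟨a, ha, rfl⟩ := List.mem_map.1 h
      exact ⟨0, rfl, ha⟩
    · obtain ⟨j, h1, h2⟩ := ih h
      exact ⟨j + 1, by omega, h2⟩

theorem pairwise_labelledWord (k i : ℕ) (bs : List (Block A)) :
    (labelledWord k i bs).Pairwise fun e e' => e.2 ≤ e'.2 := by
  induction bs generalizing i with
  | nil => exact .nil
  | cons b bs ih =>
    rw [labelledWord, List.pairwise_append]
    refine ⟨?_, ih _, ?_⟩
    · rw [List.pairwise_map]
      exact List.pairwise_of_forall fun _ _ => le_rfl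
    · intro e he e' he'
      obtain ⟨a, -, rfl⟩ := List.mem_map.1 he
      obtain ⟨j, h, -⟩ := mem_labelledWord he'
      simp only [h]
      omega

theorem piece_labelledWord (k i : ℕ) (bs : List (Block A)) (j : ℕ) (hj : j < bs.length) :
    BlockPattern.piece (i + j) (labelledWord k i bs) = (blockAt bs j).word k := by
  induction bs generalizing i j with
  | nil => simp at hj
  | cons b bs ih =>
    rw [labelledWord, BlockPattern.piece_append, BlockPattern.piece_map_const]
    cases j with
    | zero =>
      rw [if_pos (by omega), BlockPattern.piece_eq_nil, List.append_nil]
      · rfl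
      · intro e he
        obtain ⟨j, h, -⟩ := mem_labelledWord he
        omega
    | succ j =>
      rw [if_neg (by omega), List.nil_append, show i + (j + 1) = i + 1 + j by omega,
        ih _ _ (by simpa using hj)]
      rfl

theorem cut_labelledWord (k i : ℕ) (bs : List (Block A)) (j : ℕ) (hj : j < bs.length) (a : A) :
    BlockPattern.cut (i + j) a (labelledWord k i bs) =
      ∑ t ∈ Finset.range (j + 1), (blockAt bs t).wordCount k a := by
  induction bs generalizing i j with
  | nil => simp at hj
  | cons b bs ih =>
    rw [labelledWord, BlockPattern.cut_append, BlockPattern.cut_map_const, if_pos (by omega),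
      Finset.sum_range_succ', add_comm]
    congr 1
    cases j with
    | zero =>
      rw [Finset.range_zero, Finset.sum_empty, BlockPattern.cut, List.countP_eq_zero]
      intro e he
      obtain ⟨j, h, -⟩ := mem_labelledWord he
      simp only [decide_eq_true_eq]
      omega
    | succ j =>
      rw [show i + (j + 1) = i + 1 + j by omega, ih _ _ (by simpa using hj)]
      rfl

theorem tendsto_flatten_word (bs : List (Block A)) :
    Tendsto (fun k => of (FreeMonoid.ofList (bs.map fun b => b.word k).flatten)) atTop
      (𝓝 (bs.map Block.eval).prod) := by
  induction bs with
  | nil => exact tendsto_const_nhds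
  | cons b bs ih =>
    simp only [List.map_cons, List.flatten_cons, FreeMonoid.ofList_append, of_mul, List.prod_cons]
    exact b.tendsto_word.mul ih

end Approximation

/-! ### Products of blocks in normal form -/

section NormalProduct

open ProfiniteCompl ProfiniteNat Pseudoword

variable {A : Type*} [LinearOrder A]

/-- The conditions of the normal form, for a list of blocks. -/
structure IsNormalProduct (bs : List (Block A)) : Prop where
  valid : ∀ b ∈ bs, b.Valid
  incomparable : bs.IsChain Block.Incomparable
  omegaShared : bs.IsChain Block.OmegaShared

theorem IsNormalForm.exists_isNormalProduct {α : Pseudoword A} (h : IsNormalForm α) :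
    ∃ bs : List (Block A), IsNormalProduct bs ∧ α = (bs.map Block.eval).prod := by
  obtain ⟨L, b, rfl, hb⟩ := h
  have key : ∀ i, ∃ c : Block A, c.Valid ∧ c.eval = b i ∧ (c.IsInf →
      (∀ j : Fin L, (j : ℕ) + 1 = i ∨ (i : ℕ) + 1 = j →
          (alphabet (b j) \ alphabet (b i)).Nonempty) ∧
        ∀ j : Fin L, (j : ℕ) + 1 = i →
          ∀ a ∈ alphabet (b j) ∩ alphabet (b i), count a (b i) = omega) := by
    intro i
    rcases hb i with ⟨a, ha⟩ | ⟨hinf, h1, h2⟩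
    · exact ⟨.letter a, trivial, ha.symm, fun h => h.elim⟩
    · obtain ⟨l, n, hv, he⟩ := Block.exists_of_isInfiniteBlock hinf
      exact ⟨_, hv, he, fun _ => ⟨h1, h2⟩⟩
  choose c hv he hc using key
  have hal : ∀ {i j}, (alphabet (b j) \ alphabet (b i)).Nonempty →
      ¬ (c j).letters ⊆ (c i).letters := by
    rintro i j ⟨a, ha, ha'⟩ hsub
    rw [← he, Block.alphabet_eval] at ha ha'
    exact ha' (hsub ha)
  refine ⟨List.ofFn c, ⟨?_, ?_, ?_⟩, ?_⟩
  · intro d hd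
    obtain ⟨i, rfl⟩ := (List.mem_ofFn' c d).1 hd
    exact hv i
  · rw [List.isChain_iff_getElem]
    intro i hi
    simp only [List.getElem_ofFn]
    exact ⟨fun h => hal ((hc _ h).1 _ (Or.inr rfl)), fun h => hal ((hc _ h).1 _ (Or.inl rfl))⟩
  · rw [List.isChain_iff_getElem]
    intro i hi l n hln a ha hal'
    rw [List.length_ofFn] at hi
    simp only [List.getElem_ofFn] at hln ha
    have hv' := hv ⟨i + 1, hi⟩
    rw [hln] at hv'
    have hinf : (c ⟨i + 1, hi⟩).IsInf := by rw [hln]; trivial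
    have h1 := (hc _ hinf).2 ⟨i, by omega⟩ rfl a ?_
    · rwa [← he, hln, Block.count_eval hv'.nodup hal' (hv'.2.2 a hal')] at h1
    · rw [← he, ← he, Block.alphabet_eval, Block.alphabet_eval]
      exact ⟨ha, by rw [hln]; exact hal'⟩
  · rw [List.map_ofFn]
    congr 2
    ext i
    exact (he i).symm

namespace IsNormalProduct

variable {bs : List (Block A)}

theorem valid_at (h : IsNormalProduct bs) {j : ℕ} (hj : j < bs.length) : (blockAt bs j).Valid := by
  rw [blockAt_of_lt hj]
  exact h.valid _ (List.getElem_mem _)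

theorem incomparable_at (h : IsNormalProduct bs) {j : ℕ} (hj : j + 1 < bs.length) :
    (blockAt bs j).Incomparable (blockAt bs (j + 1)) := by
  rw [blockAt_of_lt hj, blockAt_of_lt (by omega)]
  exact List.isChain_iff_getElem.1 h.incomparable j hj

theorem omegaShared_at (h : IsNormalProduct bs) {j : ℕ} (hj : j + 1 < bs.length) :
    (blockAt bs j).OmegaShared (blockAt bs (j + 1)) := by
  rw [blockAt_of_lt hj, blockAt_of_lt (by omega)]
  exact List.isChain_iff_getElem.1 h.omegaShared j hj

/-- For an infinite block the first letter of the key avoids the left neighbour and the second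
avoids the right one, if these are infinite. For a letter the key is the letter itself.
Incomparability provides the choice. -/
theorem exists_key (h : IsNormalProduct bs) (j : ℕ) : ∃ w : List A, w.length ≤ 2 ∧
    (j < bs.length → w ⊆ (blockAt bs j).letters ∧
      (¬ (blockAt bs j).IsInf → w = (blockAt bs j).letters)) ∧
    (∀ i, j = i + 1 → j < bs.length → (blockAt bs i).IsInf →
      ∃ a t, w = a :: t ∧ a ∉ (blockAt bs i).letters) ∧
    (j + 1 < bs.length → (blockAt bs (j + 1)).IsInf →
      ∃ t a, w = t ++ [a] ∧ a ∉ (blockAt bs (j + 1)).letters) := by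
  by_cases hj : j < bs.length
  swap
  · exact ⟨[], by simp, fun h => absurd h hj, fun i _ h => absurd h hj, fun h => by omega⟩
  have hv := h.valid_at hj
  match hb : blockAt bs j, hv with
  | .letter a, _ =>
    refine ⟨[a], by simp, fun _ => ⟨fun _ h => h, fun _ => rfl⟩, ?_, ?_⟩
    · rintro i rfl hi hinf
      have h1 := (h.incomparable_at hi).1 hinf
      rw [hb] at h1
      exact ⟨a, [], rfl, fun ha => h1 fun c hc => by
        rw [List.mem_singleton.1 hc]; exact ha⟩
    · intro hi hinf
      have h1 := (h.incomparable_at hi).2 hinf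
      rw [hb] at h1
      exact ⟨[], a, rfl, fun ha => h1 fun c hc => by
        rw [List.mem_singleton.1 hc]; exact ha⟩
  | .infinite l n, hv =>
    obtain ⟨a₀, ha₀⟩ := List.exists_mem_of_ne_nil l hv.1
    have hfst : ∃ d ∈ l, ∀ i, j = i + 1 → (blockAt bs i).IsInf → d ∉ (blockAt bs i).letters := by
      by_cases hex : ∃ i, j = i + 1 ∧ (blockAt bs i).IsInf
      · obtain ⟨i, rfl, hinf⟩ := hex
        have h1 := (h.incomparable_at hj).1 hinf
        rw [hb] at h1
        obtain ⟨d, hd, hd'⟩ : ∃ d ∈ l, d ∉ (blockAt bs i).letters := by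
          simpa [List.subset_def, Block.letters] using h1
        refine ⟨d, hd, fun i' hi' _ => ?_⟩
        obtain rfl : i = i' := by omega
        exact hd'
      · exact ⟨a₀, ha₀, fun i hi hinf => absurd ⟨i, hi, hinf⟩ hex⟩
    have hsnd : ∃ d ∈ l, j + 1 < bs.length → (blockAt bs (j + 1)).IsInf →
        d ∉ (blockAt bs (j + 1)).letters := by
      by_cases hex : j + 1 < bs.length ∧ (blockAt bs (j + 1)).IsInf
      · have h1 := (h.incomparable_at hex.1).2 hex.2
        rw [hb] at h1
        obtain ⟨d, hd, hd'⟩ : ∃ d ∈ l, d ∉ (blockAt bs (j + 1)).letters := by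
          simpa [List.subset_def, Block.letters] using h1
        exact ⟨d, hd, fun _ _ => hd'⟩
      · exact ⟨a₀, ha₀, fun h1 h2 => absurd ⟨h1, h2⟩ hex⟩
    obtain ⟨d, hd, hd'⟩ := hfst
    obtain ⟨d₂, hd₂, hd₂'⟩ := hsnd
    refine ⟨[d, d₂], by simp, fun _ => ⟨?_, fun h => absurd trivial h⟩, ?_, ?_⟩
    · intro c hc
      simp only [List.mem_cons, List.not_mem_nil, or_false] at hc
      rcases hc with rfl | rfl
      · exact hd
      · exact hd₂
    · intro i hi _ hinf
      exact ⟨d, [d₂], rfl, hd' i hi hinf⟩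
    · intro hi hinf
      exact ⟨[d], d₂, rfl, hd₂' hi hinf⟩

/-- The pattern of a product of blocks. -/
noncomputable def pattern (h : IsNormalProduct bs) : BlockPattern A where
  L := bs.length
  B j := {a | a ∈ (blockAt bs j).letters}
  inf j := (blockAt bs j).IsInf
  key j := (h.exists_key j).choose
  finite j := List.finite_toSet _
  B_eq_empty j hj := by
    rw [blockAt_of_le hj]
    simp [Block.letters]
  key_length j := (h.exists_key j).choose_spec.1
  key_head j hinf hj := (h.exists_key (j + 1)).choose_spec.2.2.1 j rfl hj hinf
  key_last j hinf hj := (h.exists_key j).choose_spec.2.2.2 hj hinf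

/-- The numbers of occurrences of letters in the prefixes of a product of blocks, modulo `m`. -/
noncomputable def prefixCount (m : ℕ) [NeZero m] (bs : List (Block A)) (j : ℕ) (a : A) : ZMod m :=
  ∑ t ∈ Finset.range (j + 1), (blockAt bs t).res m a

theorem eventually_cut_eq (h : IsNormalProduct bs) (m : ℕ) [NeZero m] : ∀ᶠ k in atTop,
    ∀ j < bs.length, ∀ a, (BlockPattern.cut j a (labelledWord k 0 bs) : ZMod m) =
      prefixCount m bs j a := by
  have hev : ∀ᶠ k in atTop, ∀ j ∈ Finset.range bs.length, ∀ a,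
      ((blockAt bs j).wordCount k a : ZMod m) = (blockAt bs j).res m a :=
    (Filter.eventually_all_finset _).2 fun j hj =>
      Block.eventually_wordCount_eq m fun l n hln =>
        (hln ▸ h.valid_at (Finset.mem_range.1 hj) : (Block.infinite l n).Valid).nodup
  filter_upwards [hev] with k hk j hj a
  have := cut_labelledWord k 0 bs j hj a
  rw [zero_add] at this
  rw [this, prefixCount, Nat.cast_sum]
  refine Finset.sum_congr rfl fun t ht => hk t ?_ a
  rw [Finset.mem_range] at ht ⊢
  omega

theorem labelling_labelledWord (h : IsNormalProduct bs) (m : ℕ) [NeZero m] : ∀ᶠ k in atTop,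
    h.pattern.Labelling (prefixCount m bs) (labelledWord k 0 bs) := by
  filter_upwards [h.eventually_cut_eq m, eventually_ge_atTop 2] with k hk hk2
  have hpiece : ∀ j < bs.length,
      BlockPattern.piece j (labelledWord k 0 bs) = (blockAt bs j).word k := fun j hj => by
    have := piece_labelledWord k 0 bs j hj
    rwa [zero_add] at this
  refine ⟨pairwise_labelledWord k 0 bs, ?_, ?_, ?_, fun j hj a _ => hk j hj a⟩
  · intro e he
    obtain ⟨j, h1, h2⟩ := mem_labelledWord he
    obtain rfl : e.2 = j := by omega
    exact Block.subset_letters _ k h2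
  · intro j hj
    rw [hpiece j hj]
    have hlen := h.pattern.key_length j
    obtain ⟨h1, h2⟩ := (h.exists_key j).choose_spec.2.1 hj
    change (h.pattern.key j ⊆ _) at h1
    change (_ → h.pattern.key j = _) at h2
    match hb : blockAt bs j with
    | .letter a =>
      rw [hb] at h2
      rw [h2 id]
      exact List.Sublist.refl _
    | .infinite l n =>
      rw [hb] at h1
      -- Each of the at most two key letters is found in its own copy of `l`, and there are k! ≥ 2
      -- copies.
      refine (List.sublist_flatten_replicate h1 ?_).trans (List.sublist_append_left _ _)
      exact hlen.trans (hk2.trans (Nat.self_le_factorial k))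
  · intro j hj hni
    rw [hpiece j hj]
    change ¬ (blockAt bs j).IsInf at hni
    match hb : blockAt bs j with
    | .letter a => exact le_rfl
    | .infinite l n => rw [hb] at hni; exact absurd trivial hni

end IsNormalProduct

end NormalProduct

/-! ### Uniqueness of normal forms -/

section Uniqueness

open ProfiniteCompl ProfiniteNat Pseudoword

variable {A : Type*}

/-- In z every letter carries its label from y first and its label from x second. -/
theorem exists_common_labelling {x y : List (A × ℕ)} (h : x.map Prod.fst = y.map Prod.fst) :
    ∃ z : List (A × ℕ × ℕ), z.map (fun e => (e.1, e.2.1)) = y ∧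
      z.map (fun e => (e.1, e.2.2)) = x := by
  induction x generalizing y with
  | nil => exact ⟨[], by simpa using h.symm, rfl⟩
  | cons e x ih =>
    cases y with
    | nil => simp at h
    | cons e' y =>
      rw [List.map_cons, List.map_cons, List.cons.injEq] at h
      obtain ⟨z, hz, hz'⟩ := ih h.2
      exact ⟨(e'.1, e'.2, e.2) :: z, by simp [hz], by simp [hz', ← h.1]⟩

/-- A monotone self-map of the indices of a sequence of blocks that only enlarges blocks is the
identity. -/
theorem eq_self_of_subset {L : ℕ} {B : ℕ → List A} {inf : ℕ → Prop} {h : ℕ → ℕ}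
    (hL : ∀ j < L, h j < L) (hmono : ∀ i < L, ∀ j < L, i < j → h i ≤ h j)
    (hsub : ∀ j < L, B j ⊆ B (h j))
    (hinj : ∀ i < L, ∀ j < L, ¬ inf (h i) → h i = h j → i = j)
    (hinc : ∀ j, j + 1 < L → (inf j → ¬ B (j + 1) ⊆ B j) ∧ (inf (j + 1) → ¬ B j ⊆ B (j + 1))) :
    ∀ j < L, h j = j := by
  -- This descends from the end of the sequence; the lower bound is proved symmetrically from its
  -- beginning.
  have hle : ∀ d j, j < L → L ≤ j + d → h j ≤ j := by
    intro d
    induction d with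
    | zero => intro j hj hj'; omega
    | succ d ih =>
      intro j hj hjd
      by_contra! hlt
      have h1 := hL j hj
      have hj1 : j + 1 < L := by omega
      have h2 := ih (j + 1) hj1 (by omega)
      have h3 := hmono j hj (j + 1) hj1 (by omega)
      have h4 : h (j + 1) = j + 1 := by omega
      have h5 : h j = j + 1 := by omega
      have h6 := hsub j hj
      rw [h5] at h6
      -- Blocks j and j + 1 are both sent to j + 1. This contradicts incomparability if j + 1 is
      -- infinite, and injectivity otherwise.
      by_cases hi : inf (j + 1)
      · exact (hinc j hj1).2 hi h6
      · have := hinj (j + 1) hj1 j hj (by rwa [h4]) (by omega)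
        omega
  intro j hj
  refine le_antisymm (hle L j hj (by omega)) ?_
  induction j with
  | zero => exact Nat.zero_le _
  | succ j ih =>
    by_contra! hlt
    have hj' : j < L := by omega
    have h1 := ih hj'
    have h2 := hmono j hj' (j + 1) hj (by omega)
    have h4 : h j = j := by omega
    have h5 : h (j + 1) = j := by omega
    have h6 := hsub (j + 1) hj
    rw [h5] at h6
    by_cases hi : inf j
    · exact (hinc j hj).1 hi h6
    · have := hinj j hj' (j + 1) hj (by rwa [h4]) (by omega)
      omega

/-- The two labels of a word with two labellings. -/
def Overlap (z : List (A × ℕ × ℕ)) (i j : ℕ) : Prop := ∃ e ∈ z, e.2.1 = i ∧ e.2.2 = j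

theorem le_or_le_of_sorted {x y : List (A × ℕ)} {z : List (A × ℕ × ℕ)}
    (hzy : z.map (fun e => (e.1, e.2.1)) = y) (hzx : z.map (fun e => (e.1, e.2.2)) = x)
    (hx : x.Pairwise fun e e' => e.2 ≤ e'.2) (hy : y.Pairwise fun e e' => e.2 ≤ e'.2)
    {e e' : A × ℕ × ℕ} (he : e ∈ z) (he' : e' ∈ z) :
    (e.2.1 ≤ e'.2.1 ∧ e.2.2 ≤ e'.2.2) ∨ (e'.2.1 ≤ e.2.1 ∧ e'.2.2 ≤ e.2.2) := by
  rw [← hzx, List.pairwise_map] at hx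
  rw [← hzy, List.pairwise_map] at hy
  have := hy.and hx
  clear hx hy hzx hzy
  induction z with
  | nil => simp at he
  | cons c z ih =>
    rw [List.pairwise_cons] at this
    rcases List.mem_cons.1 he with rfl | hez
    · rcases List.mem_cons.1 he' with rfl | hez'
      · exact Or.inl ⟨le_rfl, le_rfl⟩
      · exact Or.inl (this.1 e' hez')
    · rcases List.mem_cons.1 he' with rfl | hez'
      · exact Or.inr (this.1 e hez)
      · exact ih hez hez' this.2

/-- A piece that is not infinite has at most one letter, so at most one index of the other labelling
can meet it. -/
theorem overlap_injective {P : BlockPattern A} {m : ℕ} {C : ℕ → A → ZMod m} {x : List (A × ℕ)}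
    {z : List (A × ℕ × ℕ)} (hx : P.Labelling C x) (hzx : z.map (fun e => (e.1, e.2.2)) = x)
    {i i' j : ℕ} (hj : j < P.L) (hni : ¬ P.inf j) (h : Overlap z i j) (h' : Overlap z i' j) :
    i = i' := by
  obtain ⟨e, he, rfl, hej⟩ := h
  obtain ⟨e', he', rfl, hej'⟩ := h'
  have h1 := hx.short j hj hni
  rw [BlockPattern.piece, ← hzx, List.filter_map, List.length_map, List.length_map] at h1
  have hmem : ∀ {d}, d ∈ z → d.2.2 = j →
      d ∈ z.filter ((fun e : A × ℕ => decide (e.2 = j)) ∘ fun e => (e.1, e.2.2)) :=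
    fun hd hdj => List.mem_filter.2 ⟨hd, by simpa using hdj⟩
  have h2 := hmem he hej
  have h3 := hmem he' hej'
  match hf : z.filter ((fun e : A × ℕ => decide (e.2 = j)) ∘ fun e => (e.1, e.2.2)), h1, h2, h3 with
  | [], _, h2, _ => simp [hf] at h2
  | [d], _, h2, h3 =>
    rw [hf] at h2 h3
    rw [List.mem_singleton.1 h2, List.mem_singleton.1 h3]
  | _ :: _ :: _, h1, _, _ => rw [hf] at h1; simp at h1

variable [LinearOrder A]

namespace IsNormalProduct

variable {bs cs : List (Block A)}

/-- A labelling of a word approximating a product of blocks by the blocks of another pattern assigns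
to each block a larger block. -/
theorem exists_overlap (hc : IsNormalProduct cs) {P : BlockPattern A} {m k : ℕ}
    {C : ℕ → A → ZMod m} {x : List (A × ℕ)} {z : List (A × ℕ × ℕ)} (hx : P.Labelling C x)
    (hk : 2 * (P.L + 1) ≤ k.factorial)
    (hzy : z.map (fun e => (e.1, e.2.1)) = labelledWord k 0 cs)
    (hzx : z.map (fun e => (e.1, e.2.2)) = x) {i : ℕ} (hi : i < cs.length) :
    ∃ j < P.L, (∀ a ∈ (blockAt cs i).letters, a ∈ P.B j) ∧
      ((blockAt cs i).IsInf → P.inf j) ∧ Overlap z i j := by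
  have hpiece := piece_labelledWord k 0 cs i hi
  rw [zero_add] at hpiece
  match hb : blockAt cs i with
  | .letter a =>
    rw [hb] at hpiece
    have ha : a ∈ BlockPattern.piece i (labelledWord k 0 cs) := by
      rw [hpiece]; exact List.mem_singleton_self a
    rw [BlockPattern.mem_piece, ← hzy, List.mem_map] at ha
    obtain ⟨e, he, hea⟩ := ha
    obtain ⟨rfl, rfl⟩ := Prod.mk.inj hea
    have hex : (e.1, e.2.2) ∈ x := by rw [← hzx]; exact List.mem_map_of_mem he
    have hB := hx.mem _ hex
    refine ⟨e.2.2, P.lt_of_mem hB, fun c hc' => ?_, fun h => h.elim, e, he, rfl, rfl⟩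
    rw [List.mem_singleton.1 hc']
    exact hB
  | .infinite l n =>
    have hv := hc.valid_at hi
    rw [hb] at hpiece hv
    let zi := z.filter fun e => e.2.1 = i
    have hzi : zi.map Prod.fst = (Block.infinite l n).word k := by
      rw [← hpiece, BlockPattern.piece, ← hzy, List.filter_map, List.map_map]
      rfl
    let xs := zi.map fun e => (e.1, e.2.2)
    have hxs : xs.Sublist x := by
      rw [← hzx]
      exact (List.filter_sublist (p := fun e : A × ℕ × ℕ => decide (e.2.1 = i))).map _
    obtain ⟨r, hr⟩ := Nat.exists_eq_add_of_le hk
    -- Copies of `l` are taken in pairs so that a pair with a constant label has at least two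
    -- letters and forces an infinite block.
    have hword : (Block.infinite l n).word k = (List.replicate (P.L + 1) (l ++ l)).flatten ++
        ((List.replicate r l).flatten ++
          l.flatMap fun a => List.replicate ((n a).approx k) a) := by
      have hdouble : ∀ N : ℕ, (List.replicate (2 * N) l).flatten =
          (List.replicate N (l ++ l)).flatten := by
        intro N
        induction N with
        | zero => rfl
        | succ N ih =>
          rw [show 2 * (N + 1) = 2 * N + 1 + 1 by ring]
          simp only [List.replicate_succ, List.flatten_cons, ih, List.append_assoc]
      rw [Block.word, hr, List.replicate_add, List.flatten_append, hdouble, List.append_assoc]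
    obtain ⟨j, X, hX, hXl, hXj⟩ := exists_constant_copy P.L 0 xs
      (by rw [← hword, ← hzi, List.map_map]; rfl) (hx.sorted.sublist hxs) fun e he => by
        have := P.lt_of_mem (hx.mem e (hxs.subset he))
        omega
    have hXB : ∀ a ∈ l, a ∈ P.B j := by
      intro a ha
      have : a ∈ X.map Prod.fst := by rw [hXl]; exact List.mem_append_left _ ha
      obtain ⟨e, he, rfl⟩ := List.mem_map.1 this
      rw [← hXj e he]
      exact hx.mem e (hxs.subset (hX.subset he))
    obtain ⟨a₀, ha₀⟩ := List.exists_mem_of_ne_nil l hv.1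
    have hjL := P.lt_of_mem (hXB a₀ ha₀)
    refine ⟨j, hjL, hXB, fun _ => ?_, ?_⟩
    · by_contra hni
      have h1 := hx.short j hjL hni
      have h2 : (l ++ l).Sublist (BlockPattern.piece j x) := by
        rw [← hXl, BlockPattern.piece]
        refine List.Sublist.map _ ?_
        have h3 := (hX.trans hxs).filter fun e => decide (e.2 = j)
        rwa [List.filter_eq_self.2 fun e he => by simpa using hXj e he] at h3
      have h4 := h2.length_le
      have h5 := List.length_pos_of_mem ha₀
      rw [List.length_append] at h4
      omega
    · have : a₀ ∈ X.map Prod.fst := by rw [hXl]; exact List.mem_append_left _ ha₀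
      obtain ⟨e, he, -⟩ := List.mem_map.1 this
      obtain ⟨e', he', hee'⟩ := List.mem_map.1 (hX.subset he)
      refine ⟨e', (List.mem_filter.1 he').1, by simpa using (List.mem_filter.1 he').2, ?_⟩
      rw [← hXj e he, ← hee']

/-- Two products of blocks, words for which are in the languages of each other, have the same
blocks, up to the exponents. -/
theorem same_blocks (hb : IsNormalProduct bs) (hc : IsNormalProduct cs) {m k : ℕ}
    {C D : ℕ → A → ZMod m} {x y : List (A × ℕ)} {z w : List (A × ℕ × ℕ)}
    (hx : hb.pattern.Labelling C x) (hy : hc.pattern.Labelling D y)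
    (hkb : 2 * (bs.length + 1) ≤ k.factorial) (hkc : 2 * (cs.length + 1) ≤ k.factorial)
    (hzc : z.map (fun e => (e.1, e.2.1)) = labelledWord k 0 cs)
    (hzx : z.map (fun e => (e.1, e.2.2)) = x)
    (hwb : w.map (fun e => (e.1, e.2.1)) = labelledWord k 0 bs)
    (hwy : w.map (fun e => (e.1, e.2.2)) = y) :
    bs.length = cs.length ∧ ∀ j < bs.length,
      (∀ a, a ∈ (blockAt bs j).letters ↔ a ∈ (blockAt cs j).letters) ∧
      ((blockAt bs j).IsInf ↔ (blockAt cs j).IsInf) ∧ Overlap z j j := by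
  have hf : ∀ i, ∃ j, i < cs.length → j < bs.length ∧
      (blockAt cs i).letters ⊆ (blockAt bs j).letters ∧
      ((blockAt cs i).IsInf → (blockAt bs j).IsInf) ∧ Overlap z i j := by
    intro i
    by_cases hi : i < cs.length
    · obtain ⟨j, h1, h2, h3, h4⟩ := hc.exists_overlap hx hkb hzc hzx hi
      exact ⟨j, fun _ => ⟨h1, h2, h3, h4⟩⟩
    · exact ⟨0, fun h => absurd h hi⟩
  have hg : ∀ j, ∃ i, j < bs.length → i < cs.length ∧
      (blockAt bs j).letters ⊆ (blockAt cs i).letters ∧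
      ((blockAt bs j).IsInf → (blockAt cs i).IsInf) ∧ Overlap w j i := by
    intro j
    by_cases hj : j < bs.length
    · obtain ⟨i, h1, h2, h3, h4⟩ := hb.exists_overlap hy hkc hwb hwy hj
      exact ⟨i, fun _ => ⟨h1, h2, h3, h4⟩⟩
    · exact ⟨0, fun h => absurd h hj⟩
  choose f hf using hf
  choose g hg using hg
  have hmono : ∀ {x y : List (A × ℕ)} {z : List (A × ℕ × ℕ)} {i i' j j'}
      (_ : z.map (fun e => (e.1, e.2.1)) = y) (_ : z.map (fun e => (e.1, e.2.2)) = x)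
      (_ : x.Pairwise fun e e' => e.2 ≤ e'.2) (_ : y.Pairwise fun e e' => e.2 ≤ e'.2),
      Overlap z i j → Overlap z i' j' → i < i' → j ≤ j' := by
    rintro x y z _ _ _ _ hzy hzx hx hy ⟨e, he, rfl, rfl⟩ ⟨e', he', rfl, rfl⟩ hlt
    have := le_or_le_of_sorted hzy hzx hx hy he he'
    omega
  have hfm : ∀ i < cs.length, ∀ i' < cs.length, i < i' → f i ≤ f i' := fun i hi i' hi' hlt =>
    hmono hzc hzx hx.sorted (pairwise_labelledWord k 0 cs) (hf i hi).2.2.2 (hf i' hi').2.2.2 hlt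
  have hgm : ∀ j < bs.length, ∀ j' < bs.length, j < j' → g j ≤ g j' := fun j hj j' hj' hlt =>
    hmono hwb hwy hy.sorted (pairwise_labelledWord k 0 bs) (hg j hj).2.2.2 (hg j' hj').2.2.2 hlt
  have hfi : ∀ i < cs.length, ∀ i' < cs.length, ¬ (blockAt bs (f i)).IsInf → f i = f i' →
      i = i' := fun i hi i' hi' hni heq =>
    overlap_injective hx hzx (hf i hi).1 hni (hf i hi).2.2.2 (heq ▸ (hf i' hi').2.2.2)
  have hgi : ∀ j < bs.length, ∀ j' < bs.length, ¬ (blockAt cs (g j)).IsInf → g j = g j' →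
      j = j' := fun j hj j' hj' hni heq =>
    overlap_injective hy hwy (hg j hj).1 hni (hg j hj).2.2.2 (heq ▸ (hg j' hj').2.2.2)
  have hle : ∀ {i i' : ℕ} {h : ℕ → ℕ} {L : ℕ} (_ : ∀ i < L, ∀ i' < L, i < i' → h i ≤ h i'),
      i < L → i' < L → i ≤ i' → h i ≤ h i' := by
    intro i i' h L hm hi hi' hle
    rcases hle.lt_or_eq with hlt | rfl
    · exact hm i hi i' hi' hlt
    · exact le_rfl
  -- The composite is monotone and only enlarges blocks. If it hits a block that is not infinite,
  -- both of its factors are injective there.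
  have hgf : ∀ i < cs.length, g (f i) = i := by
    refine eq_self_of_subset (B := fun i => (blockAt cs i).letters)
      (inf := fun i => (blockAt cs i).IsInf) (h := fun i => g (f i))
      (fun i hi => (hg _ (hf i hi).1).1) ?_ ?_ ?_ fun i hi => hc.incomparable_at hi
    · intro i hi i' hi' hlt
      exact hle hgm (hf i hi).1 (hf i' hi').1 (hfm i hi i' hi' hlt)
    · intro i hi
      exact List.Subset.trans (hf i hi).2.1 (hg _ (hf i hi).1).2.1
    · intro i hi i' hi' hni heq
      have h1 := hgi _ (hf i hi).1 _ (hf i' hi').1 hni heq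
      exact hfi i hi i' hi' (fun h => hni ((hg _ (hf i hi).1).2.2.1 h)) h1
  have hfg : ∀ j < bs.length, f (g j) = j := by
    refine eq_self_of_subset (B := fun i => (blockAt bs i).letters)
      (inf := fun i => (blockAt bs i).IsInf) (h := fun i => f (g i))
      (fun i hi => (hf _ (hg i hi).1).1) ?_ ?_ ?_ fun i hi => hb.incomparable_at hi
    · intro i hi i' hi' hlt
      exact hle hfm (hg i hi).1 (hg i' hi').1 (hgm i hi i' hi' hlt)
    · intro i hi
      exact List.Subset.trans (hg i hi).2.1 (hf _ (hg i hi).1).2.1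
    · intro i hi i' hi' hni heq
      have h1 := hfi _ (hg i hi).1 _ (hg i' hi').1 hni heq
      exact hgi i hi i' hi' (fun h => hni ((hf _ (hg i hi).1).2.2.1 h)) h1
  -- Having a left inverse, f is strictly increasing. The same holds for g, and g (f i) = i then
  -- leaves only f i = i.
  have hfge : ∀ i < cs.length, i ≤ f i := by
    intro i
    induction i with
    | zero => exact fun _ => Nat.zero_le _
    | succ i ih =>
      intro hi
      have h1 := ih (by omega)
      have h2 := hfm i (by omega) (i + 1) hi (by omega)
      have h3 : f i ≠ f (i + 1) := fun h => by
        have h4 := hgf i (by omega)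
        rw [h, hgf (i + 1) hi] at h4
        omega
      omega
  have hgge : ∀ j < bs.length, j ≤ g j := by
    intro j
    induction j with
    | zero => exact fun _ => Nat.zero_le _
    | succ j ih =>
      intro hj
      have h1 := ih (by omega)
      have h2 := hgm j (by omega) (j + 1) hj (by omega)
      have h3 : g j ≠ g (j + 1) := fun h => by
        have h4 := hfg j (by omega)
        rw [h, hfg (j + 1) hj] at h4
        omega
      omega
  have hfid : ∀ i < cs.length, f i = i := by
    intro i hi
    have h1 := hfge i hi
    have h2 := hgge _ (hf i hi).1
    rw [hgf i hi] at h2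
    omega
  have hlen : bs.length = cs.length := by
    refine le_antisymm ?_ ?_
    · by_contra! hlt
      have h1 := hgge cs.length hlt
      have h2 := (hg cs.length hlt).1
      omega
    · by_contra! hlt
      have h1 := hfge bs.length hlt
      have h2 := (hf bs.length hlt).1
      omega
  refine ⟨hlen, fun j hj => ?_⟩
  have hj' : j < cs.length := hlen ▸ hj
  have hfj := hfid j hj'
  have hgj : g j = j := by
    have := hgf j hj'
    rwa [hfj] at this
  obtain ⟨h1, h2, h3, h4⟩ := hf j hj'
  obtain ⟨h1', h2', h3', -⟩ := hg j hj
  rw [hfj] at h2 h3 h4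
  rw [hgj] at h2' h3'
  exact ⟨fun a => ⟨fun h => h2' h, fun h => h2 h⟩, ⟨h3', h3⟩, h4⟩

/-- Each index has a position that carries it as both labels. Between such positions, a letter
counted by only one of the labellings at cut j has labels j and j + 1, hence occurs in both blocks
at the cut. -/
theorem cut_eq_of_overlap (hb : IsNormalProduct bs) {m k : ℕ}
    {C : ℕ → A → ZMod m} {x : List (A × ℕ)} {z : List (A × ℕ × ℕ)}
    (hx : hb.pattern.Labelling C x)
    (hzc : z.map (fun e => (e.1, e.2.1)) = labelledWord k 0 cs)
    (hzx : z.map (fun e => (e.1, e.2.2)) = x) (hlen : bs.length = cs.length)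
    (hsame : ∀ j < bs.length,
      (∀ a, a ∈ (blockAt bs j).letters ↔ a ∈ (blockAt cs j).letters) ∧
      ((blockAt bs j).IsInf ↔ (blockAt cs j).IsInf) ∧ Overlap z j j)
    {j : ℕ} (hj : j < bs.length) {a : A}
    (ha : a ∉ (blockAt bs j).letters ∨ a ∉ (blockAt bs (j + 1)).letters) :
    BlockPattern.cut j a x = BlockPattern.cut j a (labelledWord k 0 cs) := by
  have hcmp : ∀ {e e'}, e ∈ z → e' ∈ z → _ := fun he he' =>
    le_or_le_of_sorted hzc hzx hx.sorted (pairwise_labelledWord k 0 cs) he he'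
  rw [← hzc, ← hzx, BlockPattern.cut, BlockPattern.cut, List.countP_map, List.countP_map]
  refine List.countP_congr fun e he => ?_
  simp only [Function.comp_apply, decide_eq_true_eq]
  refine and_congr_right fun hea => ?_
  have hxB : a ∈ (blockAt bs e.2.2).letters := by
    have := hx.mem (e.1, e.2.2) (by rw [← hzx]; exact List.mem_map_of_mem he)
    rw [hea] at this
    exact this
  have hyB : a ∈ (blockAt cs e.2.1).letters := by
    obtain ⟨t, ht, hta⟩ := mem_labelledWord (e := (e.1, e.2.1))
      (by rw [← hzc]; exact List.mem_map_of_mem he)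
    rw [zero_add] at ht
    simp only at ht hta
    rw [ht, ← hea]
    exact Block.subset_letters _ k hta
  have hlx : e.2.2 < bs.length := by
    by_contra! hle
    rw [blockAt_of_le hle] at hxB
    simp [Block.letters] at hxB
  have hly : e.2.1 < bs.length := by
    by_contra! hle
    rw [blockAt_of_le (hlen ▸ hle)] at hyB
    simp [Block.letters] at hyB
  have hyB' : a ∈ (blockAt bs e.2.1).letters := ((hsame _ hly).1 a).2 hyB
  by_contra hne
  have hboth : a ∈ (blockAt bs j).letters ∧ a ∈ (blockAt bs (j + 1)).letters := by
    have hj1 : j + 1 < bs.length := by omega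
    obtain ⟨e₁, he₁, h1, h2⟩ := (hsame j hj).2.2
    obtain ⟨e₂, he₂, h3, h4⟩ := (hsame (j + 1) hj1).2.2
    have h5 := hcmp he he₁
    have h6 := hcmp he he₂
    -- Any two positions are comparable in both labels at once; comparison with the positions
    -- labelled (j, j) and (j + 1, j + 1) leaves only these cases.
    have h7 : (e.2.1 = j ∧ e.2.2 = j + 1) ∨ (e.2.1 = j + 1 ∧ e.2.2 = j) := by omega
    rcases h7 with ⟨h7, h8⟩ | ⟨h7, h8⟩
    · rw [h8] at hxB; rw [h7] at hyB'
      exact ⟨hyB', hxB⟩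
    · rw [h8] at hxB; rw [h7] at hyB'
      exact ⟨hxB, hyB'⟩
  exact ha.elim (· hboth.1) (· hboth.2)

theorem prefixCount_eq (hb : IsNormalProduct bs) (hc : IsNormalProduct cs)
    (h : DAbSatisfies (bs.map Block.eval).prod (cs.map Block.eval).prod) (m : ℕ) [NeZero m] :
    bs.length = cs.length ∧ ∀ j < bs.length,
      (∀ a, a ∈ (blockAt bs j).letters ↔ a ∈ (blockAt cs j).letters) ∧
      ((blockAt bs j).IsInf ↔ (blockAt cs j).IsInf) ∧
      ∀ a, a ∉ (blockAt bs j).letters ∨ a ∉ (blockAt bs (j + 1)).letters →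
        prefixCount m bs j a = prefixCount m cs j a := by
  have htb := tendsto_flatten_word bs
  have htc := tendsto_flatten_word cs
  -- For one large k, the approximating words of both products lie in both languages.
  obtain ⟨k, h1, h2, h3, h4, h5, h6, h7⟩ :=
    ((hb.pattern.eventually_mem_lang_iff (prefixCount m bs) h htb htc).and
      ((hc.pattern.eventually_mem_lang_iff (prefixCount m cs) h htb htc).and
        ((hb.labelling_labelledWord m).and ((hc.labelling_labelledWord m).and
          ((hc.eventually_cut_eq m).and
            ((tendsto_factorial.eventually_ge_atTop (2 * (bs.length + 1))).and
              (tendsto_factorial.eventually_ge_atTop (2 * (cs.length + 1))))))))).exists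
  obtain ⟨x, hx, hxw⟩ := h1.1 ⟨_, h3, map_fst_labelledWord k 0 bs⟩
  obtain ⟨y, hy, hyw⟩ := h2.2 ⟨_, h4, map_fst_labelledWord k 0 cs⟩
  obtain ⟨z, hzc, hzx⟩ := exists_common_labelling
    (hxw.trans (map_fst_labelledWord k 0 cs).symm)
  obtain ⟨w, hwb, hwy⟩ := exists_common_labelling
    (hyw.trans (map_fst_labelledWord k 0 bs).symm)
  obtain ⟨hlen, hsame⟩ := hb.same_blocks hc hx hy h6 h7 hzc hzx hwb hwy
  refine ⟨hlen, fun j hj => ⟨(hsame j hj).1, (hsame j hj).2.1, fun a ha => ?_⟩⟩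
  rw [← hx.count j hj a ha, ← h5 j (hlen ▸ hj) a,
    hb.cut_eq_of_overlap hx hzc hzx hlen hsame hj ha]

/-- The count in a block is the difference of two prefix counts, so it suffices to recover the
prefix counts that the language does not prescribe. -/
theorem res_eq (hb : IsNormalProduct bs) (hc : IsNormalProduct cs)
    (h : DAbSatisfies (bs.map Block.eval).prod (cs.map Block.eval).prod) (m : ℕ) [NeZero m]
    {j : ℕ} (hj : j < bs.length) (a : A) :
    (blockAt bs j).res m a = (blockAt cs j).res m a := by
  obtain ⟨hlen, hsame⟩ := hb.prefixCount_eq hc h m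
  have hstep : ∀ j (cs : List (Block A)), prefixCount m cs (j + 1) a =
      prefixCount m cs j a + (blockAt cs (j + 1)).res m a := fun j cs => Finset.sum_range_succ _ _
  -- A letter shared with the left neighbour has exponent ω in an infinite block on either side, and
  -- occurs once in a letter block.
  have hshared : ∀ j, j + 1 < bs.length → a ∈ (blockAt bs j).letters →
      a ∈ (blockAt bs (j + 1)).letters →
        (blockAt bs (j + 1)).res m a = (blockAt cs (j + 1)).res m a := by
    intro j hj ha ha'
    have ho := hb.omegaShared_at hj
    have ho' := hc.omegaShared_at (hlen ▸ hj)
    have hac := ((hsame j (by omega)).1 a).1 ha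
    have hac' := ((hsame (j + 1) hj).1 a).1 ha'
    have hinf := (hsame (j + 1) hj).2.1
    match hbj : blockAt bs (j + 1), hcj : blockAt cs (j + 1) with
    | .letter d, .letter d' =>
      rw [hbj] at ha'
      rw [hcj] at hac'
      rw [← List.mem_singleton.1 ha', ← List.mem_singleton.1 hac']
    | .letter d, .infinite l n => rw [hbj, hcj] at hinf; exact (hinf.2 trivial).elim
    | .infinite l n, .letter d => rw [hbj, hcj] at hinf; exact (hinf.1 trivial).elim
    | .infinite l n, .infinite l' n' =>
      rw [hbj] at ha'
      rw [hcj] at hac'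
      have hal : a ∈ l := ha'
      have hal' : a ∈ l' := hac'
      rw [Block.res, Block.res, if_pos hal, if_pos hal', ho l n hbj a ha ha',
        ho' l' n' hcj a hac hac']
  have hprefix : ∀ d j, j < bs.length → bs.length ≤ j + 1 + d →
      prefixCount m bs j a = prefixCount m cs j a := by
    intro d
    induction d with
    | zero =>
      intro j hj hjd
      -- Beyond the last block `blockAt` has no letters, so the total count of every letter is
      -- prescribed.
      refine (hsame j hj).2.2 a (Or.inr ?_)
      rw [blockAt_of_le hjd]
      simp [Block.letters]
    | succ d ih =>
      intro j hj hjd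
      by_cases ha : a ∉ (blockAt bs j).letters ∨ a ∉ (blockAt bs (j + 1)).letters
      · exact (hsame j hj).2.2 a ha
      · push Not at ha
        have hj1 : j + 1 < bs.length := by
          by_contra! hle
          rw [blockAt_of_le hle] at ha
          simp [Block.letters] at ha
        have h1 := ih (j + 1) hj1 (by omega)
        rw [hstep, hstep, hshared j hj1 ha.1 ha.2] at h1
        exact add_right_cancel h1
  cases j with
  | zero => simpa [prefixCount] using hprefix bs.length 0 hj (by omega)
  | succ j =>
    have h1 := hprefix bs.length (j + 1) hj (by omega)
    rw [hstep, hstep, hprefix bs.length j (by omega) (by omega)] at h1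
    exact add_left_cancel h1

theorem prod_eq_of_dAbSatisfies (hb : IsNormalProduct bs) (hc : IsNormalProduct cs)
    (h : DAbSatisfies (bs.map Block.eval).prod (cs.map Block.eval).prod) :
    (bs.map Block.eval).prod = (cs.map Block.eval).prod := by
  -- The number, letters and types of the blocks do not depend on the modulus, so the trivial one
  -- serves here.
  obtain ⟨hlen, hsame⟩ := hb.prefixCount_eq hc h 1
  congr 1
  refine List.ext_getElem (by simpa using hlen) fun j hj hj' => ?_
  rw [List.length_map] at hj hj'
  rw [List.getElem_map, List.getElem_map, ← blockAt_of_lt hj, ← blockAt_of_lt hj']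
  obtain ⟨hlet, hinf, -⟩ := hsame j hj
  have hres := fun (m : ℕ) [NeZero m] a => hb.res_eq hc h m hj a
  have hvb := hb.valid_at hj
  have hvc := hc.valid_at hj'
  match hbj : blockAt bs j, hcj : blockAt cs j with
  | .letter d, .letter d' =>
    rw [hbj, hcj] at hlet
    rw [List.mem_singleton.1 ((hlet d).1 (List.mem_singleton_self d))]
  | .letter d, .infinite l n => rw [hbj, hcj] at hinf; exact (hinf.2 trivial).elim
  | .infinite l n, .letter d => rw [hbj, hcj] at hinf; exact (hinf.1 trivial).elim
  | .infinite l n, .infinite l' n' =>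
    rw [hbj] at hvb hlet hres
    rw [hcj] at hvc hlet hres
    obtain rfl : l = l' :=
      List.Perm.eq_of_pairwise (fun a b _ _ h1 h2 => absurd h2 (lt_asymm h1)) hvb.pairwise
        hvc.pairwise ((List.perm_ext_iff_of_nodup hvb.nodup hvc.nodup).2 hlet)
    refine Block.eval_congr fun a ha => ?_
    refine (hvb.2.2 a ha).eq_of_residue_eq (hvc.2.2 a ha) fun m _ => ?_
    have := hres m a
    rwa [Block.res, Block.res, if_pos ha, if_pos ha] at this

end IsNormalProduct

end Uniqueness

theorem mainTheorem2 {A : Type*} [LinearOrder A] (α : Pseudoword A) :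
    ∃! α' : Pseudoword A, IsNormalForm α' ∧ DAbSatisfies α α' := by
  obtain ⟨α', h1, h2⟩ := exists_isNormalForm α
  refine ⟨α', ⟨h1, h2⟩, ?_⟩
  rintro β ⟨h3, h4⟩
  obtain ⟨bs, hb, rfl⟩ := h3.exists_isNormalProduct
  obtain ⟨cs, hc, rfl⟩ := h1.exists_isNormalProduct
  exact hb.prod_eq_of_dAbSatisfies hc (h4.symm.trans h2)
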